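/- Let $n\ge 1$ and let $\mathbf R^{n+3}_2$ be $\mathbf R^{n+3}$ with the scalar product $\langle x,y\rangle=-x^0y^0+x^1y^1+\dots+x^{n+1}y^{n+1}-x^{n+2}y^{n+2}$. Let $Q\subset P^{n+2}$ be the Lie quadric $\langle x,x\rangle=0$ and let $\Lambda^{2n-1}$ be the contact manifold of projective lines lying on $Q$. A Legendre submanifold is a smooth ($C^\infty$) immersion $\lambda:M^{n-1}\to\Lambda^{2n-1}$ that annihilates the contact form; locally $\lambda=[Y_0,Y_1]$ with smooth $Y_0,Y_1$, and the contact condition says $\langle dY_0,Y_1\rangle=0$. A point $[K]=[rY_0(p)+sY_1(p)]$ of the line $\lambda(p)$ is a curvature sphere of $\lambda$ at $p$ if there is a nonzero $X\in T_pM$ with $r\,dY_0(X)+s\,dY_1(X)\in\operatorname{Span}\{Y_0(p),Y_1(p)\}$; the vectors $X$ with this property form the principal space of $[K]$. A curvature surface is a connected smooth submanifold $S$ of $M$ whose tangent space at each point is equal to a principal space. $\lambda$ is Dupin if along each curvature surface the corresponding curvature sphere is constant, and proper Dupin if moreover the number of distinct curvature spheres at a point is constant on $M$. A Legendre submanifold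 $\lambda$ is called reducible on a nonempty open set $O\subset M$ if some curvature sphere map (a smooth map $O\to P^{n+2}$ whose value at each point is a curvature sphere of $\lambda$ at that point) takes $O$ into a fixed linear subspace of $P^{n+2}$ of codimension at least two. It is reducible if it is reducible on $M$, irreducible if it is not reducible, and locally irreducible if it is not reducible on any nonempty open subset of $M$. Proposition. Let $M^{n-1}$ be a connected smooth manifold and let $\lambda:M^{n-1}\to\Lambda^{2n-1}$ be a proper Dupin submanifold. If $\lambda$ is reducible on some nonempty open subset $U$ of $M$, then $\lambda$ is reducible. Consequently, $\lambda$ is locally irreducible if and only if it is irreducible. -/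

import Mathlib

open scoped Manifold ContDiff LinearAlgebra.Projectivization

/-!
Legendre and Dupin submanifolds in Lie sphere geometry. Throughout `m = n - 1` is the dimension of
the domain `M`, so that the ambient sphere is `S^(m+1)` and the ambient vector space is
`ℝ^(n+3) = ℝ^(m+4)` with a scalar product of signature `(n+1, 2) = (m+2, 2)`.
-/

/-- The vector space `ℝ^(n+3)`, with coordinates `x 0, …, x (n+2)`, where `n = m + 1`. -/
abbrev LieSpace (m : ℕ) : Type := EuclideanSpace ℝ (Fin (m + 4))

/-- The scalar product of signature `(n+1, 2)`:
`⟨x,y⟩ = - x⁰y⁰ + x¹y¹ + ⋯ + xⁿ⁺¹yⁿ⁺¹ - xⁿ⁺²yⁿ⁺²`. -/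
noncomputable def lieInner {m : ℕ} (x y : LieSpace m) : ℝ :=
  ∑ i : Fin (m + 4), (if i = 0 ∨ i = Fin.last (m + 3) then -1 else 1) * (x i * y i)

/-- The set of projective lines lying on the Lie quadric `⟨x,x⟩ = 0`; a projective line is
given by the corresponding two-dimensional linear subspace. -/
def LieLines (m : ℕ) : Type :=
  {ℓ : Submodule ℝ (LieSpace m) // Module.finrank ℝ ℓ = 2 ∧ ∀ x ∈ ℓ, lieInner x x = 0}

namespace LieSphere

variable {m : ℕ} {M : Type*} [TopologicalSpace M] [ChartedSpace (EuclideanSpace ℝ (Fin m)) M]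

/-- The differential `dY_p(X)` of a vector valued function `Y` on `M`, as a vector. -/
noncomputable def dvec (Y : M → LieSpace m) (p : M) (X : TangentSpace (𝓡 m) p) : LieSpace m :=
  mfderiv (𝓡 m) 𝓘(ℝ, LieSpace m) Y p X

/-- `dvec` is linear in the tangent vector. -/
theorem dvec_add (Y : M → LieSpace m) (p : M) (X Z : TangentSpace (𝓡 m) p) :
    dvec Y p (X + Z) = dvec Y p X + dvec Y p Z :=
  (mfderiv (𝓡 m) 𝓘(ℝ, LieSpace m) Y p).map_add X Z

theorem dvec_smul (Y : M → LieSpace m) (p : M) (c : ℝ) (X : TangentSpace (𝓡 m) p) :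
    dvec Y p (c • X) = c • dvec Y p X :=
  (mfderiv (𝓡 m) 𝓘(ℝ, LieSpace m) Y p).map_smul c X

theorem dvec_zero (Y : M → LieSpace m) (p : M) :
    dvec Y p (0 : TangentSpace (𝓡 m) p) = 0 :=
  (mfderiv (𝓡 m) 𝓘(ℝ, LieSpace m) Y p).map_zero

/-- `L = [Y₀, Y₁]` on the open set `U`, with smooth `Y₀, Y₁`. -/
structure IsFrameOn (L : M → LieLines m) (U : Set M) (Y₀ Y₁ : M → LieSpace m) : Prop where
  isOpen : IsOpen U
  smooth₀ : ContMDiffOn (𝓡 m) 𝓘(ℝ, LieSpace m) ∞ Y₀ U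
  smooth₁ : ContMDiffOn (𝓡 m) 𝓘(ℝ, LieSpace m) ∞ Y₁ U
  span_eq : ∀ q ∈ U, (L q).1 = Submodule.span ℝ {Y₀ q, Y₁ q}

/-- A Legendre submanifold: a smooth immersion into the manifold of lines on the Lie quadric
that annihilates the contact form. Smoothness means that `L` is locally spanned by smooth
functions `Y₀, Y₁`. The tangent space of a Grassmannian at `ℓ` is `Hom(ℓ, ℝ^(n+3) / ℓ)`, and
`dL_q(X)` is the homomorphism sending `Yᵢ(q)` to the class of `dYᵢ(X)`; hence `L` is an
immersion iff only `X = 0` has both `dYᵢ(X)` in `L q`. The contact form is, up to a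
nonvanishing factor, `⟨dY₀, Y₁⟩`. -/
def IsLegendre (L : M → LieLines m) : Prop :=
  ∀ p : M, ∃ (U : Set M) (Y₀ Y₁ : M → LieSpace m), p ∈ U ∧ IsFrameOn L U Y₀ Y₁ ∧
    ∀ q ∈ U,
      (∀ X : TangentSpace (𝓡 m) q,
        dvec Y₀ q X ∈ (L q).1 → dvec Y₁ q X ∈ (L q).1 → X = 0) ∧
      (∀ X : TangentSpace (𝓡 m) q, lieInner (dvec Y₀ q X) (Y₁ q) = 0)

/-- The space of principal vectors at `p` that correspond to a point `x = [r Y₀(p) + s Y₁(p)]` of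
the line `L p`: the tangent vectors `X` with `r dY₀(X) + s dY₁(X) ∈ Span {Y₀(p), Y₁(p)}`.
A change of the local frame changes the left side by an element of the right side only, so that
the condition is the same for all frames. -/
def principalSpace (L : M → LieLines m) (p : M) (x : ℙ ℝ (LieSpace m)) :
    Submodule ℝ (TangentSpace (𝓡 m) p) where
  carrier := {X | ∀ (U : Set M) (Y₀ Y₁ : M → LieSpace m), p ∈ U → IsFrameOn L U Y₀ Y₁ →
    ∀ r s : ℝ, r • Y₀ p + s • Y₁ p ∈ x.submodule →
      r • dvec Y₀ p X + s • dvec Y₁ p X ∈ (L p).1}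
  zero_mem' := by
    intro U Y₀ Y₁ _ _ r s _
    simp [dvec_zero]
  add_mem' := by
    intro X Z hX hZ U Y₀ Y₁ hp hY r s hx
    have h := (L p).1.add_mem (hX U Y₀ Y₁ hp hY r s hx) (hZ U Y₀ Y₁ hp hY r s hx)
    rw [dvec_add, dvec_add, smul_add, smul_add, add_add_add_comm]
    exact h
  smul_mem' := by
    intro c X hX U Y₀ Y₁ hp hY r s hx
    have h := (L p).1.smul_mem c (hX U Y₀ Y₁ hp hY r s hx)
    rw [dvec_smul, dvec_smul, smul_comm r c, smul_comm s c, ← smul_add]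
    exact h

/-- `x` is a curvature sphere of `L` at `p`: a point of the line `L p` that has a nonzero
principal vector. -/
def IsCurvatureSphere (L : M → LieLines m) (p : M) (x : ℙ ℝ (LieSpace m)) : Prop :=
  x.submodule ≤ (L p).1 ∧ principalSpace L p x ≠ ⊥

/-- The Dupin condition: along each curvature surface the corresponding curvature sphere is
constant. A curvature surface is a connected smooth (immersed) submanifold `S` of `M`, given by
an injective immersion `f : S → M`, whose tangent space at each point `q` is equal to the
principal space of a curvature sphere `x q`. -/
def IsDupin (L : M → LieLines m) : Prop :=
  ∀ (k : ℕ) (S : Type) [TopologicalSpace S] [ChartedSpace (EuclideanSpace ℝ (Fin k)) S]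
    [IsManifold (𝓡 k) ∞ S] [T2Space S] [SecondCountableTopology S] [ConnectedSpace S]
    (f : S → M) (x : S → ℙ ℝ (LieSpace m)),
    ContMDiff (𝓡 k) (𝓡 m) ∞ f → Function.Injective f →
    (∀ q : S, Function.Injective (mfderiv (𝓡 k) (𝓡 m) f q)) →
    (∀ q : S, IsCurvatureSphere L (f q) (x q)) →
    (∀ q : S, LinearMap.range (mfderiv (𝓡 k) (𝓡 m) f q).toLinearMap =
      principalSpace L (f q) (x q)) →
    ∀ q q' : S, x q = x q'

/-- A proper Dupin submanifold: a Legendre submanifold that satisfies the Dupin condition and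
whose number of distinct curvature spheres at a point is constant on `M`. -/
structure IsProperDupin (L : M → LieLines m) : Prop where
  legendre : IsLegendre L
  dupin : IsDupin L
  proper : ∃ g : ℕ, ∀ p : M, {x | IsCurvatureSphere L p x}.encard = g

/-- `x` is a curvature sphere map of `L` on the open set `O`: a smooth map from `O` to projective
space (i.e. with smooth nowhere zero lifts near each point) whose value at each point is a
curvature sphere at that point. -/
def IsCurvatureSphereMapOn (L : M → LieLines m) (O : Set M) (x : M → ℙ ℝ (LieSpace m)) : Prop :=
  (∀ p ∈ O, IsCurvatureSphere L p (x p)) ∧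
  ∀ p ∈ O, ∃ (U : Set M) (K : M → LieSpace m), IsOpen U ∧ p ∈ U ∧ U ⊆ O ∧
    ContMDiffOn (𝓡 m) 𝓘(ℝ, LieSpace m) ∞ K U ∧
    ∀ q ∈ U, K q ≠ 0 ∧ K q ∈ (x q).submodule

/-- `L` is reducible on `O` if some curvature sphere maps `O` into a fixed linear subspace of the
projective space `P^(n+2)` of codimension at least two. -/
def ReducibleOn (L : M → LieLines m) (O : Set M) : Prop :=
  ∃ (x : M → ℙ ℝ (LieSpace m)) (E : Submodule ℝ (LieSpace m)),
    IsCurvatureSphereMapOn L O x ∧ 2 ≤ Module.finrank ℝ (LieSpace m ⧸ E) ∧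
    ∀ p ∈ O, (x p).submodule ≤ E

/-- `L` is reducible if it is reducible on all of `M`. -/
def Reducible (L : M → LieLines m) : Prop := ReducibleOn L Set.univ

/-- `L` is irreducible if it is not reducible. -/
def Irreducible (L : M → LieLines m) : Prop := ¬ Reducible L

/-- `L` is locally irreducible if it is not reducible on any (nonempty) open subset. -/
def LocallyIrreducible (L : M → LieLines m) : Prop :=
  ∀ O : Set M, IsOpen O → O.Nonempty → ¬ ReducibleOn L O

end LieSphere

/-!
The point is a unique continuation property: if a hyperplane `e = 0` contains a curvature sphere
`K_j` of a Dupin submanifold on a nonempty open set, then it does so on every connected domain of a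
smooth frame. No analyticity of Dupin submanifolds is used.

It suffices to continue along the leaves of the principal foliation `T_i` of every curvature sphere
`K_i`: the spaces `T_i` span the tangent space, so that a curve in some leaf enters the interior of
the zero set of `e (K_j)` through any boundary point at which an interior ball touches
(`subset_of_transversal_curves`). Along a leaf `K_i` is constant, by the Dupin condition, and so are
the derivatives `k`, `H` of first and second order of `K_i` transversal to the leaf, if `K_i` is
scaled by a fixed linear functional. If the lines are spanned by `K_i` and `Y`, then modulo `K_i`
the vector `Y` stays in the null cone of the vectors orthogonal to `K_i` and the image of `k`. This is a
cone over a round sphere, and any two points of it lie on a conic; hence a homogeneous polynomial in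
`Y` that vanishes on an open part of the leaf vanishes on all of it
(`eq_zero_of_eventually_eq_zero`). If `e (K_i) = 0`, this is applied to `e (Y)`. Otherwise each line
has exactly one point in the hyperplane, and this point is a curvature sphere iff the second
fundamental form of the focal submanifold, `H` paired with that point, is degenerate; so it is
applied to the determinant of this form, a polynomial in `Y`. As the curvature spheres are distinct,
the one in the hyperplane is the same on the whole leaf (`IsLeaf.eqOn_zero`). For `j = i` there is
nothing to show.

The frames on which the distinct curvature spheres are smooth exist because their number is
constant: they correspond to the eigenvalues of a shape operator which is self-adjoint for a positive
definite form (`exists_smooth_eigenvalues`). The Dupin condition enters only through its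
infinitesimal form, the derivative of `K_i` along `T_i` being a multiple of `K_i`
(`IsChartFrame.isInfinitesimallyDupin`), and leaves are obtained from the constant rank theorem for
the scaled `K_i`.

By unique continuation, the set of points near which some curvature sphere lies in a fixed subspace
is open and closed, so it is all of a connected `M`. The local curvature spheres obtained this way
agree: two different ones would span the lines, which would then lie in a hyperplane near a point.
But then the polar point of the hyperplane is common to all these lines and there is at most one
curvature sphere (`IsSphereGerm.mem_span`).
-/

/-! ### The scalar product of signature `(n+1, 2)` -/

namespace LieSphere

/-- The scalar product `lieInner` as a continuous bilinear form. -/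
noncomputable def lieForm {m : ℕ} : LieSpace m →L[ℝ] LieSpace m →L[ℝ] ℝ :=
  LinearMap.toContinuousLinearMap ((LinearMap.toContinuousLinearMap :
    (LieSpace m →ₗ[ℝ] ℝ) ≃ₗ[ℝ] (LieSpace m →L[ℝ] ℝ)).toLinearMap ∘ₗ
      LinearMap.mk₂ ℝ lieInner
        (by intro x x' y; simp only [lieInner, ← Finset.sum_add_distrib, PiLp.add_apply]
            exact Finset.sum_congr rfl fun i _ => by ring)
        (by intro c x y; simp only [lieInner, smul_eq_mul, Finset.mul_sum, PiLp.smul_apply]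
            exact Finset.sum_congr rfl fun i _ => by ring)
        (by intro x y y'; simp only [lieInner, ← Finset.sum_add_distrib, PiLp.add_apply]
            exact Finset.sum_congr rfl fun i _ => by ring)
        (by intro c x y; simp only [lieInner, smul_eq_mul, Finset.mul_sum, PiLp.smul_apply]
            exact Finset.sum_congr rfl fun i _ => by ring))

section LinearAlgebra

variable {m : ℕ}

theorem lieForm_apply (x y : LieSpace m) : lieForm x y = lieInner x y := rfl

theorem lieForm_comm (x y : LieSpace m) : lieForm x y = lieForm y x := by
  simp only [lieForm_apply, lieInner]
  exact Finset.sum_congr rfl fun i _ => by ring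

theorem lieForm_self_of_eq_zero {x : LieSpace m} (h0 : x 0 = 0) (hl : x (Fin.last (m + 3)) = 0) :
    lieForm x x = ‖x‖ ^ 2 := by
  rw [lieForm_apply, lieInner, EuclideanSpace.norm_sq_eq]
  refine Finset.sum_congr rfl fun i _ => ?_
  by_cases hi : i = 0 ∨ i = Fin.last (m + 3)
  · rcases hi with rfl | rfl
    · simp [h0]
    · simp [hl]
  · rw [if_neg hi, Real.norm_eq_abs, sq_abs]; ring

/-- The scalar product is nondegenerate: every linear functional is the product with some vector. -/
theorem exists_lieForm_eq (f : LieSpace m →ₗ[ℝ] ℝ) : ∃ e : LieSpace m, ∀ x, f x = lieForm e x := by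
  refine ⟨WithLp.toLp 2 fun i => (if i = 0 ∨ i = Fin.last (m + 3) then -1 else 1) *
    f (EuclideanSpace.single i 1), fun x => ?_⟩
  have hx : x = ∑ i, x i • EuclideanSpace.single i (1 : ℝ) := by
    ext j
    simp [Pi.single_apply]
  conv_lhs => rw [hx]
  rw [map_sum, lieForm_apply, lieInner]
  refine Finset.sum_congr rfl fun i _ => ?_
  rw [map_smul, smul_eq_mul]
  dsimp only
  split_ifs <;> ring

theorem lieForm_nondegenerate {x : LieSpace m} (h : ∀ y, lieForm x y = 0) : x = 0 := by
  have : ∀ f : LieSpace m →ₗ[ℝ] ℝ, f x = 0 := fun f => by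
    obtain ⟨e, he⟩ := exists_lieForm_eq f
    rw [he, lieForm_comm, h]
  exact (Module.forall_dual_apply_eq_zero_iff ℝ x).1 this

/-- `y, z` span a line on the Lie quadric. -/
structure IsNullPair (y z : LieSpace m) : Prop where
  indep : LinearIndependent ℝ ![y, z]
  left : lieForm y y = 0
  mixed : lieForm y z = 0
  right : lieForm z z = 0

namespace IsNullPair

variable {y z : LieSpace m}

theorem coeff_eq_zero (h : IsNullPair y z) {a b : ℝ} (hab : a • y + b • z = 0) : a = 0 ∧ b = 0 :=
  LinearIndependent.pair_iff.1 h.indep a b hab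

theorem symm (h : IsNullPair y z) : IsNullPair z y :=
  ⟨LinearIndependent.pair_symm_iff.1 h.indep, h.right, by rw [lieForm_comm, h.mixed], h.left⟩

theorem form_add_left (h : IsNullPair y z) (a b : ℝ) : lieForm (a • y + b • z) y = 0 := by
  simp [h.left, lieForm_comm z y, h.mixed]

theorem form_add_right (h : IsNullPair y z) (a b : ℝ) : lieForm (a • y + b • z) z = 0 := by
  simp [h.right, h.mixed]

theorem form_mem_left (h : IsNullPair y z) {v : LieSpace m} (hv : v ∈ Submodule.span ℝ {y, z}) :
    lieForm v y = 0 := by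
  obtain ⟨a, b, rfl⟩ := Submodule.mem_span_pair.1 hv
  exact h.form_add_left a b

theorem form_mem_right (h : IsNullPair y z) {v : LieSpace m} (hv : v ∈ Submodule.span ℝ {y, z}) :
    lieForm v z = 0 := by
  obtain ⟨a, b, rfl⟩ := Submodule.mem_span_pair.1 hv
  exact h.form_add_right a b

theorem det_ne_zero (h : IsNullPair y z) :
    y 0 * z (Fin.last (m + 3)) - y (Fin.last (m + 3)) * z 0 ≠ 0 := by
  intro hd
  have key : ∀ a b : ℝ, a * y 0 + b * z 0 = 0 →
      a * y (Fin.last (m + 3)) + b * z (Fin.last (m + 3)) = 0 → a = 0 ∧ b = 0 := by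
    intro a b h0 hl
    apply h.coeff_eq_zero
    have hn : lieForm (a • y + b • z) (a • y + b • z) = 0 := by
      rw [map_add, map_smul, map_smul, h.form_add_left, h.form_add_right]; simp
    rw [lieForm_self_of_eq_zero (by simpa using h0) (by simpa using hl)] at hn
    simpa using hn
  have h1 := key (z 0) (-y 0) (by ring) (by linarith)
  have h2 := key (z (Fin.last (m + 3))) (-y (Fin.last (m + 3))) (by linarith) (by ring)
  have h3 := key 1 0 (by simpa using h1.2) (by simpa using h2.2)
  exact one_ne_zero h3.1

/-- On a line `ℓ` of the quadric the two negative coordinates are linear coordinates; hence every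
vector is congruent modulo `ℓ` to one whose negative coordinates vanish. -/
theorem exists_sub (h : IsNullPair y z) (v : LieSpace m) : ∃ a b : ℝ,
    (v - (a • y + b • z)) 0 = 0 ∧ (v - (a • y + b • z)) (Fin.last (m + 3)) = 0 := by
  have hd := h.det_ne_zero
  set d := y 0 * z (Fin.last (m + 3)) - y (Fin.last (m + 3)) * z 0 with hd'
  refine ⟨(v 0 * z (Fin.last (m + 3)) - v (Fin.last (m + 3)) * z 0) / d,
    (y 0 * v (Fin.last (m + 3)) - y (Fin.last (m + 3)) * v 0) / d, ?_, ?_⟩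
  · simp only [PiLp.sub_apply, PiLp.add_apply, PiLp.smul_apply, smul_eq_mul]
    field_simp
    rw [hd']; ring
  · simp only [PiLp.sub_apply, PiLp.add_apply, PiLp.smul_apply, smul_eq_mul]
    field_simp
    rw [hd']; ring

theorem form_sub_self (h : IsNullPair y z) {v : LieSpace m} (hy : lieForm v y = 0)
    (hz : lieForm v z = 0) (a b : ℝ) :
    lieForm (v - (a • y + b • z)) (v - (a • y + b • z)) = lieForm v v := by
  have h1 : lieForm (a • y + b • z) v = 0 := by rw [lieForm_comm]; simp [hy, hz]
  have h2 : lieForm (a • y + b • z) (a • y + b • z) = 0 := by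
    rw [map_add, map_smul, map_smul, h.form_add_left, h.form_add_right]; simp
  have h3 : lieForm v (a • y + b • z) = 0 := by simp [hy, hz]
  rw [map_sub, map_sub, sub_apply, sub_apply, h1, h2, h3]
  ring

theorem form_self_nonneg (h : IsNullPair y z) {v : LieSpace m} (hy : lieForm v y = 0)
    (hz : lieForm v z = 0) : 0 ≤ lieForm v v := by
  obtain ⟨a, b, h0, hl⟩ := h.exists_sub v
  rw [← h.form_sub_self hy hz a b, lieForm_self_of_eq_zero h0 hl]
  positivity

theorem mem_of_form_self (h : IsNullPair y z) {v : LieSpace m} (hy : lieForm v y = 0)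
    (hz : lieForm v z = 0) (hv : lieForm v v = 0) : v ∈ Submodule.span ℝ {y, z} := by
  obtain ⟨a, b, h0, hl⟩ := h.exists_sub v
  have := h.form_sub_self hy hz a b
  rw [lieForm_self_of_eq_zero h0 hl, hv] at this
  have h' : v - (a • y + b • z) = 0 := by simpa using this
  rw [sub_eq_zero.1 h']
  exact Submodule.mem_span_pair.2 ⟨a, b, rfl⟩

/-- If `A` maps an `m`-dimensional space injectively into `ℓ^⊥ / ℓ`, then its image spans
`ℓ^⊥ / ℓ`, on which the product is positive definite. -/
theorem mem_of_orthogonal_range (h : IsNullPair y z) {F : Type*} [AddCommGroup F] [Module ℝ F]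
    [FiniteDimensional ℝ F] (hF : Module.finrank ℝ F = m) (A : F →ₗ[ℝ] LieSpace m)
    (hAy : ∀ X, lieForm (A X) y = 0) (hAz : ∀ X, lieForm (A X) z = 0)
    (hA : ∀ X, A X ∈ Submodule.span ℝ {y, z} → X = 0) {v : LieSpace m}
    (hvy : lieForm v y = 0) (hvz : lieForm v z = 0) (hv : ∀ X, lieForm v (A X) = 0) :
    v ∈ Submodule.span ℝ {y, z} := by
  let B : LinearMap.BilinForm ℝ (LieSpace m) := LinearMap.mk₂ ℝ (fun x y => lieForm x y)
    (by intros; simp) (by intros; simp) (by intros; simp) (by intros; simp)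
  have hBapp : ∀ x y, B x y = lieForm x y := fun x y => rfl
  have hB : B.IsRefl := fun x y hxy => by rw [hBapp, lieForm_comm]; exact hxy
  have hBn : B.Nondegenerate := by
    exact (LinearMap.IsRefl.nondegenerate_iff_separatingLeft hB).2
      fun x hx => lieForm_nondegenerate hx
  set ℓ := Submodule.span ℝ {y, z} with hℓ
  have hfl : Module.finrank ℝ ℓ = 2 := by
    have := finrank_span_eq_card h.indep
    rw [Matrix.range_cons, Matrix.range_cons, Matrix.range_empty, Set.union_empty,
      Set.singleton_union] at this
    simpa using this
  have hmem : ∀ {w}, w ∈ B.orthogonal ℓ ↔ lieForm w y = 0 ∧ lieForm w z = 0 := by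
    intro w
    rw [LinearMap.BilinForm.mem_orthogonal_iff]
    constructor
    · intro hw
      refine ⟨?_, ?_⟩
      · rw [lieForm_comm]; exact hw y (Submodule.subset_span (by simp))
      · rw [lieForm_comm]; exact hw z (Submodule.subset_span (by simp))
    · rintro ⟨h1, h2⟩ x hx
      obtain ⟨a, b, rfl⟩ := Submodule.mem_span_pair.1 hx
      change lieForm _ w = 0
      rw [lieForm_comm]; simp [h1, h2]
  have hinj : Function.Injective A := by
    rw [← LinearMap.ker_eq_bot, LinearMap.ker_eq_bot']
    intro X hX
    exact hA X (by rw [hX]; exact ℓ.zero_mem)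
  have hfr : Module.finrank ℝ (LinearMap.range A) = m := by
    rw [LinearMap.finrank_range_of_inj hinj, hF]
  have hdisj : Disjoint ℓ (LinearMap.range A) := by
    rw [Submodule.disjoint_def]
    rintro _ hx ⟨X, rfl⟩
    rw [hA X hx, map_zero]
  have hle : ℓ ⊔ LinearMap.range A ≤ B.orthogonal ℓ := by
    refine sup_le ?_ ?_
    · intro x hx
      exact hmem.2 ⟨h.form_mem_left hx, h.form_mem_right hx⟩
    · rintro _ ⟨X, rfl⟩
      exact hmem.2 ⟨hAy X, hAz X⟩
  have hdim : Module.finrank ℝ (B.orthogonal ℓ) = Module.finrank ℝ ↥(ℓ ⊔ LinearMap.range A) := by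
    have h1 := Submodule.finrank_sup_add_finrank_inf_eq ℓ (LinearMap.range A)
    rw [hdisj.eq_bot, finrank_bot, hfl, hfr] at h1
    rw [LinearMap.BilinForm.finrank_orthogonal hBn, hfl, finrank_euclideanSpace,
      Fintype.card_fin]
    omega
  have heq := Submodule.eq_of_le_of_finrank_eq hle hdim.symm
  have hvm : v ∈ ℓ ⊔ LinearMap.range A := by rw [heq]; exact hmem.2 ⟨hvy, hvz⟩
  obtain ⟨l, hl, _, ⟨X, rfl⟩, hlX⟩ := Submodule.mem_sup.1 hvm
  refine h.mem_of_form_self hvy hvz ?_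
  conv_lhs => rw [← hlX]
  rw [map_add, hlX, hv X, add_zero]
  obtain ⟨a, b, rfl⟩ := Submodule.mem_span_pair.1 hl
  simp [hvy, hvz]

end IsNullPair

end LinearAlgebra

end LieSphere

/-! ### Local frames and the shape operator -/

namespace LieSphere

open Filter Topology

section Frames

variable {m : ℕ} {F : Type*} [NormedAddCommGroup F] [NormedSpace ℝ F]

theorem two_le_infty : (2 : ℕ∞ω) ≤ ∞ := WithTop.coe_le_coe.2 (le_top : (2 : ℕ∞) ≤ ⊤)

theorem fderiv_lieForm {a b : F → LieSpace m} {q : F} (ha : DifferentiableAt ℝ a q)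
    (hb : DifferentiableAt ℝ b q) (X : F) :
    fderiv ℝ (fun p => lieForm (a p) (b p)) q X =
      lieForm (fderiv ℝ a q X) (b q) + lieForm (a q) (fderiv ℝ b q X) := by
  rw [(lieForm.hasFDerivAt_of_bilinear ha.hasFDerivAt hb.hasFDerivAt).fderiv]
  simp [add_comm]

theorem lieForm_fderiv_add {a b : F → LieSpace m} {q : F} (ha : DifferentiableAt ℝ a q)
    (hb : DifferentiableAt ℝ b q) {c : ℝ} (h : ∀ᶠ p in 𝓝 q, lieForm (a p) (b p) = c) (X : F) :
    lieForm (fderiv ℝ a q X) (b q) + lieForm (a q) (fderiv ℝ b q X) = 0 := by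
  rw [← fderiv_lieForm ha hb, (show (fun p => lieForm (a p) (b p)) =ᶠ[𝓝 q] fun _ => c from h).fderiv_eq]
  simp

theorem fderiv_fderiv_apply {G : Type*} [NormedAddCommGroup G] [NormedSpace ℝ G] {b : F → G} {q : F}
    (hb : DifferentiableAt ℝ (fderiv ℝ b) q) (Z X : F) :
    fderiv ℝ (fun p => fderiv ℝ b p Z) q X = fderiv ℝ (fderiv ℝ b) q X Z := by
  rw [fderiv_clm_apply hb (differentiableAt_const Z)]
  simp

/-- Differentiating `⟨a, db(Z)⟩ = 0`. -/
theorem lieForm_second_fderiv {a b : F → LieSpace m} {q : F} (ha : DifferentiableAt ℝ a q)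
    (hb : ContDiffAt ℝ 2 b q) {Z : F} (h : ∀ᶠ p in 𝓝 q, lieForm (a p) (fderiv ℝ b p Z) = 0) (X : F) :
    lieForm (a q) (fderiv ℝ (fderiv ℝ b) q X Z) =
      -lieForm (fderiv ℝ a q X) (fderiv ℝ b q Z) := by
  have hb' : DifferentiableAt ℝ (fderiv ℝ b) q :=
    (hb.fderiv_right (m := 1) (by norm_num)).differentiableAt (by norm_num)
  have := lieForm_fderiv_add ha (hb'.clm_apply (differentiableAt_const Z)) h X
  rw [fderiv_fderiv_apply hb'] at this
  linarith

theorem second_fderiv_comm {G : Type*} [NormedAddCommGroup G] [NormedSpace ℝ G] {b : F → G} {q : F}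
    (hb : ContDiffAt ℝ 2 b q) (X Z : F) :
    fderiv ℝ (fderiv ℝ b) q X Z = fderiv ℝ (fderiv ℝ b) q Z X :=
  (hb.isSymmSndFDerivAt (by simp)) X Z

/-- `y, z` is a smooth frame of a Legendre submanifold parametrized by the open set `Ω`, such that
`[y]` is at no point a curvature sphere. The latter makes `dy` an isomorphism from the tangent space
onto `ℓ^⊥ / ℓ`, where `ℓ` is the line spanned by `y, z`. -/
structure IsLegendreFrame (Ω : Set F) (y z : F → LieSpace m) : Prop where
  isOpen : IsOpen Ω
  smooth_left : ContDiffOn ℝ ∞ y Ω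
  smooth_right : ContDiffOn ℝ ∞ z Ω
  pair : ∀ q ∈ Ω, IsNullPair (y q) (z q)
  contact : ∀ q ∈ Ω, ∀ X, lieForm (fderiv ℝ y q X) (z q) = 0
  regular : ∀ q ∈ Ω, ∀ X, fderiv ℝ y q X ∈ Submodule.span ℝ {y q, z q} → X = 0

/-- The bilinear form `⟨A X, B Z⟩`. -/
noncomputable def gram (A B : F →L[ℝ] LieSpace m) : F →L[ℝ] F →L[ℝ] ℝ :=
  ((ContinuousLinearMap.compL ℝ F (LieSpace m) ℝ).flip B).comp (lieForm.comp A)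

@[simp] theorem gram_apply (A B : F →L[ℝ] LieSpace m) (X Z : F) :
    gram A B X Z = lieForm (A X) (B Z) := rfl

theorem ContDiffAt.gram {E : Type*} [NormedAddCommGroup E] [NormedSpace ℝ E] {n : ℕ∞ω}
    {A B : E → F →L[ℝ] LieSpace m} {q : E} (hA : ContDiffAt ℝ n A q) (hB : ContDiffAt ℝ n B q) :
    ContDiffAt ℝ n (fun p => LieSphere.gram (A p) (B p)) q :=
  (contDiffAt_const.clm_apply hB).clm_comp (contDiffAt_const.clm_comp hA)

/-- The shape operator `S` of `z` with respect to `y`: it is determined by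
`dz ≡ dy ∘ S` modulo the line spanned by `y, z`. -/
noncomputable def shapeOp (y z : F → LieSpace m) (q : F) : F →L[ℝ] F :=
  (gram (fderiv ℝ y q) (fderiv ℝ y q)).inverse.comp (gram (fderiv ℝ z q) (fderiv ℝ y q))

theorem isInvertible_of_injective [FiniteDimensional ℝ F] {I : F →L[ℝ] F →L[ℝ] ℝ}
    (hI : Function.Injective I) : I.IsInvertible := by
  have hfr : Module.finrank ℝ F = Module.finrank ℝ (F →L[ℝ] ℝ) := by
    rw [← (LinearMap.toContinuousLinearMap : (F →ₗ[ℝ] ℝ) ≃ₗ[ℝ] (F →L[ℝ] ℝ)).finrank_eq]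
    exact Subspace.dual_finrank_eq.symm
  let e := LinearEquiv.ofInjectiveOfFinrankEq I.toLinearMap hI hfr
  exact ⟨e.toContinuousLinearEquiv, by ext; rfl⟩

namespace IsLegendreFrame

variable {Ω : Set F} {y z : F → LieSpace m} {q : F}

theorem contDiffAt_left (h : IsLegendreFrame Ω y z) (hq : q ∈ Ω) : ContDiffAt ℝ ∞ y q :=
  h.smooth_left.contDiffAt (h.isOpen.mem_nhds hq)

theorem contDiffAt_right (h : IsLegendreFrame Ω y z) (hq : q ∈ Ω) : ContDiffAt ℝ ∞ z q :=
  h.smooth_right.contDiffAt (h.isOpen.mem_nhds hq)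

theorem diff_left (h : IsLegendreFrame Ω y z) (hq : q ∈ Ω) : DifferentiableAt ℝ y q :=
  (h.contDiffAt_left hq).differentiableAt (by simp)

theorem diff_right (h : IsLegendreFrame Ω y z) (hq : q ∈ Ω) : DifferentiableAt ℝ z q :=
  (h.contDiffAt_right hq).differentiableAt (by simp)

theorem form_dy_y (h : IsLegendreFrame Ω y z) (hq : q ∈ Ω) (X : F) :
    lieForm (fderiv ℝ y q X) (y q) = 0 := by
  have := lieForm_fderiv_add (h.diff_left hq) (h.diff_left hq) (c := 0)
    (eventually_of_mem (h.isOpen.mem_nhds hq) fun p hp => (h.pair p hp).left) X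
  rw [lieForm_comm (y q)] at this
  linarith

theorem form_dz_z (h : IsLegendreFrame Ω y z) (hq : q ∈ Ω) (X : F) :
    lieForm (fderiv ℝ z q X) (z q) = 0 := by
  have := lieForm_fderiv_add (h.diff_right hq) (h.diff_right hq) (c := 0)
    (eventually_of_mem (h.isOpen.mem_nhds hq) fun p hp => (h.pair p hp).right) X
  rw [lieForm_comm (z q)] at this
  linarith

theorem form_dz_y (h : IsLegendreFrame Ω y z) (hq : q ∈ Ω) (X : F) :
    lieForm (fderiv ℝ z q X) (y q) = 0 := by
  have := lieForm_fderiv_add (h.diff_left hq) (h.diff_right hq) (c := 0)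
    (eventually_of_mem (h.isOpen.mem_nhds hq) fun p hp => (h.pair p hp).mixed) X
  rw [h.contact q hq, lieForm_comm, zero_add] at this
  exact this

theorem second_yy (h : IsLegendreFrame Ω y z) (hq : q ∈ Ω) (X Z : F) :
    lieForm (y q) (fderiv ℝ (fderiv ℝ y) q X Z) =
      -lieForm (fderiv ℝ y q X) (fderiv ℝ y q Z) :=
  lieForm_second_fderiv (h.diff_left hq) ((h.contDiffAt_left hq).of_le two_le_infty)
    (eventually_of_mem (h.isOpen.mem_nhds hq) fun p hp => by rw [lieForm_comm, h.form_dy_y hp]) X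

theorem second_zy (h : IsLegendreFrame Ω y z) (hq : q ∈ Ω) (X Z : F) :
    lieForm (z q) (fderiv ℝ (fderiv ℝ y) q X Z) =
      -lieForm (fderiv ℝ z q X) (fderiv ℝ y q Z) :=
  lieForm_second_fderiv (h.diff_right hq) ((h.contDiffAt_left hq).of_le two_le_infty)
    (eventually_of_mem (h.isOpen.mem_nhds hq) fun p hp => by rw [lieForm_comm, h.contact p hp]) X

/-- Symmetry of the second fundamental form. -/
theorem form_dz_dy_comm (h : IsLegendreFrame Ω y z) (hq : q ∈ Ω) (X Z : F) :
    lieForm (fderiv ℝ z q X) (fderiv ℝ y q Z) = lieForm (fderiv ℝ z q Z) (fderiv ℝ y q X) := by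
  have h1 := h.second_zy hq X Z
  rw [second_fderiv_comm ((h.contDiffAt_left hq).of_le two_le_infty),
    h.second_zy hq Z X] at h1
  linarith

theorem gram_pos (h : IsLegendreFrame Ω y z) (hq : q ∈ Ω) {X : F} (hX : X ≠ 0) :
    0 < lieForm (fderiv ℝ y q X) (fderiv ℝ y q X) := by
  refine lt_of_le_of_ne ((h.pair q hq).form_self_nonneg (h.form_dy_y hq X) (h.contact q hq X)) ?_
  intro h0
  exact hX (h.regular q hq X
    ((h.pair q hq).mem_of_form_self (h.form_dy_y hq X) (h.contact q hq X) h0.symm))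

theorem gram_injective (h : IsLegendreFrame Ω y z) (hq : q ∈ Ω) :
    Function.Injective (gram (fderiv ℝ y q) (fderiv ℝ y q)) := by
  rw [injective_iff_map_eq_zero]
  intro X hX
  by_contra hne
  have := h.gram_pos hq hne
  rw [← gram_apply, hX] at this
  simp at this

variable [FiniteDimensional ℝ F]

theorem gram_shapeOp (h : IsLegendreFrame Ω y z) (hq : q ∈ Ω) (X Z : F) :
    lieForm (fderiv ℝ y q (shapeOp y z q X)) (fderiv ℝ y q Z) =
      lieForm (fderiv ℝ z q X) (fderiv ℝ y q Z) := by
  have h1 := (isInvertible_of_injective (h.gram_injective hq)).self_apply_inverse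
    (gram (fderiv ℝ z q) (fderiv ℝ y q) X)
  exact DFunLike.congr_fun h1 Z

theorem shapeOp_symm (h : IsLegendreFrame Ω y z) (hq : q ∈ Ω) (X Z : F) :
    lieForm (fderiv ℝ y q (shapeOp y z q X)) (fderiv ℝ y q Z) =
      lieForm (fderiv ℝ y q X) (fderiv ℝ y q (shapeOp y z q Z)) := by
  rw [h.gram_shapeOp hq, h.form_dz_dy_comm hq, ← h.gram_shapeOp hq, lieForm_comm]

theorem contDiffOn_shapeOp (h : IsLegendreFrame Ω y z) : ContDiffOn ℝ ∞ (shapeOp y z) Ω := by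
  intro q hq
  refine ContDiffAt.contDiffWithinAt ?_
  have h1 : ContDiffAt ℝ ∞ (fderiv ℝ y) q := (h.contDiffAt_left hq).fderiv_right (by simp)
  have h2 : ContDiffAt ℝ ∞ (fderiv ℝ z) q := (h.contDiffAt_right hq).fderiv_right (by simp)
  obtain ⟨e, he⟩ := isInvertible_of_injective (h.gram_injective hq)
  have h3 : ContDiffAt ℝ ∞ (ContinuousLinearMap.inverse : (F →L[ℝ] F →L[ℝ] ℝ) → _)
      (gram (fderiv ℝ y q) (fderiv ℝ y q)) := by
    rw [← he]; exact contDiffAt_map_inverse e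
  exact (h3.comp q (ContDiffAt.gram h1 h1)).clm_comp (ContDiffAt.gram h2 h1)

/-- A vector orthogonal to the line and to the image of `dy` lies on the line. -/
theorem mem_span_of_orthogonal (hF : Module.finrank ℝ F = m) (h : IsLegendreFrame Ω y z)
    (hq : q ∈ Ω) {v : LieSpace m} (hy : lieForm v (y q) = 0) (hz : lieForm v (z q) = 0)
    (hv : ∀ X, lieForm v (fderiv ℝ y q X) = 0) : v ∈ Submodule.span ℝ {y q, z q} :=
  (h.pair q hq).mem_of_orthogonal_range hF (fderiv ℝ y q).toLinearMap (h.form_dy_y hq)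
    (h.contact q hq) (h.regular q hq) hy hz hv

theorem sub_shapeOp_mem (hF : Module.finrank ℝ F = m) (h : IsLegendreFrame Ω y z) (hq : q ∈ Ω)
    (X : F) : fderiv ℝ z q X - fderiv ℝ y q (shapeOp y z q X) ∈ Submodule.span ℝ {y q, z q} := by
  refine h.mem_span_of_orthogonal hF hq ?_ ?_ fun Z => ?_
  · rw [map_sub, sub_apply, h.form_dz_y hq, h.form_dy_y hq, sub_zero]
  · rw [map_sub, sub_apply, h.form_dz_z hq, h.contact q hq, sub_zero]
  · rw [map_sub, sub_apply, h.gram_shapeOp hq, sub_self]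

theorem principal_iff (hF : Module.finrank ℝ F = m) (h : IsLegendreFrame Ω y z) (hq : q ∈ Ω)
    (r s : ℝ) (X : F) : r • fderiv ℝ y q X + s • fderiv ℝ z q X ∈ Submodule.span ℝ {y q, z q} ↔
      r • X + s • shapeOp y z q X = 0 := by
  have h1 := Submodule.smul_mem _ s (h.sub_shapeOp_mem hF hq X)
  have h2 : r • fderiv ℝ y q X + s • fderiv ℝ z q X = s • (fderiv ℝ z q X -
      fderiv ℝ y q (shapeOp y z q X)) + fderiv ℝ y q (r • X + s • shapeOp y z q X) := by
    rw [map_add, map_smul, map_smul, smul_sub]; abel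
  rw [h2, Submodule.add_mem_iff_right _ h1]
  constructor
  · exact h.regular q hq _
  · intro h0; rw [h0, map_zero]; exact Submodule.zero_mem _

end IsLegendreFrame

end Frames

end LieSphere

/-! ### Smooth families of self-adjoint operators with a constant number of eigenvalues -/

namespace LieSphere

open Filter Topology

section Pointwise

variable {F : Type*} [AddCommGroup F] [Module ℝ F]

/-- The inner product given by a positive definite symmetric form. -/
noncomputable abbrev coreOfForm (B : F →ₗ[ℝ] F →ₗ[ℝ] ℝ) (hs : ∀ x y, B x y = B y x)
    (hp : ∀ x, x ≠ 0 → 0 < B x x) : InnerProductSpace.Core ℝ F where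
  inner x y := B x y
  conj_inner_symm x y := by simpa using hs y x
  re_inner_nonneg x := by
    by_cases hx : x = 0
    · simp [hx]
    · simpa using (hp x hx).le
  add_left x y z := by simp
  smul_left x y r := by simp
  definite x hx := by
    by_contra hne
    exact (hp x hne).ne' hx

variable [FiniteDimensional ℝ F] {B : F →ₗ[ℝ] F →ₗ[ℝ] ℝ} {T : Module.End ℝ F}

theorem iSup_eigenspace_eq_top (hs : ∀ x y, B x y = B y x) (hp : ∀ x, x ≠ 0 → 0 < B x x)
    (hT : ∀ x y, B (T x) y = B x (T y)) : ⨆ μ, T.eigenspace μ = ⊤ := by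
  let core := coreOfForm B hs hp
  let : NormedAddCommGroup F := core.toNormedAddCommGroup
  let : InnerProductSpace ℝ F := InnerProductSpace.ofCore core.toCore
  have hsym : LinearMap.IsSymmetric T := hT
  have := hsym.orthogonalComplement_iSup_eigenspaces_eq_bot
  rwa [Submodule.orthogonal_eq_bot_iff] at this

/-- If no eigenvalue of `T` is nearer to `c` than `ε`, then `T - c` expands by at least `ε`. -/
theorem le_form_sub_smul (hs : ∀ x y, B x y = B y x) (hp : ∀ x, x ≠ 0 → 0 < B x x)
    (hT : ∀ x y, B (T x) y = B x (T y)) {c ε : ℝ} (hε : 0 ≤ ε)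
    (h : ∀ μ, T.HasEigenvalue μ → ε ≤ |μ - c|) (v : F) :
    ε ^ 2 * B v v ≤ B (T v - c • v) (T v - c • v) := by
  let core := coreOfForm B hs hp
  let : NormedAddCommGroup F := core.toNormedAddCommGroup
  let : InnerProductSpace ℝ F := InnerProductSpace.ofCore core.toCore
  have hsym : LinearMap.IsSymmetric T := hT
  let b := hsym.eigenvectorBasis rfl
  have hB : ∀ w : F, B w w = ∑ i, (inner ℝ (b i) w) ^ 2 := by
    intro w
    have h1 : B w w = ‖w‖ ^ 2 := (real_inner_self_eq_norm_sq w)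
    rw [h1, ← b.sum_sq_norm_inner_right w]
    exact Finset.sum_congr rfl fun i _ => by rw [Real.norm_eq_abs, sq_abs]
  have hb : ∀ i, inner ℝ (b i) (T v - c • v) =
      (hsym.eigenvalues rfl i - c) * inner ℝ (b i) v := by
    intro i
    rw [inner_sub_right, inner_smul_right, ← hsym (b i) v, hsym.apply_eigenvectorBasis rfl i,
      inner_smul_left]
    simp only [conj_trivial, RCLike.ofReal_real_eq_id, id]
    ring
  rw [hB, hB, Finset.mul_sum]
  refine Finset.sum_le_sum fun i _ => ?_
  rw [hb, mul_pow]
  refine mul_le_mul_of_nonneg_right ?_ (sq_nonneg _)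
  rw [← sq_abs (_ - c)]
  exact pow_le_pow_left₀ hε (h _ (hsym.hasEigenvalue_eigenvalues rfl i)) 2

omit [FiniteDimensional ℝ F] in
theorem isInternal_eigenspace {g : ℕ} {κ : Fin g → ℝ} (hsup : ⨆ μ, T.eigenspace μ = ⊤)
    (hinj : Function.Injective κ) (hκ : ∀ c, T.HasEigenvalue c → ∃ l, κ l = c) :
    DirectSum.IsInternal fun l => T.eigenspace (κ l) := by
  refine DirectSum.isInternal_submodule_of_iSupIndep_of_iSup_eq_top
    ((Module.End.eigenspaces_iSupIndep T).comp hinj) ?_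
  rw [eq_top_iff, ← hsup, iSup_le_iff]
  intro μ
  by_cases hμ : T.HasEigenvalue μ
  · obtain ⟨l, rfl⟩ := hκ μ hμ
    exact le_iSup (fun l => T.eigenspace (κ l)) l
  · rw [Module.End.hasEigenvalue_iff, not_not] at hμ
    rw [hμ]; exact bot_le

/-- The traces of the powers are the power sums of the eigenvalues, weighted by multiplicity. -/
theorem trace_pow_eq {g : ℕ} {κ : Fin g → ℝ} (hsup : ⨆ μ, T.eigenspace μ = ⊤)
    (hinj : Function.Injective κ) (hκ : ∀ c, T.HasEigenvalue c → ∃ l, κ l = c) (k : ℕ) :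
    LinearMap.trace ℝ F (T ^ k) =
      ∑ l, (Module.finrank ℝ (T.eigenspace (κ l)) : ℝ) * κ l ^ k := by
  have happ : ∀ l, ∀ x ∈ T.eigenspace (κ l), (T ^ k) x = κ l ^ k • x := by
    intro l x hx
    have hx' : T x = κ l • x := Module.End.mem_eigenspace_iff.1 hx
    induction k with
    | zero => simp
    | succ k ih =>
      rw [pow_succ, Module.End.mul_apply, hx', map_smul, ih, smul_smul, ← pow_succ']
  have hmaps : ∀ l, Set.MapsTo (T ^ k) (T.eigenspace (κ l)) (T.eigenspace (κ l)) := by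
    intro l x hx
    rw [happ l x hx]
    exact Submodule.smul_mem _ _ hx
  rw [LinearMap.trace_eq_sum_trace_restrict (isInternal_eigenspace hsup hinj hκ) hmaps]
  refine Finset.sum_congr rfl fun l _ => ?_
  have : (T ^ k).restrict (hmaps l) = κ l ^ k • LinearMap.id := by
    ext x
    exact happ l x x.2
  rw [this, map_smul, LinearMap.trace_id, smul_eq_mul, mul_comm]

end Pointwise

/-- The dimension of the kernel is upper semicontinuous. -/
theorem eventually_finrank_ker_le {E F : Type*} [TopologicalSpace E] [NormedAddCommGroup F]
    [NormedSpace ℝ F] [FiniteDimensional ℝ F] {T : E → F →L[ℝ] F} {a : E} (hT : ContinuousAt T a) :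
    ∀ᶠ p in 𝓝 a, Module.finrank ℝ (LinearMap.ker (T p).toLinearMap) ≤
      Module.finrank ℝ (LinearMap.ker (T a).toLinearMap) := by
  let b := Module.finBasis ℝ (LinearMap.range (T a).toLinearMap)
  choose v hv using fun i => (b i).2
  have hli : LinearIndependent ℝ fun i => T a (v i) := by
    have := b.linearIndependent.map' (Submodule.subtype _) (Submodule.ker_subtype _)
    exact (funext fun i => hv i : (fun i => T a (v i)) = Submodule.subtype _ ∘ b) ▸ this
  have hcont : ContinuousAt (fun p i => T p (v i)) a :=
    continuousAt_pi.2 fun i => hT.clm_apply continuousAt_const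
  filter_upwards [hcont.eventually (isOpen_setOfPred_linearIndependent.mem_nhds hli)] with p hp
  have hp' : LinearIndependent ℝ fun i => (⟨T p (v i), LinearMap.mem_range_self _ _⟩ :
      LinearMap.range (T p).toLinearMap) :=
    LinearIndependent.of_comp (Submodule.subtype _) hp
  have h1 := hp'.fintype_card_le_finrank
  rw [Fintype.card_fin] at h1
  have h2 := (T p).toLinearMap.finrank_range_add_finrank_ker
  have h3 := (T a).toLinearMap.finrank_range_add_finrank_ker
  omega

/-- Distinct numbers depend smoothly on their power sums, taken with fixed nonzero weights. -/
theorem contDiffAt_of_power_sums {E : Type*} [NormedAddCommGroup E] [NormedSpace ℝ E] {g : ℕ}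
    {κ : E → Fin g → ℝ} {w : Fin g → ℝ} (hw : ∀ l, w l ≠ 0) {p : E} (hκ : ContinuousAt κ p)
    (hinj : Function.Injective (κ p)) {f : E → Fin g → ℝ} (hf : ContDiffAt ℝ ∞ f p)
    (h : ∀ᶠ q in 𝓝 p, ∀ k, f q k = ∑ l, w l * κ q l ^ ((k : ℕ) + 1)) : ContDiffAt ℝ ∞ κ p := by
  let Φ : (Fin g → ℝ) → Fin g → ℝ := fun x k => ∑ l, w l * x l ^ ((k : ℕ) + 1)
  let Φ' : (Fin g → ℝ) →L[ℝ] Fin g → ℝ := ContinuousLinearMap.pi fun k =>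
    ∑ l, (w l * (((k : ℕ) + 1) * κ p l ^ (k : ℕ))) • ContinuousLinearMap.proj l
  have hΦs : ContDiff ℝ ∞ Φ := by
    rw [contDiff_pi]
    intro k
    exact ContDiff.sum fun l _ => contDiff_const.mul ((contDiff_apply ℝ ℝ l).pow _)
  have hΦd : HasFDerivAt Φ Φ' (κ p) := by
    rw [hasFDerivAt_pi]
    intro k
    refine HasFDerivAt.fun_sum fun l _ => ?_
    have h1 : HasFDerivAt (fun x : Fin g → ℝ => x l)
        (ContinuousLinearMap.proj l : (Fin g → ℝ) →L[ℝ] ℝ) (κ p) :=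
      (ContinuousLinearMap.proj l : (Fin g → ℝ) →L[ℝ] ℝ).hasFDerivAt
    refine ((h1.pow ((k : ℕ) + 1)).const_mul (w l)).congr_fderiv ?_
    ext x
    simp
    ring
  have hΦi : Function.Injective Φ'.toLinearMap := by
    rw [injective_iff_map_eq_zero]
    intro x hx
    have hz : (fun l => w l * x l) = 0 := by
      refine Matrix.eq_zero_of_forall_pow_sum_mul_pow_eq_zero hinj fun k => ?_
      have hk : Φ' x k = 0 := congrFun hx k
      have hk2 : Φ' x k = ((k : ℕ) + 1 : ℝ) * ∑ l, w l * x l * κ p l ^ (k : ℕ) := by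
        rw [Finset.mul_sum]
        simp only [Φ', ContinuousLinearMap.coe_pi', FunLike.coe_sum, Finset.sum_apply]
        refine Finset.sum_congr rfl fun l _ => ?_
        simp
        ring
      rw [hk2] at hk
      exact (mul_eq_zero.1 hk).resolve_left (by positivity)
    ext l
    exact (mul_eq_zero.1 (congrFun hz l)).resolve_left (hw l)
  let e : (Fin g → ℝ) ≃L[ℝ] (Fin g → ℝ) :=
    (LinearEquiv.ofInjectiveEndo Φ'.toLinearMap hΦi).toContinuousLinearEquiv
  have he : HasFDerivAt Φ (e : (Fin g → ℝ) →L[ℝ] (Fin g → ℝ)) (κ p) := hΦd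
  have hne : (∞ : ℕ∞ω) ≠ 0 := by simp
  have hinv := hΦs.contDiffAt.to_localInverse he hne
  have hfp : f p = Φ (κ p) := funext h.self_of_nhds
  have hcomp : ContDiffAt ℝ ∞ (fun q => (hΦs.contDiffAt.localInverse he hne) (f q)) p := by
    refine ContDiffAt.comp p ?_ hf
    rw [hfp]; exact hinv
  refine hcomp.congr_of_eventuallyEq ?_
  have hs : HasStrictFDerivAt Φ (e : (Fin g → ℝ) →L[ℝ] (Fin g → ℝ)) (κ p) :=
    hΦs.contDiffAt.hasStrictFDerivAt' he hne
  filter_upwards [h, hκ.eventually hs.eventually_left_inverse] with q hq1 hq2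
  rw [show f q = Φ (κ q) from funext hq1]
  exact hq2.symm

theorem exists_enum_of_encard {s : Set ℝ} {g : ℕ} (hs : s.encard = g) :
    ∃ c : Fin g → ℝ, Function.Injective c ∧ ∀ x, x ∈ s ↔ ∃ l, c l = x := by
  have hfin : s.Finite := Set.finite_of_encard_eq_coe hs
  have hcard : hfin.toFinset.card = g := by
    rw [hfin.encard_eq_coe_toFinset_card] at hs
    exact_mod_cast hs
  let e := (hfin.toFinset.equivFinOfCardEq hcard).symm
  refine ⟨fun l => e l, fun i j hij => e.injective (Subtype.ext hij), fun x => ⟨fun hx => ?_, ?_⟩⟩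
  · exact ⟨e.symm ⟨x, hfin.mem_toFinset.2 hx⟩, by simp⟩
  · rintro ⟨l, rfl⟩
    exact hfin.mem_toFinset.1 (e l).2

section Family

variable {E F : Type*} [NormedAddCommGroup E] [NormedSpace ℝ E] [NormedAddCommGroup F]
  [NormedSpace ℝ F] [FiniteDimensional ℝ F] {Ω : Set E} {S : E → F →L[ℝ] F}
  {I : E → F →L[ℝ] F →L[ℝ] ℝ}

omit [NormedSpace ℝ E] in
/-- Eigenvalues at `a` persist nearby: an eigenvector at `a` violates the bound `le_form_sub_smul`. -/
theorem eventually_exists_eigenvalue (hΩ : IsOpen Ω) (hS : ContinuousOn S Ω)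
    (hI : ContinuousOn I Ω) (hs : ∀ p ∈ Ω, ∀ x y, I p x y = I p y x)
    (hp : ∀ p ∈ Ω, ∀ x, x ≠ 0 → 0 < I p x x)
    (hT : ∀ p ∈ Ω, ∀ x y, I p (S p x) y = I p x (S p y)) {a : E} (ha : a ∈ Ω) {c : ℝ}
    (hc : Module.End.HasEigenvalue (S a).toLinearMap c) {ε : ℝ} (hε : 0 < ε) :
    ∀ᶠ p in 𝓝 a, ∃ μ, Module.End.HasEigenvalue (S p).toLinearMap μ ∧ |μ - c| < ε := by
  obtain ⟨v, hv⟩ := hc.exists_hasEigenvector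
  have hSa : S a v = c • v := hv.apply_eq_smul
  have hSc : ContinuousAt S a := hS.continuousAt (hΩ.mem_nhds ha)
  have hIc : ContinuousAt I a := hI.continuousAt (hΩ.mem_nhds ha)
  have hc1 : ContinuousAt (fun p => S p v - c • v) a :=
    (hSc.clm_apply continuousAt_const).sub continuousAt_const
  have hc2 : ContinuousAt (fun p => I p (S p v - c • v) (S p v - c • v) - ε ^ 2 * I p v v) a :=
    ((hIc.clm_apply hc1).clm_apply hc1).sub
      (continuousAt_const.mul ((hIc.clm_apply continuousAt_const).clm_apply continuousAt_const))
  have hlt : I a (S a v - c • v) (S a v - c • v) - ε ^ 2 * I a v v < 0 := by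
    rw [hSa, sub_self]
    have := hp a ha v hv.2
    simp only [map_zero, zero_sub, neg_lt_zero]
    positivity
  filter_upwards [hc2.eventually (isOpen_Iio.mem_nhds hlt), hΩ.mem_nhds ha] with p hlt' hpΩ
  by_contra hno
  push Not at hno
  have := le_form_sub_smul (B := (ContinuousLinearMap.coeLM ℝ).comp (I p).toLinearMap)
    (T := (S p).toLinearMap) (hs p hpΩ) (hp p hpΩ) (hT p hpΩ) (c := c) hε.le hno v
  have h2 : ε ^ 2 * I p v v ≤ I p (S p v - c • v) (S p v - c • v) := this
  have h3 : I p (S p v - c • v) (S p v - c • v) - ε ^ 2 * I p v v < 0 := hlt'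
  linarith

/-- If a smooth family of operators, self-adjoint for a continuous family of inner products, has a
constant number of eigenvalues, then locally the eigenvalues are smooth functions and their
multiplicities are constant. -/
theorem exists_smooth_eigenvalues (hΩ : IsOpen Ω) (hS : ContDiffOn ℝ ∞ S Ω)
    (hI : ContinuousOn I Ω) (hs : ∀ p ∈ Ω, ∀ x y, I p x y = I p y x)
    (hp : ∀ p ∈ Ω, ∀ x, x ≠ 0 → 0 < I p x x)
    (hT : ∀ p ∈ Ω, ∀ x y, I p (S p x) y = I p x (S p y)) {g : ℕ}
    (hg : ∀ p ∈ Ω, {μ | Module.End.HasEigenvalue (S p).toLinearMap μ}.encard = g)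
    {a : E} (ha : a ∈ Ω) :
    ∃ (N : Set E) (κ : Fin g → E → ℝ), IsOpen N ∧ a ∈ N ∧ N ⊆ Ω ∧
      (∀ l, ContDiffOn ℝ ∞ (κ l) N) ∧ ∀ p ∈ N, Function.Injective (fun l => κ l p) ∧
        (∀ μ, Module.End.HasEigenvalue (S p).toLinearMap μ ↔ ∃ l, κ l p = μ) ∧
        ∀ l, Module.finrank ℝ (Module.End.eigenspace (S p).toLinearMap (κ l p)) =
          Module.finrank ℝ (Module.End.eigenspace (S a).toLinearMap (κ l a)) := by
  classical
  have hSc := hS.continuousOn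
  have hev := fun {b : E} (hb : b ∈ Ω) {c : ℝ} => eventually_exists_eigenvalue hΩ hSc hI hs hp hT hb
    (c := c)
  obtain ⟨c, hcinj, hc⟩ := exists_enum_of_encard (hg a ha)
  -- intervals of radius `ε` around the eigenvalues at `a` are disjoint
  obtain ⟨ε, hε0, hε⟩ : ∃ ε : ℝ, 0 < ε ∧ ∀ l l', l ≠ l' → 2 * ε ≤ |c l - c l'| := by
    have h1 : ∀ᶠ ε in 𝓝[>] (0 : ℝ), ∀ l l', l ≠ l' → 2 * ε ≤ |c l - c l'| := by
      rw [eventually_all]; intro l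
      rw [eventually_all]; intro l'
      by_cases hl : l = l'
      · simp [hl]
      · have hpos : 0 < |c l - c l'| := abs_pos.2 (sub_ne_zero.2 fun h => hl (hcinj h))
        have : ∀ᶠ ε in 𝓝 (0 : ℝ), 2 * ε < |c l - c l'| := by
          have hct : ContinuousAt (fun ε : ℝ => 2 * ε) 0 := by fun_prop
          exact hct.eventually (isOpen_Iio.mem_nhds (by simpa using hpos))
        filter_upwards [nhdsWithin_le_nhds this] with ε h _ using h.le
    obtain ⟨ε, h2, h3⟩ := (h1.and self_mem_nhdsWithin).exists
    exact ⟨ε, h3, h2⟩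
  have hsep : ∀ {l l' x}, |x - c l| < ε → |x - c l'| < ε → l = l' := by
    intro l l' x h1 h2
    by_contra hne
    have h3 := hε l l' hne
    have h4 : |c l - c l'| ≤ |x - c l| + |x - c l'| := by
      rw [abs_sub_comm x (c l)]
      calc |c l - c l'| = |(c l - x) + (x - c l')| := by ring_nf
        _ ≤ _ := abs_add_le _ _
    linarith
  have hN0 : ∀ᶠ p in 𝓝 a, p ∈ Ω ∧ ∀ l, ∃ μ, Module.End.HasEigenvalue (S p).toLinearMap μ ∧
      |μ - c l| < ε :=
    (hΩ.eventually_mem ha).and (eventually_all.2 fun l => hev ha ((hc _).2 ⟨l, rfl⟩) hε0)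
  -- there are as many intervals as eigenvalues, so that each interval contains exactly one
  let κ : Fin g → E → ℝ := fun l p =>
    if h : ∃ μ, Module.End.HasEigenvalue (S p).toLinearMap μ ∧ |μ - c l| < ε then h.choose else 0
  have hκ : ∀ p l, (∃ μ, Module.End.HasEigenvalue (S p).toLinearMap μ ∧ |μ - c l| < ε) →
      Module.End.HasEigenvalue (S p).toLinearMap (κ l p) ∧ |κ l p - c l| < ε := by
    intro p l h
    simp only [κ, dif_pos h]
    exact h.choose_spec
  obtain ⟨N0, hN0s, hN0o, haN0⟩ := eventually_nhds_iff.1 hN0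
  have hκinj : ∀ p ∈ N0, Function.Injective (fun l => κ l p) := by
    intro p hp0 l l' hll
    have h1 := (hκ p l ((hN0s p hp0).2 l)).2
    have h2 := (hκ p l' ((hN0s p hp0).2 l')).2
    simp only at hll
    rw [← hll] at h2
    exact hsep h1 h2
  have hκall : ∀ p ∈ N0, ∀ μ, Module.End.HasEigenvalue (S p).toLinearMap μ ↔ ∃ l, κ l p = μ := by
    intro p hp0
    have hsub : Set.range (fun l => κ l p) ⊆
        {μ | Module.End.HasEigenvalue (S p).toLinearMap μ} := by
      rintro _ ⟨l, rfl⟩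
      exact (hκ p l ((hN0s p hp0).2 l)).1
    have hgp := hg p (hN0s p hp0).1
    have heq : Set.range (fun l => κ l p) =
        {μ | Module.End.HasEigenvalue (S p).toLinearMap μ} := by
      refine (Set.finite_range _).eq_of_subset_of_encard_le hsub ?_
      rw [hgp, ← Set.image_univ, (hκinj p hp0).encard_image, Set.encard_univ]
      simp
    intro μ
    have := Set.ext_iff.1 heq μ
    exact this.symm
  have hκcont : ∀ p ∈ N0, ∀ l, ContinuousAt (κ l) p := by
    intro p hp0 l
    obtain ⟨h1, h2⟩ := hκ p l ((hN0s p hp0).2 l)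
    rw [Metric.continuousAt_iff']
    intro δ hδ
    have hδ' : 0 < min δ (ε - |κ l p - c l|) := lt_min hδ (by linarith)
    filter_upwards [hev (hN0s p hp0).1 h1 hδ', hN0o.mem_nhds hp0] with q hq hqN
    obtain ⟨μ, hμ, hμd⟩ := hq
    obtain ⟨l', rfl⟩ := (hκall q hqN μ).1 hμ
    have h3 := (hκ q l' ((hN0s q hqN).2 l')).2
    have h4 : |κ l' q - c l| < ε := by
      have h5 : |κ l' q - c l| ≤ |κ l' q - κ l p| + |κ l p - c l| := abs_sub_le _ _ _
      have := hμd.trans_le (min_le_right _ _)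
      linarith
    rw [hsep h4 h3, Real.dist_eq, ← hsep h4 h3]
    rw [← hsep h4 h3] at hμd
    exact hμd.trans_le (min_le_left _ _)
  have hsup : ∀ p ∈ Ω, ⨆ μ, Module.End.eigenspace (S p).toLinearMap μ = ⊤ := fun p hpΩ =>
    iSup_eigenspace_eq_top (B := (ContinuousLinearMap.coeLM ℝ).comp (I p).toLinearMap)
      (T := (S p).toLinearMap) (hs p hpΩ) (hp p hpΩ) (hT p hpΩ)
  have htr : ∀ p ∈ N0, ∀ k, LinearMap.trace ℝ F ((S p).toLinearMap ^ k) =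
      ∑ l, (Module.finrank ℝ (Module.End.eigenspace (S p).toLinearMap (κ l p)) : ℝ) * κ l p ^ k :=
    fun p hp0 k => trace_pow_eq (hsup p (hN0s p hp0).1) (hκinj p hp0)
      (fun c hc => (hκall p hp0 c).1 hc) k
  have hdim : ∀ᶠ p in 𝓝 a, ∀ l, Module.finrank ℝ (Module.End.eigenspace (S p).toLinearMap (κ l p)) ≤
      Module.finrank ℝ (Module.End.eigenspace (S a).toLinearMap (κ l a)) := by
    rw [eventually_all]
    intro l
    have hcont : ContinuousAt (fun p => S p - κ l p • ContinuousLinearMap.id ℝ F) a :=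
      (hSc.continuousAt (hΩ.mem_nhds ha)).sub ((hκcont a haN0 l).smul continuousAt_const)
    have hker : ∀ p, LinearMap.ker (S p - κ l p • ContinuousLinearMap.id ℝ F).toLinearMap =
        Module.End.eigenspace (S p).toLinearMap (κ l p) := by
      intro p
      ext x
      rw [Module.End.mem_eigenspace_iff, LinearMap.mem_ker]
      simp [sub_eq_zero]
    filter_upwards [eventually_finrank_ker_le hcont] with p h
    rwa [hker, hker] at h
  obtain ⟨N1, hN1s, hN1o, haN1⟩ := eventually_nhds_iff.1 hdim
  -- the multiplicities are upper semicontinuous with constant sum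
  have hdimeq : ∀ p ∈ N0 ∩ N1, ∀ l,
      Module.finrank ℝ (Module.End.eigenspace (S p).toLinearMap (κ l p)) =
        Module.finrank ℝ (Module.End.eigenspace (S a).toLinearMap (κ l a)) := by
    rintro p ⟨hp0, hp1⟩
    have h1 := htr p hp0 0
    rw [pow_zero, ← pow_zero (S a).toLinearMap, htr a haN0 0] at h1
    simp only [pow_zero, mul_one] at h1
    have h2 : ∑ l, Module.finrank ℝ (Module.End.eigenspace (S p).toLinearMap (κ l p)) =
        ∑ l, Module.finrank ℝ (Module.End.eigenspace (S a).toLinearMap (κ l a)) := by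
      exact_mod_cast h1.symm
    intro l
    exact (Finset.sum_eq_sum_iff_of_le fun l _ => hN1s p hp1 l).1 h2 l (Finset.mem_univ l)
  refine ⟨N0 ∩ N1, κ, hN0o.inter hN1o, ⟨haN0, haN1⟩, fun p hpN => (hN0s p hpN.1).1, ?_,
    fun p hpN => ⟨hκinj p hpN.1, hκall p hpN.1, hdimeq p hpN⟩⟩
  intro l p hpN
  refine ContDiffAt.contDiffWithinAt ?_
  have hΩp := (hN0s p hpN.1).1
  let w : Fin g → ℝ := fun l =>
    (Module.finrank ℝ (Module.End.eigenspace (S a).toLinearMap (κ l a)) : ℝ)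
  have hw : ∀ l, w l ≠ 0 := by
    intro l
    have h1 : Module.End.HasEigenvalue (S a).toLinearMap (κ l a) := (hκall a haN0 _).2 ⟨l, rfl⟩
    rw [Module.End.hasEigenvalue_iff] at h1
    have h2 : Module.finrank ℝ (Module.End.eigenspace (S a).toLinearMap (κ l a)) ≠ 0 := by
      rwa [Ne, Submodule.finrank_eq_zero]
    exact Nat.cast_ne_zero.2 h2
  let f : E → Fin g → ℝ := fun q k => LinearMap.trace ℝ F ((S q).toLinearMap ^ ((k : ℕ) + 1))
  have hf : ContDiffAt ℝ ∞ f p := by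
    rw [contDiffAt_pi]
    intro k
    let tr : (F →L[ℝ] F) →L[ℝ] ℝ :=
      LinearMap.toContinuousLinearMap ((LinearMap.trace ℝ F).comp (ContinuousLinearMap.coeLM ℝ))
    have h1 : ContDiffAt ℝ ∞ (fun q => tr (S q ^ ((k : ℕ) + 1))) p :=
      tr.contDiff.contDiffAt.comp p ((hS.contDiffAt (hΩ.mem_nhds hΩp)).pow _)
    refine h1.congr_of_eventuallyEq (Eventually.of_forall fun q => ?_)
    have h2 : ∀ n : ℕ, ((S q ^ n : F →L[ℝ] F) : F →ₗ[ℝ] F) = (S q).toLinearMap ^ n := by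
      intro n
      induction n with
      | zero => rfl
      | succ n ih => rw [pow_succ, pow_succ, ← ih]; rfl
    change _ = LinearMap.trace ℝ F ((S q ^ ((k : ℕ) + 1) : F →L[ℝ] F) : F →ₗ[ℝ] F)
    rw [h2]
  have hmain := contDiffAt_of_power_sums (κ := fun q l => κ l q) hw
    (continuousAt_pi.2 fun l => hκcont p hpN.1 l) (hκinj p hpN.1) hf (by
      filter_upwards [(hN0o.inter hN1o).mem_nhds hpN] with q hq k
      simp only [f]
      rw [htr q hq.1]
      exact Finset.sum_congr rfl fun l _ => by rw [hdimeq q hq])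
  exact contDiffAt_pi.1 hmain l

end Family

end LieSphere

/-! ### Curvature spheres are constant in the directions of their principal spaces -/

namespace LieSphere

open Filter Topology

variable {m : ℕ} {F : Type*} [NormedAddCommGroup F] [NormedSpace ℝ F] {g : ℕ}

/-- A Legendre frame `y, z` together with the smooth eigenvalues `κ l` of its shape operator, so
that the `z - κ l • y` represent the distinct curvature spheres, and with their multiplicities
`d l`. -/
structure IsCurvatureFrame (Ω : Set F) (y z : F → LieSpace m) (κ : Fin g → F → ℝ)
    (d : Fin g → ℕ) : Prop extends IsLegendreFrame Ω y z where
  smooth_curv : ∀ l, ContDiffOn ℝ ∞ (κ l) Ω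
  injective : ∀ p ∈ Ω, Function.Injective fun l => κ l p
  hasEigenvalue_iff : ∀ p ∈ Ω, ∀ μ,
    Module.End.HasEigenvalue (shapeOp y z p).toLinearMap μ ↔ ∃ l, κ l p = μ
  finrank_eq : ∀ p ∈ Ω, ∀ l,
    Module.finrank ℝ (Module.End.eigenspace (shapeOp y z p).toLinearMap (κ l p)) = d l

/-- The vector `z - κ y` representing a curvature sphere. -/
def sphereVec (y z : F → LieSpace m) (κ : F → ℝ) (p : F) : LieSpace m := z p - κ p • y p

theorem list_prod_apply (S : F →L[ℝ] F) {v : F} {c : ℝ} (hv : S v = c • v) (L : List ℝ) :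
    (L.map fun μ => S - μ • (1 : F →L[ℝ] F)).prod v = (L.map fun μ => c - μ).prod • v := by
  induction L with
  | nil => simp
  | cons μ L ih =>
    rw [List.map_cons, List.prod_cons, List.map_cons, List.prod_cons, mul_apply_eq_comp,
      ih, map_smul]
    simp only [sub_apply, hv, smul_apply, one_apply_eq_self]
    rw [← sub_smul, smul_smul, mul_comm]

theorem contDiffOn_list_prod {E : Type*} [NormedAddCommGroup E] [NormedSpace ℝ E] {Ω : Set E}
    {S : E → F →L[ℝ] F} (hS : ContDiffOn ℝ ∞ S Ω) {ι : Type*} {κ : ι → E → ℝ} (L : List ι)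
    (hκ : ∀ l, ContDiffOn ℝ ∞ (κ l) Ω) :
    ContDiffOn ℝ ∞ (fun p => ((L.map fun j => κ j p).map
      fun μ => S p - μ • (1 : F →L[ℝ] F)).prod) Ω := by
  induction L with
  | nil => exact contDiffOn_const
  | cons j L ih =>
    simp only [List.map_cons, List.prod_cons]
    exact (hS.sub ((hκ j).smul contDiffOn_const)).clm_comp ih

theorem mem_of_hasDerivAt {V : Type*} [NormedAddCommGroup V] [NormedSpace ℝ V]
    [FiniteDimensional ℝ V] {W : Submodule ℝ V} {f : ℝ → V} {f' : V} {t : ℝ} (hf : HasDerivAt f f' t)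
    (h : ∀ᶠ s in 𝓝 t, f s ∈ W) : f' ∈ W := by
  by_contra hne
  obtain ⟨φ, hφ, hW⟩ := W.exists_le_ker_of_notMem hne
  have h1 := (LinearMap.toContinuousLinearMap φ).hasFDerivAt.comp_hasDerivAt t hf
  have h2 : HasDerivAt ((LinearMap.toContinuousLinearMap φ) ∘ f) 0 t := by
    refine (hasDerivAt_const t (0 : ℝ)).congr_of_eventuallyEq ?_
    filter_upwards [h] with s hs
    exact hW hs
  exact hφ (h1.unique h2)

namespace IsLegendreFrame

variable {Ω : Set F} {y z : F → LieSpace m} {q : F} {κ : F → ℝ}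

theorem fderiv_sphereVec (h : IsLegendreFrame Ω y z) (hq : q ∈ Ω) (hκ : DifferentiableAt ℝ κ q)
    (X : F) : fderiv ℝ (sphereVec y z κ) q X =
      fderiv ℝ z q X - κ q • fderiv ℝ y q X - fderiv ℝ κ q X • y q := by
  have h1 : sphereVec y z κ = z - κ • y := rfl
  rw [h1, fderiv_sub (h.diff_right hq) (hκ.smul (h.diff_left hq)), fderiv_smul hκ (h.diff_left hq)]
  simp [sub_sub]

variable [FiniteDimensional ℝ F]

theorem mem_eigenspace_iff (hF : Module.finrank ℝ F = m) (h : IsLegendreFrame Ω y z) (hq : q ∈ Ω)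
    (c : ℝ) (X : F) : X ∈ Module.End.eigenspace (shapeOp y z q).toLinearMap c ↔
      fderiv ℝ z q X - c • fderiv ℝ y q X ∈ Submodule.span ℝ {y q, z q} := by
  have h1 := h.principal_iff hF hq (-c) 1 X
  rw [Module.End.mem_eigenspace_iff]
  have h2 : fderiv ℝ z q X - c • fderiv ℝ y q X = -c • fderiv ℝ y q X + (1 : ℝ) • fderiv ℝ z q X := by
    rw [one_smul, neg_smul]; abel
  rw [h2, h1, one_smul, neg_smul, neg_add_eq_zero]
  exact eq_comm

theorem iSup_eigenspace (h : IsLegendreFrame Ω y z) (hq : q ∈ Ω) :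
    ⨆ μ, Module.End.eigenspace (shapeOp y z q).toLinearMap μ = ⊤ :=
  iSup_eigenspace_eq_top (B := (ContinuousLinearMap.coeLM ℝ).comp
      (gram (fderiv ℝ y q) (fderiv ℝ y q)).toLinearMap) (T := (shapeOp y z q).toLinearMap)
    (fun _ _ => lieForm_comm _ _) (fun _ hx => h.gram_pos hq hx) (h.shapeOp_symm hq)

end IsLegendreFrame

namespace IsCurvatureFrame

variable {Ω : Set F} {y z : F → LieSpace m} {κ : Fin g → F → ℝ} {d : Fin g → ℕ} {q : F}

theorem contDiffAt_curv (h : IsCurvatureFrame Ω y z κ d) (hq : q ∈ Ω) (l : Fin g) :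
    ContDiffAt ℝ ∞ (κ l) q :=
  (h.smooth_curv l).contDiffAt (h.isOpen.mem_nhds hq)

theorem contDiffAt_sphereVec (h : IsCurvatureFrame Ω y z κ d) (hq : q ∈ Ω) (l : Fin g) :
    ContDiffAt ℝ ∞ (sphereVec y z (κ l)) q :=
  (h.contDiffAt_right hq).sub ((h.contDiffAt_curv hq l).smul (h.contDiffAt_left hq))

theorem fderiv_sphereVec (h : IsCurvatureFrame Ω y z κ d) (hq : q ∈ Ω) (l : Fin g) (X : F) :
    fderiv ℝ (sphereVec y z (κ l)) q X =
      fderiv ℝ z q X - κ l q • fderiv ℝ y q X - fderiv ℝ (κ l) q X • y q :=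
  h.toIsLegendreFrame.fderiv_sphereVec hq ((h.contDiffAt_curv hq l).differentiableAt (by simp)) X

theorem fderiv_sphereVec_mem_iff (h : IsCurvatureFrame Ω y z κ d) (hq : q ∈ Ω) (l : Fin g) (X : F) :
    fderiv ℝ (sphereVec y z (κ l)) q X ∈ Submodule.span ℝ {y q, z q} ↔
      fderiv ℝ z q X - κ l q • fderiv ℝ y q X ∈ Submodule.span ℝ {y q, z q} := by
  rw [h.fderiv_sphereVec hq]
  exact Submodule.sub_mem_iff_left _ (Submodule.smul_mem _ _ (Submodule.subset_span (by simp)))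

variable [FiniteDimensional ℝ F]

/-- A principal vector extends to a smooth field of principal vectors: apply the product of the
`S - κ j`, `j ≠ l`, which maps everything into the `l`-th eigenspace. -/
theorem exists_principal_field (h : IsCurvatureFrame Ω y z κ d) (hq : q ∈ Ω) {l : Fin g} {X : F}
    (hX : X ∈ Module.End.eigenspace (shapeOp y z q).toLinearMap (κ l q)) :
    ∃ ξ : F → F, ContDiffOn ℝ ∞ ξ Ω ∧ ξ q = X ∧
      ∀ p ∈ Ω, ξ p ∈ Module.End.eigenspace (shapeOp y z p).toLinearMap (κ l p) := by
  classical
  let L : List (Fin g) := (List.finRange g).filter (· ≠ l)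
  have hL : ∀ j, j ∈ L ↔ j ≠ l := fun j => by simp [L]
  let Q : F → F →L[ℝ] F := fun p => ((L.map fun j => κ j p).map
      fun μ => shapeOp y z p - μ • (1 : F →L[ℝ] F)).prod
  let c : ℝ := ((L.map fun j => κ j q).map fun μ => κ l q - μ).prod
  have hc : c ≠ 0 := by
    refine List.prod_ne_zero ?_
    simp only [List.map_map, List.mem_map, Function.comp, not_exists, not_and]
    intro j hj h0
    exact (hL j).1 hj (h.injective q hq (sub_eq_zero.1 h0).symm)
  refine ⟨fun p => c⁻¹ • Q p X, ?_, ?_, fun p hp => Submodule.smul_mem _ _ ?_⟩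
  · exact contDiffOn_const.smul
      ((contDiffOn_list_prod h.contDiffOn_shapeOp L h.smooth_curv).clm_apply contDiffOn_const)
  · have h1 : Q q X = c • X := list_prod_apply (shapeOp y z q) (Module.End.mem_eigenspace_iff.1 hX) _
    simp only [h1]
    rw [smul_smul, inv_mul_cancel₀ hc, one_smul]
  · have hmem : X ∈ ⨆ μ, Module.End.eigenspace (shapeOp y z p).toLinearMap μ := by
      rw [h.iSup_eigenspace hp]; trivial
    refine Submodule.iSup_induction _
      (motive := fun x => Q p x ∈ Module.End.eigenspace (shapeOp y z p).toLinearMap (κ l p))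
      hmem ?_ ?_ ?_
    · intro μ x hx
      have h1 : Q p x = _ • x :=
        list_prod_apply (shapeOp y z p) (Module.End.mem_eigenspace_iff.1 hx) _
      rw [h1]
      by_cases hμ : Module.End.HasEigenvalue (shapeOp y z p).toLinearMap μ
      · obtain ⟨j, rfl⟩ := (h.hasEigenvalue_iff p hp μ).1 hμ
        by_cases hj : j = l
        · subst hj
          exact Submodule.smul_mem _ _ hx
        · have h0 : ((L.map fun i => κ i p).map fun μ => κ j p - μ).prod = 0 := by
            refine List.prod_eq_zero ?_
            simp only [List.map_map, List.mem_map, Function.comp]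
            exact ⟨j, (hL j).2 hj, sub_self _⟩
          rw [h0, zero_smul]
          exact Submodule.zero_mem _
      · rw [Module.End.hasEigenvalue_iff, not_not] at hμ
        rw [hμ, Submodule.mem_bot] at hx
        rw [hx, smul_zero]
        exact Submodule.zero_mem _
    · rw [map_zero]; exact Submodule.zero_mem _
    · intro x x' hx hx'
      rw [map_add]; exact Submodule.add_mem _ hx hx'

theorem form_fderiv_sphereVec (h : IsCurvatureFrame Ω y z κ d) (hq : q ∈ Ω) {l : Fin g} {X : F}
    (hX : X ∈ Module.End.eigenspace (shapeOp y z q).toLinearMap (κ l q)) (V : F) :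
    lieForm (fderiv ℝ (sphereVec y z (κ l)) q V) (fderiv ℝ y q X) = 0 ∧
      lieForm (fderiv ℝ (sphereVec y z (κ l)) q X) (fderiv ℝ y q V) = 0 := by
  have hX' : shapeOp y z q X = κ l q • X := Module.End.mem_eigenspace_iff.1 hX
  have h2 : lieForm (fderiv ℝ z q X) (fderiv ℝ y q V) =
      κ l q * lieForm (fderiv ℝ y q X) (fderiv ℝ y q V) := by
    rw [← h.gram_shapeOp hq, hX']; simp
  have h3 : ∀ W, lieForm (y q) (fderiv ℝ y q W) = 0 := fun W => by
    rw [lieForm_comm]; exact h.form_dy_y hq W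
  rw [h.fderiv_sphereVec hq, h.fderiv_sphereVec hq]
  simp only [map_sub, map_smul, sub_apply, smul_apply, smul_eq_mul, h3]
  rw [h2, h.form_dz_dy_comm hq V X, h2, lieForm_comm (fderiv ℝ y q V)]
  constructor <;> ring

/-- The component `b` of the derivative of the curvature sphere along its principal space which is
not a multiple of the curvature sphere, expressed by second derivatives. The symmetry of these gives
`b = 0` if the principal space has dimension at least two. -/
theorem form_second_fderiv_sphereVec (hF : Module.finrank ℝ F = m) (h : IsCurvatureFrame Ω y z κ d)
    (hq : q ∈ Ω) {l : Fin g} {X : F}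
    (hX : X ∈ Module.End.eigenspace (shapeOp y z q).toLinearMap (κ l q)) :
    ∃ a b : ℝ, fderiv ℝ (sphereVec y z (κ l)) q X = a • sphereVec y z (κ l) q + b • y q ∧
      ∀ W ∈ Module.End.eigenspace (shapeOp y z q).toLinearMap (κ l q),
      ∀ V ∈ Module.End.eigenspace (shapeOp y z q).toLinearMap (κ l q),
        lieForm (fderiv ℝ (fderiv ℝ (sphereVec y z (κ l))) q W X) (fderiv ℝ y q V) =
          b * lieForm (fderiv ℝ y q W) (fderiv ℝ y q V) := by
  obtain ⟨ξ, hξs, hξq, hξ⟩ := h.exists_principal_field hq hX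
  set K := sphereVec y z (κ l) with hK
  have h1 : fderiv ℝ K q X ∈ Submodule.span ℝ {y q, z q} := by
    rw [hK, h.fderiv_sphereVec_mem_iff hq]
    exact (h.mem_eigenspace_iff hF hq _ X).1 hX
  obtain ⟨r, s, hrs⟩ := Submodule.mem_span_pair.1 h1
  have hab : fderiv ℝ K q X = s • K q + (r + s * κ l q) • y q := by
    rw [← hrs, hK, sphereVec, smul_sub, add_smul, smul_smul]; abel
  refine ⟨s, r + s * κ l q, hab, fun W hW V hV => ?_⟩
  have hKd : DifferentiableAt ℝ (fderiv ℝ K) q :=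
    (((h.contDiffAt_sphereVec hq l).of_le two_le_infty).fderiv_right (m := 1)
      (by norm_num)).differentiableAt (by norm_num)
  have hyd : DifferentiableAt ℝ (fderiv ℝ y) q :=
    (((h.contDiffAt_left hq).of_le two_le_infty).fderiv_right (m := 1)
      (by norm_num)).differentiableAt (by norm_num)
  have hξd : DifferentiableAt ℝ ξ q :=
    (hξs.contDiffAt (h.isOpen.mem_nhds hq)).differentiableAt (by simp)
  have h2 := lieForm_fderiv_add (hKd.clm_apply hξd)
    (hyd.clm_apply (differentiableAt_const V)) (c := 0)
    (eventually_of_mem (h.isOpen.mem_nhds hq) fun p hp => (h.form_fderiv_sphereVec hp (hξ p hp) V).2) W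
  rw [fderiv_fderiv_apply hyd, fderiv_clm_apply hKd hξd] at h2
  simp only [add_apply, ContinuousLinearMap.coe_comp, Function.comp, hξq,
    ContinuousLinearMap.flip_apply, map_add] at h2
  rw [(h.form_fderiv_sphereVec hq hV _).1, hab] at h2
  have hW' : shapeOp y z q W = κ l q • W := Module.End.mem_eigenspace_iff.1 hW
  have h3 : lieForm (fderiv ℝ z q W) (fderiv ℝ y q V) =
      κ l q * lieForm (fderiv ℝ y q W) (fderiv ℝ y q V) := by
    rw [← h.gram_shapeOp hq, hW']; simp
  have h4 : lieForm (K q) (fderiv ℝ (fderiv ℝ y) q W V) = 0 := by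
    rw [hK, sphereVec]
    simp only [map_sub, map_smul, sub_apply, smul_apply, smul_eq_mul]
    rw [h.second_zy hq, h.second_yy hq, h3]; ring
  simp only [map_add, map_smul, add_apply, smul_apply, smul_eq_mul] at h2
  rw [h4, h.second_yy hq] at h2
  linarith

/-- A principal space of dimension at least two: the curvature sphere is constant along it, whether
or not the Dupin condition holds. -/
theorem fderiv_mem_of_two_le (hF : Module.finrank ℝ F = m) (h : IsCurvatureFrame Ω y z κ d)
    (hq : q ∈ Ω) {l : Fin g} (hd : 2 ≤ d l) {X : F}
    (hX : X ∈ Module.End.eigenspace (shapeOp y z q).toLinearMap (κ l q)) :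
    fderiv ℝ (sphereVec y z (κ l)) q X ∈ Submodule.span ℝ {sphereVec y z (κ l) q} := by
  set T := Module.End.eigenspace (shapeOp y z q).toLinearMap (κ l q) with hT
  obtain ⟨Z, hZT, hZ0, hXZ⟩ : ∃ Z ∈ T, Z ≠ 0 ∧ lieForm (fderiv ℝ y q X) (fderiv ℝ y q Z) = 0 := by
    let f : T →ₗ[ℝ] ℝ :=
      (gram (fderiv ℝ y q) (fderiv ℝ y q) X).toLinearMap.comp T.subtype
    have hker : LinearMap.ker f ≠ ⊥ := by
      intro h0
      have h1 := LinearMap.finrank_range_add_finrank_ker f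
      rw [h0, finrank_bot, h.finrank_eq q hq] at h1
      have h2 := Submodule.finrank_le (LinearMap.range f)
      rw [Module.finrank_self] at h2
      omega
    obtain ⟨Z, hZ, hZ0⟩ := Submodule.exists_mem_ne_zero_of_ne_bot hker
    exact ⟨Z, Z.2, fun h0 => hZ0 (Subtype.ext h0), hZ⟩
  obtain ⟨a, b, hab, hb⟩ := h.form_second_fderiv_sphereVec hF hq hX
  obtain ⟨a', b', -, hb'⟩ := h.form_second_fderiv_sphereVec hF hq hZT
  have h1 := hb Z hZT Z hZT
  rw [second_fderiv_comm ((h.contDiffAt_sphereVec hq l).of_le two_le_infty), hb' X hX Z hZT, hXZ,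
    mul_zero] at h1
  have hb0 : b = 0 := (mul_eq_zero.1 h1.symm).resolve_right (h.gram_pos hq hZ0).ne'
  rw [hab, hb0, zero_smul, add_zero]
  exact Submodule.smul_mem _ _ (Submodule.mem_span_singleton_self _)

/-- Integral curves of a field of principal vectors. -/
theorem exists_principal_curve (h : IsCurvatureFrame Ω y z κ d) (hq : q ∈ Ω) {l : Fin g} {X : F}
    (hX : X ∈ Module.End.eigenspace (shapeOp y z q).toLinearMap (κ l q)) (hX0 : X ≠ 0) :
    ∃ (γ : ℝ → F) (ε : ℝ), 0 < ε ∧ γ 0 = q ∧ HasDerivAt γ X 0 ∧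
      ContDiffOn ℝ ∞ γ (Set.Ioo (-ε) ε) ∧ Set.InjOn γ (Set.Ioo (-ε) ε) ∧
      ∀ t ∈ Set.Ioo (-ε) ε, γ t ∈ Ω ∧ deriv γ t ≠ 0 ∧
        deriv γ t ∈ Module.End.eigenspace (shapeOp y z (γ t)).toLinearMap (κ l (γ t)) := by
  obtain ⟨ξ, hξs, hξq, hξ⟩ := h.exists_principal_field hq hX
  have hξq' : ContDiffAt ℝ ∞ ξ q := hξs.contDiffAt (h.isOpen.mem_nhds hq)
  obtain ⟨γ, hγ0, ε, hε, hγ⟩ :=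
    (hξq'.of_le (m := 1) (by exact_mod_cast le_top)).exists_forall_mem_closedBall_exists_eq_forall_mem_Ioo_hasDerivAt₀ 0
  rw [zero_sub, zero_add] at hγ
  obtain ⟨f, hf⟩ := SeparatingDual.exists_eq_one (R := ℝ) hX0
  have hγc : ContinuousAt γ 0 := (hγ 0 ⟨by linarith, hε⟩).continuousAt
  have hev : ∀ᶠ t in 𝓝 (0 : ℝ), t ∈ Set.Ioo (-ε) ε ∧ γ t ∈ Ω ∧ 0 < f (ξ (γ t)) := by
    refine Filter.Eventually.and (Ioo_mem_nhds (by linarith) hε) (Filter.Eventually.and ?_ ?_)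
    · exact hγc.eventually (by rw [hγ0]; exact h.isOpen.mem_nhds hq)
    · have h1 : ContinuousAt (fun t => f (ξ (γ t))) 0 := by
        refine f.continuous.continuousAt.comp (ContinuousAt.comp ?_ hγc)
        rw [hγ0]; exact hξq'.continuousAt
      exact h1.eventually (isOpen_Ioi.mem_nhds (by simp [hγ0, hξq, hf]))
  obtain ⟨δ, hδ, hball⟩ := Metric.eventually_nhds_iff.1 hev
  have hI : ∀ t ∈ Set.Icc (-(δ / 2)) (δ / 2), t ∈ Set.Ioo (-ε) ε ∧ γ t ∈ Ω ∧ 0 < f (ξ (γ t)) := by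
    intro t ht
    refine hball ?_
    rw [Real.dist_eq, sub_zero, abs_lt]
    constructor <;> linarith [ht.1, ht.2]
  have hsub : Set.Ioo (-(δ / 2)) (δ / 2) ⊆ Set.Icc (-(δ / 2)) (δ / 2) := Set.Ioo_subset_Icc_self
  refine ⟨γ, δ / 2, by linarith, hγ0, ?_, ?_, ?_, ?_⟩
  · have := hγ 0 ⟨by linarith, hε⟩
    rwa [hγ0, hξq] at this
  · have h1 : ContDiffOn ℝ ∞ γ (Set.Icc (-(δ / 2)) (δ / 2)) := by
      refine ODE.contDiffOn_enat_Icc_of_hasDerivWithinAt (f := fun _ x => ξ x) (u := Ω) (n := ⊤) ?_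
        (fun t ht => (hγ t (hI t ht).1).hasDerivWithinAt) (fun t ht => (hI t ht).2.1)
      exact hξs.comp contDiffOn_snd fun x hx => hx.2
    exact h1.mono hsub
  · have hmono : StrictMonoOn (fun t => f (γ t)) (Set.Icc (-(δ / 2)) (δ / 2)) := by
      have hd : ∀ t ∈ Set.Icc (-(δ / 2)) (δ / 2), HasDerivAt (fun t => f (γ t)) (f (ξ (γ t))) t :=
        fun t ht => f.hasFDerivAt.comp_hasDerivAt t (hγ t (hI t ht).1)
      refine strictMonoOn_of_deriv_pos (convex_Icc _ _)
        (fun t ht => (hd t ht).continuousAt.continuousWithinAt) fun t ht => ?_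
      rw [interior_Icc] at ht
      rw [(hd t (hsub ht)).deriv]
      exact (hI t (hsub ht)).2.2
    intro s hs t ht hst
    exact hmono.injOn (hsub hs) (hsub ht) (congrArg f hst)
  · intro t ht
    have ht' := hI t (hsub ht)
    rw [(hγ t ht'.1).deriv]
    refine ⟨ht'.2.1, fun h0 => ?_, hξ _ ht'.2.1⟩
    rw [h0, map_zero] at ht'
    exact lt_irrefl _ ht'.2.2

end IsCurvatureFrame

end LieSphere

/-! ### Propagation along a leaf of constant curvature sphere -/

namespace LieSphere

open Filter Topology Polynomial

section Leaf

variable {m : ℕ} {A B : Type*} [NormedAddCommGroup A] [NormedSpace ℝ A] [FiniteDimensional ℝ A]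
  [NormedAddCommGroup B] [NormedSpace ℝ B] [FiniteDimensional ℝ B]

theorem lieForm_sub_sub (x y : LieSpace m) :
    lieForm (x - y) (x - y) = lieForm x x - lieForm x y - lieForm y x + lieForm y y := by
  simp only [map_sub, sub_apply]
  ring

theorem mem_span_of_orthogonal_coprod (hdim : Module.finrank ℝ A + Module.finrank ℝ B = m)
    {K P : LieSpace m} (hKP : IsNullPair K P) (k : A →ₗ[ℝ] LieSpace m) (v : B →ₗ[ℝ] LieSpace m)
    (hkK : ∀ X, lieForm (k X) K = 0) (hkP : ∀ X, lieForm (k X) P = 0)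
    (hvK : ∀ W, lieForm (v W) K = 0) (hvP : ∀ W, lieForm (v W) P = 0)
    (hkv : ∀ X W, lieForm (k X) (v W) = 0) (hk : ∀ X, k X ∈ Submodule.span ℝ {K, P} → X = 0)
    (hv : ∀ W, lieForm (v W) (v W) = 0 → W = 0) {δ : LieSpace m} (hδK : lieForm δ K = 0)
    (hδP : lieForm δ P = 0) (hδk : ∀ X, lieForm δ (k X) = 0) (hδv : ∀ W, lieForm δ (v W) = 0) :
    δ ∈ Submodule.span ℝ {K, P} := by
  refine hKP.mem_of_orthogonal_range (F := A × B) (by rw [Module.finrank_prod, hdim])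
    (k.coprod v) ?_ ?_ ?_ hδK hδP ?_
  · rintro ⟨X, W⟩
    rw [LinearMap.coprod_apply, map_add, add_apply, hkK, hvK, add_zero]
  · rintro ⟨X, W⟩
    rw [LinearMap.coprod_apply, map_add, add_apply, hkP, hvP, add_zero]
  · rintro ⟨X, W⟩ hXW
    rw [LinearMap.coprod_apply] at hXW
    have h1 : lieForm (k X + v W) (v W) = 0 := by
      obtain ⟨a, b, hab⟩ := Submodule.mem_span_pair.1 hXW
      rw [← hab, lieForm_comm]
      simp [hvK, hvP]
    rw [map_add, add_apply, hkv, zero_add] at h1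
    have hW := hv W h1
    subst hW
    rw [map_zero, add_zero] at hXW
    rw [hk X hXW]
    rfl
  · rintro ⟨X, W⟩
    rw [LinearMap.coprod_apply, map_add, hδk, hδv, add_zero]

/-- Let `Y` parametrize an open part of the null cone of `W^⊥ / K`, where `W` is spanned by `K` and
the image of `k`. This cone is the cone over a round sphere. If a homogeneous function `D`, which is
polynomial along conics, vanishes on the part of the cone near `Y w₁`, then it vanishes at any other
point `Y w₀` of the cone: join both points by a conic. -/
theorem eq_zero_of_eventually_eq_zero (hdim : Module.finrank ℝ A + Module.finrank ℝ B = m)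
    [Nontrivial B] {K : LieSpace m} (k : A →ₗ[ℝ] LieSpace m) {Y : B → LieSpace m} {w₀ w₁ : B}
    (hkK : ∀ X, lieForm (k X) K = 0)
    (hY₀ : IsNullPair K (Y w₀)) (hkY₀ : ∀ X, lieForm (k X) (Y w₀) = 0)
    (hk₀ : ∀ X, k X ∈ Submodule.span ℝ {K, Y w₀} → X = 0)
    (hYs : ContDiffAt ℝ ∞ Y w₁)
    (hY₁ : ∀ᶠ w in 𝓝 w₁, IsNullPair K (Y w) ∧ ∀ X, lieForm (k X) (Y w) = 0)
    (hdY : ∀ W, fderiv ℝ Y w₁ W ∈ Submodule.span ℝ {K, Y w₁} → W = 0)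
    {D : LieSpace m → ℝ} {N : ℕ} (hDs : ∀ (c : ℝ) P, D (c • P) = c ^ N * D P)
    (hDK : ∀ (c : ℝ) P, D (P + c • K) = D P)
    (hDp : ∀ P Q R, ∃ f : ℝ[X], ∀ τ : ℝ, D (τ ^ 2 • P + τ • Q + R) = f.eval τ)
    (hD : ∀ᶠ w in 𝓝 w₁, D (Y w) = 0) : D (Y w₀) = 0 := by
  have hp₁ := hY₁.self_of_nhds.1
  have hYd : DifferentiableAt ℝ Y w₁ := hYs.differentiableAt (by simp)
  set P₀ := Y w₀ with hP₀
  set P₁ := Y w₁ with hP₁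
  set c := lieForm P₁ P₀ with hc
  have hdK : ∀ W, lieForm (fderiv ℝ Y w₁ W) K = 0 := by
    intro W
    have := lieForm_fderiv_add hYd (differentiableAt_const K) (c := 0)
      (hY₁.mono fun w hw => by rw [lieForm_comm, hw.1.mixed]) W
    simpa using this
  have hdP : ∀ W, lieForm (fderiv ℝ Y w₁ W) P₁ = 0 := by
    intro W
    have := lieForm_fderiv_add hYd hYd (c := 0) (hY₁.mono fun w hw => hw.1.right) W
    rw [lieForm_comm (Y w₁)] at this
    linarith
  have hdk : ∀ X W, lieForm (k X) (fderiv ℝ Y w₁ W) = 0 := by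
    intro X W
    have := lieForm_fderiv_add hYd (differentiableAt_const (k X)) (c := 0)
      (hY₁.mono fun w hw => by rw [lieForm_comm, hw.2 X]) W
    rw [lieForm_comm]
    simpa using this
  have hdd : ∀ W, lieForm (fderiv ℝ Y w₁ W) (fderiv ℝ Y w₁ W) = 0 → W = 0 := fun W hW =>
    hdY W (hp₁.mem_of_form_self (hdK W) (hdP W) hW)
  by_cases hc0 : c = 0
  · -- then `P₀` lies on the line spanned by `K` and `P₁`
    have h1 : P₀ ∈ Submodule.span ℝ {K, P₁} :=
      hp₁.mem_of_form_self (by rw [lieForm_comm, hY₀.mixed]) (by rw [lieForm_comm, ← hc, hc0])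
        hY₀.right
    obtain ⟨a, b, hab⟩ := Submodule.mem_span_pair.1 h1
    rw [← hab, add_comm, hDK, hDs, hD.self_of_nhds, mul_zero]
  -- the projection of the image of `dY` to the orthogonal complement of `P₀, P₁`
  let v : B →L[ℝ] LieSpace m := fderiv ℝ Y w₁ -
    (c⁻¹ • (lieForm P₀).comp (fderiv ℝ Y w₁)).smulRight P₁
  have hv : ∀ W, v W = fderiv ℝ Y w₁ W - (c⁻¹ * lieForm (fderiv ℝ Y w₁ W) P₀) • P₁ := by
    intro W
    simp [v, lieForm_comm P₀]
  have hvK : ∀ W, lieForm (v W) K = 0 := by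
    intro W
    rw [hv, map_sub, sub_apply, hdK, map_smul, smul_apply, lieForm_comm P₁, hp₁.mixed]; simp
  have hvP₁ : ∀ W, lieForm (v W) P₁ = 0 := by
    intro W
    rw [hv, map_sub, sub_apply, hdP, map_smul, smul_apply, hp₁.right]; simp
  have hvP₀ : ∀ W, lieForm (v W) P₀ = 0 := by
    intro W
    rw [hv, map_sub, sub_apply, map_smul, smul_apply, ← hc, smul_eq_mul]
    field_simp
    ring
  have hkv : ∀ X W, lieForm (k X) (v W) = 0 := by
    intro X W
    rw [hv, map_sub, hdk, map_smul, hY₁.self_of_nhds.2]; simp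
  have hdv : ∀ W W', lieForm (fderiv ℝ Y w₁ W) (v W') =
      lieForm (fderiv ℝ Y w₁ W) (fderiv ℝ Y w₁ W') := by
    intro W W'
    rw [hv, map_sub, map_smul, hdP]; simp
  have hvv : ∀ W, lieForm (v W) (v W) = lieForm (fderiv ℝ Y w₁ W) (fderiv ℝ Y w₁ W) := by
    intro W
    have h1 : lieForm P₁ (v W) = 0 := by rw [lieForm_comm, hvP₁]
    rw [← hdv W W]
    nth_rewrite 1 [hv W]
    rw [map_sub, sub_apply, map_smul, smul_apply, h1]; simp
  -- stereographic projection from `P₀`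
  let ℓ : LieSpace m →L[ℝ] B →L[ℝ] ℝ := ((ContinuousLinearMap.compL ℝ B (LieSpace m) ℝ).flip v).comp
    lieForm
  have hℓ : ∀ P W, ℓ P W = lieForm P (v W) := fun P W => rfl
  let G : B → B →L[ℝ] ℝ := fun w => (c / lieForm P₀ (Y w)) • ℓ (Y w)
  have hc' : lieForm P₀ (Y w₁) = c := lieForm_comm _ _
  have hcne : lieForm P₀ (Y w₁) ≠ 0 := fun h => hc0 (hc'.symm.trans h)
  have hs : ContDiffAt ℝ ∞ (fun w => c / lieForm P₀ (Y w)) w₁ :=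
    contDiffAt_const.div ((lieForm P₀).contDiff.contDiffAt.comp w₁ hYs) hcne
  have hGs : ContDiffAt ℝ ∞ G w₁ := hs.smul (ℓ.contDiff.contDiffAt.comp w₁ hYs)
  have hℓ₁ : ℓ (Y w₁) = 0 := by
    ext W
    rw [hℓ, lieForm_comm, hvP₁]; rfl
  have hGd : fderiv ℝ G w₁ = ℓ.comp (fderiv ℝ Y w₁) := by
    have h1 : DifferentiableAt ℝ (fun w => c / lieForm P₀ (Y w)) w₁ :=
      hs.differentiableAt (by simp)
    have h2 : HasFDerivAt (fun w => ℓ (Y w)) (ℓ.comp (fderiv ℝ Y w₁)) w₁ :=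
      ℓ.hasFDerivAt.comp w₁ hYd.hasFDerivAt
    have h3 : fderiv ℝ G w₁ = _ := (h1.hasFDerivAt.smul h2).fderiv
    rw [h3, hℓ₁, hc', div_self hc0]
    ext W
    simp
  have hGinj : Function.Injective (fderiv ℝ G w₁) := by
    rw [injective_iff_map_eq_zero]
    intro W hW
    have h1 : (fderiv ℝ G w₁ W) W = 0 := by rw [hW]; rfl
    rw [hGd, ContinuousLinearMap.comp_apply, hℓ, hdv] at h1
    exact hdd W h1
  obtain ⟨e, he⟩ := isInvertible_of_injective hGinj
  have hGmap : Filter.map G (𝓝 w₁) = 𝓝 0 := by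
    have h1 : HasStrictFDerivAt G (e : B →L[ℝ] B →L[ℝ] ℝ) w₁ := by
      rw [he]; exact hGs.hasStrictFDerivAt (by simp)
    rw [h1.map_nhds_eq_of_equiv]
    congr 1
    simp only [G, hℓ₁, smul_zero]
  obtain ⟨W, hW⟩ := exists_ne (0 : B)
  set β := lieForm (v W) (v W) with hβ
  have hβ0 : β ≠ 0 := by
    intro h0
    rw [hβ, hvv] at h0
    exact hW (hdd W h0)
  have hgood : ∀ᶠ w in 𝓝 w₁, D (Y w) = 0 ∧ IsNullPair K (Y w) ∧
      (∀ X, lieForm (k X) (Y w) = 0) ∧ lieForm P₀ (Y w) ≠ 0 := by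
    refine hD.and (((hY₁.and ?_).mono) fun w hw => ⟨hw.1.1, hw.1.2, hw.2⟩)
    have h1 : ContinuousAt (fun w => lieForm P₀ (Y w)) w₁ :=
      (lieForm P₀).continuous.continuousAt.comp hYs.continuousAt
    exact h1.eventually (isOpen_ne.mem_nhds hcne)
  have himage : ∀ᶠ u in 𝓝 (0 : B →L[ℝ] ℝ), ∃ w, (D (Y w) = 0 ∧ IsNullPair K (Y w) ∧
      (∀ X, lieForm (k X) (Y w) = 0) ∧ lieForm P₀ (Y w) ≠ 0) ∧ G w = u := by
    rw [← hGmap]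
    exact Filter.image_mem_map hgood
  have ht : ∀ᶠ t in 𝓝 (0 : ℝ), D (P₁ + t • v W - (t ^ 2 * β / (2 * c)) • P₀) = 0 := by
    have h1 : ContinuousAt (fun t : ℝ => t • ℓ (v W)) 0 := by fun_prop
    have h2 : ∀ᶠ t in 𝓝 (0 : ℝ), _ := h1.eventually (p := fun u => ∃ w, (D (Y w) = 0 ∧
      IsNullPair K (Y w) ∧ (∀ X, lieForm (k X) (Y w) = 0) ∧ lieForm P₀ (Y w) ≠ 0) ∧ G w = u)
      (by simpa using himage)
    filter_upwards [h2] with t htt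
    obtain ⟨w, ⟨hDw, hpw, hkw, hnw⟩, hGw⟩ := htt
    set ν := P₁ + t • v W - (t ^ 2 * β / (2 * c)) • P₀ with hν
    have hνP₀ : lieForm ν P₀ = c := by
      rw [hν, map_sub, map_add, map_smul, map_smul, sub_apply, add_apply, smul_apply, smul_apply,
        hvP₀, hY₀.right, ← hc]; simp
    have hνK : lieForm ν K = 0 := by
      rw [hν, map_sub, map_add, map_smul, map_smul, sub_apply, add_apply, smul_apply, smul_apply,
        hvK, lieForm_comm P₁, lieForm_comm P₀, hp₁.mixed, hY₀.mixed]; simp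
    have hνP₁ : lieForm ν P₁ = -(t ^ 2 * β / 2) := by
      rw [hν, map_sub, map_add, map_smul, map_smul, sub_apply, add_apply, smul_apply, smul_apply,
        hvP₁, lieForm_comm P₀, ← hc, hp₁.right]; simp; field_simp
    have hνv : lieForm ν (v W) = t * β := by
      rw [hν, map_sub, map_add, map_smul, map_smul, sub_apply, add_apply, smul_apply, smul_apply,
        lieForm_comm P₁, lieForm_comm P₀, hvP₀, hvP₁, ← hβ]; simp
    have hνν : lieForm ν ν = 0 := by
      have : lieForm ν ν = lieForm ν (P₁ + t • v W - (t ^ 2 * β / (2 * c)) • P₀) := by rw [← hν]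
      rw [this, map_sub, map_add, map_smul, map_smul, hνP₀, hνP₁, hνv, smul_eq_mul, smul_eq_mul]
      field_simp
      ring
    set s := c / lieForm P₀ (Y w) with hs
    set δ := ν - s • Y w with hδ
    have hmem : δ ∈ Submodule.span ℝ {K, P₀} := by
      refine mem_span_of_orthogonal_coprod hdim hY₀ k v.toLinearMap hkK hkY₀ hvK hvP₀ hkv hk₀
        (fun W' hW' => ?_) ?_ ?_ ?_ ?_
      · exact hdd W' (by rw [← hvv]; exact hW')
      · rw [hδ, map_sub, sub_apply, hνK, map_smul, smul_apply, lieForm_comm, hpw.mixed]; simp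
      · rw [hδ, map_sub, sub_apply, hνP₀, map_smul, smul_apply, lieForm_comm, smul_eq_mul, hs,
          div_mul_cancel₀ _ hnw, sub_self]
      · intro X
        rw [hδ, hν, lieForm_comm, map_sub, map_sub, map_add, map_smul, map_smul, map_smul, hkv,
          hkw, hkY₀, hY₁.self_of_nhds.2]; simp
      · intro W'
        have h3 : s * lieForm (Y w) (v W') = t * lieForm (v W) (v W') := DFunLike.congr_fun hGw W'
        change lieForm δ (v W') = 0
        rw [hδ, hν, map_sub, map_sub, map_add, map_smul, map_smul, map_smul, sub_apply, sub_apply,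
          add_apply, smul_apply, smul_apply, smul_apply, lieForm_comm P₁, lieForm_comm P₀, hvP₀,
          hvP₁]
        simp only [smul_eq_mul, h3]
        ring
    obtain ⟨a, b, hab⟩ := Submodule.mem_span_pair.1 hmem
    have hYw : s • Y w = ν - (a • K + b • P₀) := by rw [hab, hδ]; abel
    have hb : b = 0 := by
      have h4 : lieForm (s • Y w) (s • Y w) = 0 := by
        rw [map_smul, map_smul, smul_apply, hpw.right]; simp
      rw [hYw] at h4
      have h5 : lieForm (a • K + b • P₀) ν = b * c := by
        rw [lieForm_comm, map_add, map_smul, map_smul, hνK, hνP₀]; simp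
      have h6 : lieForm (a • K + b • P₀) (a • K + b • P₀) = 0 := by
        rw [map_add, map_smul, map_smul, hY₀.form_add_left, hY₀.form_add_right]; simp
      have h7 : lieForm ν (a • K + b • P₀) = b * c := by rw [lieForm_comm, h5]
      rw [lieForm_sub_sub, hνν, h5, h6, h7] at h4
      have h8 : b * c = 0 := by linarith
      exact (mul_eq_zero.1 h8).resolve_right hc0
    have hνeq : ν = s • Y w + a • K := by rw [hYw, hb, zero_smul]; abel
    rw [hνeq, hDK, hDs, hDw, mul_zero]
  obtain ⟨f, hf⟩ := hDp P₁ (v W) (-(β / (2 * c)) • P₀)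
  have hf0 : f = 0 := by
    refine Polynomial.eq_zero_of_infinite_isRoot f ?_
    have hlarge : ∀ᶠ τ in (atTop : Filter ℝ), f.IsRoot τ := by
      filter_upwards [tendsto_inv_atTop_zero.eventually ht, eventually_gt_atTop 0] with τ hτ hτ0
      rw [Polynomial.IsRoot.def, ← hf]
      have : τ ^ 2 • P₁ + τ • v W + -(β / (2 * c)) • P₀ =
          τ ^ 2 • (P₁ + τ⁻¹ • v W - (τ⁻¹ ^ 2 * β / (2 * c)) • P₀) := by
        rw [smul_sub, smul_add, smul_smul, smul_smul, neg_smul, sub_eq_add_neg]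
        congr 3
        · field_simp
        · field_simp
      rw [this, hDs, hτ, mul_zero]
    obtain ⟨τ₀, hτ₀⟩ := eventually_atTop.1 hlarge
    exact (Set.Ici_infinite τ₀).mono hτ₀
  have h0 := hf 0
  rw [hf0] at h0
  simp only [ne_eq, OfNat.ofNat_ne_zero, not_false_eq_true, zero_pow, zero_smul, zero_add,
    Polynomial.eval_zero, hDs] at h0
  refine (mul_eq_zero.1 h0).resolve_left (pow_ne_zero _ ?_)
  exact neg_ne_zero.2 (div_ne_zero hβ0 (mul_ne_zero two_ne_zero hc0))

end Leaf

end LieSphere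

namespace LieSphere

open Filter Topology Polynomial
open scoped Matrix

section Leaf

variable {m : ℕ} {A B : Type*} [NormedAddCommGroup A] [NormedSpace ℝ A] [FiniteDimensional ℝ A]
  [NormedAddCommGroup B] [NormedSpace ℝ B] [FiniteDimensional ℝ B]

/-- First and second order data of a Legendre submanifold along a leaf, parametrized by `w ∈ R`, of a
curvature sphere `K` which is constant on it. Here `k` and `H` are the first and second derivative
of `K` in the directions `A` transversal to the leaf, the line at `w` is spanned by `K` and `Y w`,
and `Yu w` is the derivative of `Y` in the transversal directions. The curvature spheres other than
`K` are `Y w + ρ j w • K`. -/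
structure IsLeaf {ι : Type*} (R : Set B) (K : LieSpace m) (k : A →L[ℝ] LieSpace m)
    (H : A →L[ℝ] A →L[ℝ] LieSpace m) (Y : B → LieSpace m) (Yu : B → A →L[ℝ] LieSpace m)
    (ρ : ι → B → ℝ) : Prop where
  isOpen : IsOpen R
  smooth : ContDiffOn ℝ ∞ Y R
  pair : ∀ w ∈ R, IsNullPair K (Y w)
  form_k_K : ∀ X, lieForm (k X) K = 0
  form_k_Y : ∀ w ∈ R, ∀ X, lieForm (k X) (Y w) = 0
  form_Yu_K : ∀ w ∈ R, ∀ X, lieForm (Yu w X) K = 0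
  form_Yu_Y : ∀ w ∈ R, ∀ X, lieForm (Yu w X) (Y w) = 0
  form_H_K : ∀ X Z, lieForm K (H X Z) = -lieForm (k X) (k Z)
  form_H_Y : ∀ w ∈ R, ∀ X Z, lieForm (Y w) (H X Z) = -lieForm (Yu w X) (k Z)
  k_injective : ∀ w ∈ R, ∀ X, k X ∈ Submodule.span ℝ {K, Y w} → X = 0
  Y_immersive : ∀ w ∈ R, ∀ W, fderiv ℝ Y w W ∈ Submodule.span ℝ {K, Y w} → W = 0
  smooth_ρ : ∀ j, ContinuousOn (ρ j) R
  injective_ρ : ∀ w ∈ R, Function.Injective fun j => ρ j w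
  curvature_iff : ∀ w ∈ R, ∀ c : ℝ, (∃ (X : A) (W : B), (X ≠ 0 ∨ W ≠ 0) ∧
    c • k X + Yu w X + fderiv ℝ Y w W ∈ Submodule.span ℝ {K, Y w}) ↔ ∃ j, ρ j w = c

namespace IsLeaf

variable {ι : Type*} {R : Set B} {K : LieSpace m} {k : A →L[ℝ] LieSpace m}
  {H : A →L[ℝ] A →L[ℝ] LieSpace m} {Y : B → LieSpace m} {Yu : B → A →L[ℝ] LieSpace m}
  {ρ : ι → B → ℝ} {w : B}

theorem diff (h : IsLeaf R K k H Y Yu ρ) (hw : w ∈ R) : DifferentiableAt ℝ Y w :=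
  (h.smooth.contDiffAt (h.isOpen.mem_nhds hw)).differentiableAt (by simp)

theorem form_dY_K (h : IsLeaf R K k H Y Yu ρ) (hw : w ∈ R) (W : B) :
    lieForm (fderiv ℝ Y w W) K = 0 := by
  have := lieForm_fderiv_add (h.diff hw) (differentiableAt_const K) (c := 0)
    (eventually_of_mem (h.isOpen.mem_nhds hw) fun v hv => by
      rw [lieForm_comm, (h.pair v hv).mixed]) W
  simpa using this

theorem form_dY_Y (h : IsLeaf R K k H Y Yu ρ) (hw : w ∈ R) (W : B) :
    lieForm (fderiv ℝ Y w W) (Y w) = 0 := by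
  have := lieForm_fderiv_add (h.diff hw) (h.diff hw) (c := 0)
    (eventually_of_mem (h.isOpen.mem_nhds hw) fun v hv => (h.pair v hv).right) W
  rw [lieForm_comm (Y w)] at this
  linarith

theorem form_dY_k (h : IsLeaf R K k H Y Yu ρ) (hw : w ∈ R) (W : B) (X : A) :
    lieForm (fderiv ℝ Y w W) (k X) = 0 := by
  have := lieForm_fderiv_add (h.diff hw) (differentiableAt_const (k X)) (c := 0)
    (eventually_of_mem (h.isOpen.mem_nhds hw) fun v hv => by
      rw [lieForm_comm, h.form_k_Y v hv]) W
  simpa using this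

theorem eq_zero_of_form (h : IsLeaf R K k H Y Yu ρ) (hw : w ∈ R) (W : B)
    (hW : lieForm (fderiv ℝ Y w W) (fderiv ℝ Y w W) = 0) : W = 0 :=
  h.Y_immersive w hw W ((h.pair w hw).mem_of_form_self (h.form_dY_K hw W) (h.form_dY_Y hw W) hW)

/-- A point `Y + c K` of the line is a curvature sphere iff the second fundamental form of the focal
submanifold parametrized by `K` is degenerate in its direction. -/
theorem degenerate_iff (hdim : Module.finrank ℝ A + Module.finrank ℝ B = m)
    (h : IsLeaf R K k H Y Yu ρ) (hw : w ∈ R) (c : ℝ) :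
    (∃ X ≠ 0, ∀ Z, lieForm (Y w + c • K) (H X Z) = 0) ↔ ∃ j, ρ j w = c := by
  have key : ∀ X Z, lieForm (Y w + c • K) (H X Z) = -lieForm (c • k X + Yu w X) (k Z) := by
    intro X Z
    simp only [map_add, map_smul, add_apply, smul_apply, h.form_H_K, h.form_H_Y w hw, smul_eq_mul]
    ring
  rw [← h.curvature_iff w hw c]
  constructor
  · rintro ⟨X, hX, hZ⟩
    have hinj : Function.Injective (gram (fderiv ℝ Y w) (fderiv ℝ Y w)) := by
      rw [injective_iff_map_eq_zero]
      intro W hW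
      exact h.eq_zero_of_form hw W (by rw [← gram_apply, hW]; rfl)
    obtain ⟨W, hW⟩ := (isInvertible_of_injective hinj).bijective.2
      (-((lieForm (c • k X + Yu w X)).comp (fderiv ℝ Y w)))
    refine ⟨X, W, Or.inl hX, ?_⟩
    refine mem_span_of_orthogonal_coprod hdim (h.pair w hw) k.toLinearMap (fderiv ℝ Y w).toLinearMap
      h.form_k_K (h.form_k_Y w hw) (h.form_dY_K hw) (h.form_dY_Y hw) (fun X W => ?_)
      (h.k_injective w hw) (h.eq_zero_of_form hw) ?_ ?_ ?_ ?_
    · rw [lieForm_comm]; exact h.form_dY_k hw W X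
    · simp only [map_add, map_smul, add_apply, smul_apply, h.form_k_K, h.form_Yu_K w hw,
        h.form_dY_K hw, smul_zero, add_zero]
    · simp only [map_add, map_smul, add_apply, smul_apply, h.form_k_Y w hw, h.form_Yu_Y w hw,
        h.form_dY_Y hw, smul_zero, add_zero]
    · intro Z
      have h1 := hZ Z
      rw [key, neg_eq_zero] at h1
      change lieForm _ (k Z) = 0
      rw [map_add, add_apply, h1, h.form_dY_k hw, add_zero]
    · intro W'
      have h1 := DFunLike.congr_fun hW W'
      change lieForm (fderiv ℝ Y w W) (fderiv ℝ Y w W') =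
        -lieForm (c • k X + Yu w X) (fderiv ℝ Y w W') at h1
      change lieForm _ (fderiv ℝ Y w W') = 0
      rw [map_add, add_apply, h1, add_neg_cancel]
  · rintro ⟨X, W, hXW, hmem⟩
    refine ⟨X, ?_, fun Z => ?_⟩
    · rintro rfl
      simp only [map_zero, smul_zero, add_zero, zero_add] at hmem
      exact (hXW.resolve_left fun h => h rfl) (h.Y_immersive w hw W hmem)
    · obtain ⟨a, b, hab⟩ := Submodule.mem_span_pair.1 hmem
      have h1 : lieForm (c • k X + Yu w X + fderiv ℝ Y w W) (k Z) = 0 := by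
        rw [← hab, lieForm_comm]
        simp [h.form_k_K, h.form_k_Y w hw]
      rw [map_add, add_apply, h.form_dY_k hw, add_zero] at h1
      rw [key, h1, neg_zero]

/-- If a hyperplane contains the curvature sphere `Y + ρ j K` on an open part of the leaf, then on the
whole leaf. -/
theorem eqOn_zero (hdim : Module.finrank ℝ A + Module.finrank ℝ B = m) [Nontrivial B] [Finite ι]
    (h : IsLeaf R K k H Y Yu ρ) (hR : IsPreconnected R) (e : LieSpace m →ₗ[ℝ] ℝ) (j : ι) {w₁ : B}
    (hw₁ : w₁ ∈ R) (he : ∀ᶠ w in 𝓝 w₁, e (Y w + ρ j w • K) = 0) :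
    ∀ w ∈ R, e (Y w + ρ j w • K) = 0 := by
  classical
  have hcone : ∀ (D : LieSpace m → ℝ) (N : ℕ), (∀ (c : ℝ) P, D (c • P) = c ^ N * D P) →
      (∀ (c : ℝ) P, D (P + c • K) = D P) →
      (∀ P Q R, ∃ f : ℝ[X], ∀ τ : ℝ, D (τ ^ 2 • P + τ • Q + R) = f.eval τ) →
      (∀ᶠ w in 𝓝 w₁, D (Y w) = 0) → ∀ w ∈ R, D (Y w) = 0 := by
    intro D N hDs hDK hDp hD w hw
    exact eq_zero_of_eventually_eq_zero hdim k.toLinearMap h.form_k_K (h.pair w hw)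
      (h.form_k_Y w hw) (h.k_injective w hw) (h.smooth.contDiffAt (h.isOpen.mem_nhds hw₁))
      (eventually_of_mem (h.isOpen.mem_nhds hw₁) fun v hv => ⟨h.pair v hv, h.form_k_Y v hv⟩)
      (h.Y_immersive w₁ hw₁) hDs hDK hDp hD
  by_cases heK : e K = 0
  · have h1 := hcone e 1 (by intro c P; simp) (by intro c P; simp [heK])
      (fun P Q R => ⟨C (e P) * X ^ 2 + C (e Q) * X + C (e R), fun τ => by simp; ring⟩)
      (he.mono fun w hw => by simpa [heK] using hw)
    intro w hw
    simp [heK, h1 w hw]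
  -- the determinant of the second fundamental form in the direction of the point of the line
  -- spanned by `K, P` that lies in the hyperplane
  let b := Module.finBasis ℝ A
  let Mat : LieSpace m → Matrix (Fin (Module.finrank ℝ A)) (Fin (Module.finrank ℝ A)) ℝ := fun P =>
    Matrix.of fun i j => e K * lieForm P (H (b i) (b j)) - e P * lieForm K (H (b i) (b j))
  have hMat : ∀ P X Z, ((b.repr X) ᵥ* Mat P) ⬝ᵥ (b.repr Z) =
      e K * lieForm P (H X Z) - e P * lieForm K (H X Z) := by
    intro P X Z
    have h1 : H X Z = ∑ i, ∑ j, (b.repr X i * b.repr Z j) • H (b i) (b j) := by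
      conv_lhs => rw [← b.sum_repr X, ← b.sum_repr Z]
      simp only [map_sum, map_smul, FunLike.coe_sum, Finset.sum_apply, smul_apply]
      rw [Finset.sum_comm]
      refine Finset.sum_congr rfl fun i _ => ?_
      rw [Finset.smul_sum]
      exact Finset.sum_congr rfl fun j _ => by rw [smul_smul, mul_comm]
    rw [h1]
    simp only [map_sum, map_smul, smul_eq_mul, Finset.mul_sum, dotProduct, Matrix.vecMul, Mat,
      Matrix.of_apply, Finset.sum_mul]
    rw [Finset.sum_comm, ← Finset.sum_sub_distrib]
    refine Finset.sum_congr rfl fun i _ => ?_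
    rw [← Finset.sum_sub_distrib]
    exact Finset.sum_congr rfl fun j _ => by ring
  have hdet : ∀ w ∈ R, (Mat (Y w)).det = 0 ↔ ∃ j, e (Y w + ρ j w • K) = 0 := by
    intro w hw
    rw [← Matrix.exists_vecMul_eq_zero_iff]
    have h2 : ∀ X Z, e K * lieForm (Y w) (H X Z) - e (Y w) * lieForm K (H X Z) =
        e K * lieForm (Y w + (-(e (Y w) / e K)) • K) (H X Z) := by
      intro X Z
      simp only [map_add, map_smul, add_apply, smul_apply, smul_eq_mul]
      field_simp
      ring
    have h3 : (∃ v ≠ 0, v ᵥ* Mat (Y w) = 0) ↔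
        ∃ X ≠ 0, ∀ Z, lieForm (Y w + (-(e (Y w) / e K)) • K) (H X Z) = 0 := by
      constructor
      · rintro ⟨v, hv, hv0⟩
        obtain ⟨X, rfl⟩ := b.equivFun.surjective v
        refine ⟨X, fun h0 => hv (by rw [h0, map_zero]), fun Z => ?_⟩
        have h4 := hMat (Y w) X Z
        change (b.equivFun X ᵥ* Mat (Y w)) ⬝ᵥ _ = _ at h4
        rw [hv0, zero_dotProduct, h2] at h4
        exact (mul_eq_zero.1 h4.symm).resolve_left heK
      · rintro ⟨X, hX, hZ⟩
        refine ⟨b.repr X, fun h0 => hX ?_, ?_⟩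
        · exact b.equivFun.injective (by rw [map_zero]; exact h0)
        · refine dotProduct_eq_zero _ fun u => ?_
          obtain ⟨Z, rfl⟩ := b.equivFun.surjective u
          have h4 := hMat (Y w) X Z
          rw [h2, hZ, mul_zero] at h4
          exact h4
    rw [h3, h.degenerate_iff hdim hw]
    refine exists_congr fun j => ?_
    rw [map_add, map_smul, smul_eq_mul, eq_neg_iff_add_eq_zero]
    constructor
    · intro h4
      field_simp at h4
      linarith
    · intro h4
      field_simp
      linarith
  have hall : ∀ w ∈ R, ∃ j, e (Y w + ρ j w • K) = 0 := by
    intro w hw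
    rw [← hdet w hw]
    refine hcone (fun P => (Mat P).det) (Fintype.card (Fin (Module.finrank ℝ A))) ?_ ?_ ?_ ?_ w hw
    · intro c P
      rw [← Matrix.det_smul]
      congr 1
      ext i j
      simp [Mat]; ring
    · intro c P
      congr 1
      ext i j
      simp [Mat]; ring
    · intro P Q S
      refine ⟨(Matrix.of fun i j => C (Mat P i j) * X ^ 2 + C (Mat Q i j) * X + C (Mat S i j)).det,
        fun τ => ?_⟩
      rw [← Polynomial.coe_evalRingHom, RingHom.map_det]
      congr 1
      ext i j
      simp [Mat]; ring
    · filter_upwards [he, h.isOpen.mem_nhds hw₁] with w hw hwR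
      exact (hdet w hwR).2 ⟨j, hw⟩
  have huniq : ∀ w ∈ R, ∀ j j', e (Y w + ρ j w • K) = 0 → e (Y w + ρ j' w • K) = 0 → j = j' := by
    intro w hw j j' h1 h2
    refine h.injective_ρ w hw ?_
    rw [map_add, map_smul, smul_eq_mul] at h1 h2
    exact mul_right_cancel₀ heK (by linarith)
  -- the closed sets on which the different curvature spheres lie in the hyperplane are disjoint
  have : PreconnectedSpace R := Subtype.preconnectedSpace hR
  let Cl : ι → Set R := fun j => {w | e (Y w + ρ j w • K) = 0}
  have hcl : ∀ j, IsClosed (Cl j) := by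
    intro j
    have h1 : Continuous fun w : R => e (Y w + ρ j w • K) :=
      e.continuous_of_finiteDimensional.comp ((h.smooth.continuousOn.domRestrict).add
        (((h.smooth_ρ j).domRestrict).smul continuous_const))
    exact isClosed_eq h1 continuous_const
  have hopen : IsOpen (Cl j) := by
    rw [← isClosed_compl_iff]
    have h1 : (Cl j)ᶜ = ⋃ i ∈ {i | i ≠ j}, Cl i := by
      ext w
      simp only [Set.mem_compl_iff, Set.mem_iUnion, Set.mem_ofPred_eq, exists_prop]
      constructor
      · intro hw
        obtain ⟨i, hi⟩ := hall w w.2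
        exact ⟨i, fun hij => hw (hij ▸ hi), hi⟩
      · rintro ⟨i, hij, hi⟩ hw
        exact hij (huniq w w.2 i j hi hw)
    rw [h1]
    exact (Set.toFinite _).isClosed_biUnion fun i _ => hcl i
  have huniv : Cl j = Set.univ :=
    IsClopen.eq_univ ⟨hcl j, hopen⟩ ⟨⟨w₁, hw₁⟩, he.self_of_nhds⟩
  intro w hw
  have : (⟨w, hw⟩ : R) ∈ Cl j := by rw [huniv]; trivial
  exact this

end IsLeaf

end Leaf

end LieSphere

/-! ### Charts adapted to a map of constant rank -/

namespace LieSphere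

open Filter Topology

/-- The constant rank theorem, in the form needed for foliations: around `b` there are coordinates
`(u, w)`, with `u` in the image and `w` in the kernel of `df`, such that `f` depends on `u` only and
the kernels of `df` are spanned by the `w`-directions. -/
theorem exists_constant_rank_chart {F V : Type*} [NormedAddCommGroup F] [NormedSpace ℝ F]
    [FiniteDimensional ℝ F] [NormedAddCommGroup V] [NormedSpace ℝ V] [FiniteDimensional ℝ V]
    {f : F → V} {N : Set F} (hN : IsOpen N) (hf : ContDiffOn ℝ ∞ f N) {b : F} (hb : b ∈ N)
    (hrank : ∀ p ∈ N, Module.finrank ℝ (LinearMap.ker (fderiv ℝ f p).toLinearMap) =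
      Module.finrank ℝ (LinearMap.ker (fderiv ℝ f b).toLinearMap)) :
    ∃ (Ψ : LinearMap.range (fderiv ℝ f b).toLinearMap × LinearMap.ker (fderiv ℝ f b).toLinearMap → F)
      (u₀ : LinearMap.range (fderiv ℝ f b).toLinearMap)
      (w₀ : LinearMap.ker (fderiv ℝ f b).toLinearMap) (ε : ℝ), 0 < ε ∧ Ψ (u₀, w₀) = b ∧
      (∀ s ∈ 𝓝 (u₀, w₀), Ψ '' s ∈ 𝓝 b) ∧
      ∀ u ∈ Metric.ball u₀ ε, ∀ w ∈ Metric.ball w₀ ε,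
        ContDiffAt ℝ ∞ Ψ (u, w) ∧ Ψ (u, w) ∈ N ∧ Function.Bijective (fderiv ℝ Ψ (u, w)) ∧
        f (Ψ (u, w)) = f (Ψ (u, w₀)) ∧
        ∀ X W, fderiv ℝ f (Ψ (u, w)) (fderiv ℝ Ψ (u, w) (X, W)) = 0 ↔ X = 0 := by
  set A := LinearMap.range (fderiv ℝ f b).toLinearMap with hA
  set B := LinearMap.ker (fderiv ℝ f b).toLinearMap with hB
  obtain ⟨π₀, hπ₀⟩ := LinearMap.exists_leftInverse_of_injective A.subtype (Submodule.ker_subtype A)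
  obtain ⟨σ₀, hσ₀⟩ := LinearMap.exists_leftInverse_of_injective B.subtype (Submodule.ker_subtype B)
  let π : V →L[ℝ] A := LinearMap.toContinuousLinearMap π₀
  let σ : F →L[ℝ] B := LinearMap.toContinuousLinearMap σ₀
  have hπ : ∀ x : A, π x = x := fun x => LinearMap.congr_fun hπ₀ x
  have hσ : ∀ x : B, σ x = x := fun x => LinearMap.congr_fun hσ₀ x
  let Θ : F → A × B := fun q => (π (f q), σ q)
  have hfd : ∀ p ∈ N, DifferentiableAt ℝ f p := fun p hp =>
    (hf.contDiffAt (hN.mem_nhds hp)).differentiableAt (by simp)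
  have hΘs : ∀ p ∈ N, ContDiffAt ℝ ∞ Θ p := fun p hp =>
    (π.contDiff.contDiffAt.comp p (hf.contDiffAt (hN.mem_nhds hp))).prodMk σ.contDiff.contDiffAt
  have hΘd : ∀ p ∈ N, HasFDerivAt Θ ((π.comp (fderiv ℝ f p)).prod σ) p := fun p hp =>
    (π.hasFDerivAt.comp p (hfd p hp).hasFDerivAt).prodMk σ.hasFDerivAt
  have hdim : Module.finrank ℝ F = Module.finrank ℝ (A × B) := by
    rw [Module.finrank_prod, hA, hB, LinearMap.finrank_range_add_finrank_ker]
  have equivOf : ∀ D : F →L[ℝ] A × B, Function.Injective D →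
      ∃ e : F ≃L[ℝ] A × B, (e : F →L[ℝ] A × B) = D := fun D hD =>
    ⟨(LinearEquiv.ofInjectiveOfFinrankEq D.toLinearMap hD hdim).toContinuousLinearEquiv,
      by ext <;> rfl⟩
  have hinjb : Function.Injective ((π.comp (fderiv ℝ f b)).prod σ) := by
    rw [injective_iff_map_eq_zero]
    intro X hX
    have h1 : π (fderiv ℝ f b X) = 0 := congrArg Prod.fst hX
    have h2 : σ X = 0 := congrArg Prod.snd hX
    have h3 : fderiv ℝ f b X = 0 := by
      have h4 := hπ ⟨fderiv ℝ f b X, LinearMap.mem_range_self _ X⟩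
      simp only at h4
      rw [h1] at h4
      exact (congrArg Subtype.val h4).symm
    have h5 := hσ ⟨X, h3⟩
    simp only at h5
    rw [h2] at h5
    exact (congrArg Subtype.val h5).symm
  obtain ⟨e, he⟩ := equivOf _ hinjb
  have hbd : HasFDerivAt Θ (e : F →L[ℝ] A × B) b := by rw [he]; exact hΘd b hb
  let Φ := (hΘs b hb).toOpenPartialHomeomorph Θ hbd (by simp)
  have hΦ : ∀ p, Φ p = Θ p := fun p => rfl
  have hbs : b ∈ Φ.source := (hΘs b hb).mem_toOpenPartialHomeomorph_source hbd (by simp)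
  -- near `b` the derivative of the coordinates stays invertible
  have hnear : ∀ᶠ p in 𝓝 b, p ∈ Φ.source ∧ p ∈ N ∧
      Function.Injective ((π.comp (fderiv ℝ f p)).prod σ) := by
    refine (Φ.open_source.eventually_mem hbs).and ((hN.eventually_mem hb).and ?_)
    have hc : ContinuousAt (fun p => (π.comp (fderiv ℝ f p)).prod σ) b := by
      have h1 : ContinuousAt (fderiv ℝ Θ) b :=
        ((hΘs b hb).fderiv_right (m := 0) (by simp)).continuousAt
      refine h1.congr ?_
      filter_upwards [hN.mem_nhds hb] with p hp using (hΘd p hp).fderiv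
    have hopen : Set.range ((↑) : (F ≃L[ℝ] A × B) → F →L[ℝ] A × B) ∈
        𝓝 ((π.comp (fderiv ℝ f b)).prod σ) := by
      rw [← he]; exact ContinuousLinearEquiv.nhds e
    filter_upwards [hc.preimage_mem_nhds hopen] with p hp
    obtain ⟨e', he'⟩ := hp
    have he'' : (e' : F →L[ℝ] A × B) = (π.comp (fderiv ℝ f p)).prod σ := he'
    rw [← he'']
    exact e'.injective
  have hbt : Θ b ∈ Φ.target := Φ.map_source hbs
  have hsymmb : Φ.symm (Θ b) = b := Φ.left_inv hbs
  have hbox : ∀ᶠ x in 𝓝 (Θ b), x ∈ Φ.target ∧ Φ.symm x ∈ N ∧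
      Function.Injective ((π.comp (fderiv ℝ f (Φ.symm x))).prod σ) := by
    refine (Φ.open_target.eventually_mem hbt).and ?_
    have h1 : Tendsto Φ.symm (𝓝 (Θ b)) (𝓝 b) := by
      have := Φ.symm.continuousAt (x := Θ b) hbt
      rwa [ContinuousAt, hsymmb] at this
    exact (h1.eventually hnear).mono fun x hx => hx.2
  obtain ⟨ε, hε, hball⟩ := Metric.eventually_nhds_iff_ball.1 hbox
  have hbox' : ∀ u ∈ Metric.ball (Θ b).1 ε, ∀ w ∈ Metric.ball (Θ b).2 ε, (u, w) ∈ Φ.target ∧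
      Φ.symm (u, w) ∈ N ∧ Function.Injective ((π.comp (fderiv ℝ f (Φ.symm (u, w)))).prod σ) := by
    intro u hu w hw
    refine hball (u, w) ?_
    rw [← ball_prod_same]
    exact ⟨hu, hw⟩
  -- properties of the inverse of the coordinate map
  have hsm : ∀ u ∈ Metric.ball (Θ b).1 ε, ∀ w ∈ Metric.ball (Θ b).2 ε,
      ContDiffAt ℝ ∞ Φ.symm (u, w) ∧ Function.Bijective (fderiv ℝ Φ.symm (u, w)) ∧
      ∀ X W, fderiv ℝ f (Φ.symm (u, w)) (fderiv ℝ Φ.symm (u, w) (X, W)) = 0 ↔ X = 0 := by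
    intro u hu w hw
    obtain ⟨ht, hpN, hinj⟩ := hbox' u hu w hw
    set p := Φ.symm (u, w) with hp
    obtain ⟨e', he'⟩ := equivOf _ hinj
    have hpd : HasFDerivAt Φ (e' : F →L[ℝ] A × B) p := by rw [he']; exact hΘd p hpN
    have h1 : ContDiffAt ℝ ∞ Φ.symm (u, w) := Φ.contDiffAt_symm ht hpd (hΘs p hpN)
    have h2 : HasFDerivAt Φ.symm (e'.symm : A × B →L[ℝ] F) (u, w) := Φ.hasFDerivAt_symm ht hpd
    refine ⟨h1, ?_, ?_⟩
    · rw [h2.fderiv]; exact e'.symm.bijective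
    · intro X W
      rw [h2.fderiv]
      have h3 : ∀ x : A × B, π (fderiv ℝ f p (e'.symm x)) = x.1 ∧ σ (e'.symm x) = x.2 := by
        intro x
        have h4 : (π.comp (fderiv ℝ f p)).prod σ (e'.symm x) = x := by
          rw [← he']; exact e'.apply_symm_apply x
        exact ⟨congrArg Prod.fst h4, congrArg Prod.snd h4⟩
      constructor
      · intro h0
        have h4 : π (fderiv ℝ f p ((e'.symm : A × B →L[ℝ] F) (X, W))) = X := (h3 (X, W)).1
        rw [← h4, h0, map_zero]
      · rintro rfl
        -- the kernel of `π ∘ df` has at most the dimension of the kernel of `df`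
        let ker' := LinearMap.ker (π.comp (fderiv ℝ f p)).toLinearMap
        have hle : LinearMap.ker (fderiv ℝ f p).toLinearMap ≤ ker' := by
          intro x hx
          have hx' : fderiv ℝ f p x = 0 := hx
          change π (fderiv ℝ f p x) = 0
          rw [hx', map_zero]
        have hker : Module.finrank ℝ ker' ≤ Module.finrank ℝ B := by
          refine LinearMap.finrank_le_finrank_of_injective
            (f := σ.toLinearMap.comp ker'.subtype) ?_
          rw [injective_iff_map_eq_zero]
          intro x hx
          have h5 : (π.comp (fderiv ℝ f p)).prod σ x = 0 := Prod.ext x.2 hx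
          exact Subtype.ext (hinj (h5.trans (map_zero _).symm))
        have heq := Submodule.eq_of_le_of_finrank_le hle (by rw [hrank p hpN]; exact hker)
        have hmem : e'.symm (0, W) ∈ ker' := (h3 (0, W)).1
        rw [← heq] at hmem
        exact hmem
  refine ⟨Φ.symm, (Θ b).1, (Θ b).2, ε, hε, hsymmb, ?_, ?_⟩
  · intro s hs
    have h1 := Φ.symm.image_mem_nhds (x := Θ b) hbt hs
    rwa [hsymmb] at h1
  · intro u hu w hw
    obtain ⟨h1, h2, h3⟩ := hsm u hu w hw
    refine ⟨h1, (hbox' u hu w hw).2.1, h2, ?_, h3⟩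
    have hw₀ : (Θ b).2 ∈ Metric.ball (Θ b).2 ε := Metric.mem_ball_self hε
    have hd : ∀ v ∈ Metric.ball (Θ b).2 ε,
        HasFDerivAt (fun v => f (Φ.symm (u, v))) (0 : B →L[ℝ] V) v := by
      intro v hv
      have h4 : HasFDerivAt (fun v : B => (u, v)) (ContinuousLinearMap.inr ℝ A B) v :=
        hasFDerivAt_prodMk_right u v
      have h5 := ((hfd _ (hbox' u hu v hv).2.1).hasFDerivAt.comp v
        (((hsm u hu v hv).1.differentiableAt (by simp)).hasFDerivAt.comp v h4))
      refine h5.congr_fderiv ?_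
      ext W
      exact ((hsm u hu v hv).2.2 0 W).2 rfl
    exact (convex_ball (Θ b).2 ε).is_const_of_fderivWithin_eq_zero (𝕜 := ℝ)
      (fun v hv => (hd v hv).differentiableAt.differentiableWithinAt)
      (fun v hv => by
        rw [fderivWithin_of_isOpen Metric.isOpen_ball hv, (hd v hv).fderiv]) hw hw₀

end LieSphere

/-! ### Unique continuation for curvature spheres in a hyperplane -/

namespace LieSphere

open Filter Topology

section Span

variable {m : ℕ} {y z : LieSpace m}

theorem span_sphere_eq {a : ℝ} (ha : a ≠ 0) (c : ℝ) :
    Submodule.span ℝ {a • (z - c • y), y} = Submodule.span ℝ {y, z} := by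
  apply le_antisymm
  · rw [Submodule.span_le]
    rintro _ (rfl | rfl)
    · exact Submodule.mem_span_pair.2 ⟨-(a * c), a, by rw [smul_sub, smul_smul, neg_smul]; abel⟩
    · exact Submodule.subset_span (by simp)
  · rw [Submodule.span_le]
    rintro _ (rfl | rfl)
    · exact Submodule.subset_span (by simp)
    · refine Submodule.mem_span_pair.2 ⟨a⁻¹, c, ?_⟩
      rw [smul_smul, inv_mul_cancel₀ ha, one_smul, sub_add_cancel]

theorem IsNullPair.sphere (h : IsNullPair y z) {a : ℝ} (ha : a ≠ 0) (c : ℝ) :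
    IsNullPair (a • (z - c • y)) y := by
  refine ⟨LinearIndependent.pair_iff.2 fun s t hst => ?_, ?_, ?_, h.left⟩
  · have h1 : (t - s * a * c) • y + (s * a) • z = 0 := by
      rw [← hst]; module
    obtain ⟨h2, h3⟩ := h.coeff_eq_zero h1
    have hs : s = 0 := (mul_eq_zero.1 h3).resolve_right ha
    rw [hs] at h2
    exact ⟨hs, by simpa using h2⟩
  · simp [h.left, h.right, h.mixed, h.symm.mixed]
  · simp [h.left, h.symm.mixed]

end Span

variable {m : ℕ} {F : Type*} [NormedAddCommGroup F] [NormedSpace ℝ F] {g : ℕ}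

/-- The vector `z - κ y` scaled so that the linear functional `β` is one on it. -/
noncomputable def unitSphereVec (β : LieSpace m →L[ℝ] ℝ) (y z : F → LieSpace m) (κ : F → ℝ) (p : F) :
    LieSpace m := (β (sphereVec y z κ p))⁻¹ • sphereVec y z κ p

/-- The infinitesimal form of the Dupin condition: the derivative of each curvature sphere in the
directions of its principal space vanishes in projective space. -/
def IsInfinitesimallyDupin (Ω : Set F) (y z : F → LieSpace m) (κ : Fin g → F → ℝ) : Prop :=
  ∀ q ∈ Ω, ∀ l, ∀ X ∈ Module.End.eigenspace (shapeOp y z q).toLinearMap (κ l q),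
    fderiv ℝ (sphereVec y z (κ l)) q X ∈ Submodule.span ℝ {sphereVec y z (κ l) q}

namespace IsCurvatureFrame

variable {Ω : Set F} {y z : F → LieSpace m} {κ : Fin g → F → ℝ} {d : Fin g → ℕ} {q : F}
  {β : LieSpace m →L[ℝ] ℝ} {i : Fin g}

theorem isOpen_unit (h : IsCurvatureFrame Ω y z κ d) (β : LieSpace m →L[ℝ] ℝ) (i : Fin g) :
    IsOpen {q | q ∈ Ω ∧ β (sphereVec y z (κ i) q) ≠ 0} := by
  have h1 : ContinuousOn (fun q => β (sphereVec y z (κ i) q)) Ω := fun q hq =>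
    (β.continuous.continuousAt.comp (h.contDiffAt_sphereVec hq i).continuousAt).continuousWithinAt
  exact h1.isOpen_inter_preimage h.isOpen isOpen_ne

theorem contDiffAt_unit (h : IsCurvatureFrame Ω y z κ d) (hq : q ∈ Ω)
    (hβ : β (sphereVec y z (κ i) q) ≠ 0) : ContDiffAt ℝ ∞ (unitSphereVec β y z (κ i)) q :=
  ((β.contDiff.contDiffAt.comp q (h.contDiffAt_sphereVec hq i)).inv hβ).smul
    (h.contDiffAt_sphereVec hq i)

theorem fderiv_unit (h : IsCurvatureFrame Ω y z κ d) (hq : q ∈ Ω)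
    (hβ : β (sphereVec y z (κ i) q) ≠ 0) (X : F) : ∃ c : ℝ,
      fderiv ℝ (unitSphereVec β y z (κ i)) q X = (β (sphereVec y z (κ i) q))⁻¹ •
        fderiv ℝ (sphereVec y z (κ i)) q X + c • sphereVec y z (κ i) q := by
  have h1 : DifferentiableAt ℝ (fun p => (β (sphereVec y z (κ i) p))⁻¹) q :=
    ((β.contDiff.contDiffAt.comp q (h.contDiffAt_sphereVec hq i)).inv hβ).differentiableAt (by simp)
  have h2 := fderiv_fun_smul h1 ((h.contDiffAt_sphereVec hq i).differentiableAt (by simp))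
  exact ⟨fderiv ℝ (fun p => (β (sphereVec y z (κ i) p))⁻¹) q X, by
    unfold unitSphereVec; rw [h2]; rfl⟩

theorem form_fderiv_unit (h : IsCurvatureFrame Ω y z κ d) (hq : q ∈ Ω)
    (hβ : β (sphereVec y z (κ i) q) ≠ 0) (X : F) :
    lieForm (fderiv ℝ (unitSphereVec β y z (κ i)) q X) (y q) = 0 ∧
      lieForm (fderiv ℝ (unitSphereVec β y z (κ i)) q X) (z q) = 0 := by
  obtain ⟨c, hc⟩ := h.fderiv_unit hq hβ X
  rw [hc, h.fderiv_sphereVec hq]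
  have hp := h.pair q hq
  simp [sphereVec, h.form_dy_y hq, h.form_dz_z hq, h.form_dz_y hq, h.contact q hq, hp.left,
    hp.mixed, hp.right, hp.symm.mixed]

theorem sphereVec_mem (i : Fin g) (q : F) :
    sphereVec y z (κ i) q ∈ Submodule.span ℝ {y q, z q} :=
  Submodule.mem_span_pair.2 ⟨-κ i q, 1, by rw [sphereVec]; module⟩

variable [FiniteDimensional ℝ F]

theorem mem_of_fderiv_unit_mem (hF : Module.finrank ℝ F = m) (h : IsCurvatureFrame Ω y z κ d)
    (hq : q ∈ Ω) (hβ : β (sphereVec y z (κ i) q) ≠ 0) {X : F}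
    (hX : fderiv ℝ (unitSphereVec β y z (κ i)) q X ∈ Submodule.span ℝ {y q, z q}) :
    X ∈ Module.End.eigenspace (shapeOp y z q).toLinearMap (κ i q) := by
  obtain ⟨c, hc⟩ := h.fderiv_unit hq hβ X
  rw [hc, Submodule.add_mem_iff_left _ (Submodule.smul_mem _ _ (sphereVec_mem i q)),
    Submodule.smul_mem_iff _ (inv_ne_zero hβ), h.fderiv_sphereVec_mem_iff hq] at hX
  exact (h.mem_eigenspace_iff hF hq _ X).2 hX

/-- The scaled curvature sphere has constant rank, and its fibres are tangent to the principal
spaces. -/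
theorem fderiv_unit_eq_zero_iff (hF : Module.finrank ℝ F = m) (h : IsCurvatureFrame Ω y z κ d)
    (hD : IsInfinitesimallyDupin Ω y z κ) (hq : q ∈ Ω) (hβ : β (sphereVec y z (κ i) q) ≠ 0) (X : F) :
    fderiv ℝ (unitSphereVec β y z (κ i)) q X = 0 ↔
      X ∈ Module.End.eigenspace (shapeOp y z q).toLinearMap (κ i q) := by
  constructor
  · intro h0
    exact h.mem_of_fderiv_unit_mem hF hq hβ (by rw [h0]; exact Submodule.zero_mem _)
  · intro hX
    obtain ⟨a, ha⟩ := Submodule.mem_span_singleton.1 (hD q hq i X hX)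
    obtain ⟨c, hc⟩ := h.fderiv_unit hq hβ X
    rw [← ha, smul_smul, ← add_smul] at hc
    -- the functional `β` is constant on the scaled vectors
    have h1 : β (fderiv ℝ (unitSphereVec β y z (κ i)) q X) = 0 := by
      have h2 : (fun p => β (unitSphereVec β y z (κ i) p)) =ᶠ[𝓝 q] fun _ => (1 : ℝ) := by
        filter_upwards [(h.isOpen_unit β i).mem_nhds ⟨hq, hβ⟩] with p hp
        rw [unitSphereVec, map_smul, smul_eq_mul, inv_mul_cancel₀ hp.2]
      have h3 : HasFDerivAt (fun p => β (unitSphereVec β y z (κ i) p))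
          (β.comp (fderiv ℝ (unitSphereVec β y z (κ i)) q)) q :=
        β.hasFDerivAt.comp q ((h.contDiffAt_unit hq hβ).differentiableAt (by simp)).hasFDerivAt
      have h4 := h3.unique ((hasFDerivAt_const (1 : ℝ) q).congr_of_eventuallyEq h2)
      exact DFunLike.congr_fun h4 X
    rw [hc, map_smul, smul_eq_mul] at h1
    rw [hc, (mul_eq_zero.1 h1).resolve_right hβ, zero_smul]

/-- The position, relative to `y`, of the other curvature spheres on the line spanned by the curvature
sphere `i` and `y`. -/
theorem exists_principal_iff (hF : Module.finrank ℝ F = m) (h : IsCurvatureFrame Ω y z κ d)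
    (hq : q ∈ Ω) (i : Fin g) (c : ℝ) :
    (∃ ξ ≠ 0, c • (fderiv ℝ z q ξ - κ i q • fderiv ℝ y q ξ) + fderiv ℝ y q ξ ∈
      Submodule.span ℝ {y q, z q}) ↔ ∃ j : {j // j ≠ i}, (κ i q - κ j q)⁻¹ = c := by
  have h1 : ∀ ξ, c • (fderiv ℝ z q ξ - κ i q • fderiv ℝ y q ξ) + fderiv ℝ y q ξ =
      (1 - c * κ i q) • fderiv ℝ y q ξ + c • fderiv ℝ z q ξ := fun ξ => by module
  simp only [h1, h.principal_iff hF hq]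
  constructor
  · rintro ⟨ξ, hξ, h2⟩
    have hc : c ≠ 0 := by
      rintro rfl
      apply hξ
      simpa using h2
    have h3 : shapeOp y z q ξ = (κ i q - c⁻¹) • ξ := by
      have h4 : c • (shapeOp y z q ξ - (κ i q - c⁻¹) • ξ) = 0 := by
        rw [← h2, smul_sub, smul_smul, mul_sub, mul_inv_cancel₀ hc]; module
      exact sub_eq_zero.1 ((smul_eq_zero.1 h4).resolve_left hc)
    obtain ⟨j, hj⟩ := (h.hasEigenvalue_iff q hq (κ i q - c⁻¹)).1
      (Module.End.hasEigenvalue_of_hasEigenvector ⟨Module.End.mem_eigenspace_iff.2 h3, hξ⟩)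
    refine ⟨⟨j, ?_⟩, ?_⟩
    · rintro rfl
      exact inv_ne_zero hc (by linarith)
    · rw [hj, sub_sub_cancel, inv_inv]
  · rintro ⟨⟨j, hj⟩, rfl⟩
    obtain ⟨ξ, hξ⟩ := ((h.hasEigenvalue_iff q hq (κ j q)).2 ⟨j, rfl⟩).exists_hasEigenvector
    have hS : shapeOp y z q ξ = κ j q • ξ := hξ.apply_eq_smul
    have hne : κ i q - κ j q ≠ 0 := sub_ne_zero.2 fun h0 => hj (h.injective q hq h0).symm
    refine ⟨ξ, hξ.2, ?_⟩
    rw [hS, smul_smul, ← add_smul]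
    have : 1 - (κ i q - κ j q)⁻¹ * κ i q + (κ i q - κ j q)⁻¹ * κ j q = 0 := by
      field_simp; ring
    rw [this, zero_smul]

/-- In coordinates `Ψ (u, w)` adapted to the kernels of the differential of the curvature sphere `i`,
the slices `u = const` are leaves. -/
theorem isLeaf_of_chart (hF : Module.finrank ℝ F = m) (h : IsCurvatureFrame Ω y z κ d)
    (hD : IsInfinitesimallyDupin Ω y z κ) {A B : Type*} [NormedAddCommGroup A] [NormedSpace ℝ A]
    [NormedAddCommGroup B] [NormedSpace ℝ B] {Ψ : A × B → F} {u₀ : A} {w₀ : B} {ε : ℝ} (hε : 0 < ε)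
    (hΨ : ∀ u ∈ Metric.ball u₀ ε, ∀ w ∈ Metric.ball w₀ ε,
        ContDiffAt ℝ ∞ Ψ (u, w) ∧ Ψ (u, w) ∈ {q | q ∈ Ω ∧ β (sphereVec y z (κ i) q) ≠ 0} ∧
        Function.Bijective (fderiv ℝ Ψ (u, w)) ∧
        unitSphereVec β y z (κ i) (Ψ (u, w)) = unitSphereVec β y z (κ i) (Ψ (u, w₀)) ∧
        ∀ X W, fderiv ℝ (unitSphereVec β y z (κ i)) (Ψ (u, w)) (fderiv ℝ Ψ (u, w) (X, W)) = 0 ↔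
          X = 0) {u : A} (hu : u ∈ Metric.ball u₀ ε) :
    IsLeaf (Metric.ball w₀ ε) (unitSphereVec β y z (κ i) (Ψ (u, w₀)))
      (fderiv ℝ (fun v => unitSphereVec β y z (κ i) (Ψ (v, w₀))) u)
      (fderiv ℝ (fderiv ℝ fun v => unitSphereVec β y z (κ i) (Ψ (v, w₀))) u)
      (fun w => y (Ψ (u, w))) (fun w => fderiv ℝ (fun v => y (Ψ (v, w))) u)
      (fun (j : {j // j ≠ i}) w => β (sphereVec y z (κ i) (Ψ (u, w))) *
        (κ i (Ψ (u, w)) - κ j (Ψ (u, w)))⁻¹) := by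
  set U := unitSphereVec β y z (κ i) with hU
  have hw₀ : w₀ ∈ Metric.ball w₀ ε := Metric.mem_ball_self hε
  have hΨd : ∀ v ∈ Metric.ball u₀ ε, ∀ w ∈ Metric.ball w₀ ε,
      HasFDerivAt Ψ (fderiv ℝ Ψ (v, w)) (v, w) := fun v hv w hw =>
    ((hΨ v hv w hw).1.differentiableAt (by simp)).hasFDerivAt
  have hUs : ∀ v ∈ Metric.ball u₀ ε, ∀ w ∈ Metric.ball w₀ ε, ContDiffAt ℝ ∞ U (Ψ (v, w)) :=
    fun v hv w hw => h.contDiffAt_unit (hΨ v hv w hw).2.1.1 (hΨ v hv w hw).2.1.2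
  have hys : ∀ v ∈ Metric.ball u₀ ε, ∀ w ∈ Metric.ball w₀ ε, ContDiffAt ℝ ∞ y (Ψ (v, w)) :=
    fun v hv w hw => h.contDiffAt_left (hΨ v hv w hw).2.1.1
  have hinl : ∀ v ∈ Metric.ball u₀ ε, ∀ w ∈ Metric.ball w₀ ε, HasFDerivAt (fun v => Ψ (v, w))
      ((fderiv ℝ Ψ (v, w)).comp (ContinuousLinearMap.inl ℝ A B)) v := fun v hv w hw =>
    (hΨd v hv w hw).comp v (hasFDerivAt_prodMk_left v w)
  have hinr : ∀ w ∈ Metric.ball w₀ ε, HasFDerivAt (fun w => Ψ (u, w))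
      ((fderiv ℝ Ψ (u, w)).comp (ContinuousLinearMap.inr ℝ A B)) w := fun w hw =>
    (hΨd u hu w hw).comp w (hasFDerivAt_prodMk_right u w)
  -- the derivative of the curvature sphere in the transversal directions
  have hk : ∀ v ∈ Metric.ball u₀ ε, ∀ w ∈ Metric.ball w₀ ε, ∀ X W,
      fderiv ℝ (fun v => U (Ψ (v, w₀))) v X = fderiv ℝ U (Ψ (v, w)) (fderiv ℝ Ψ (v, w) (X, W)) := by
    intro v hv w hw X W
    have h1 : (fun v => U (Ψ (v, w₀))) =ᶠ[𝓝 v] fun v => U (Ψ (v, w)) := by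
      filter_upwards [Metric.isOpen_ball.mem_nhds hv] with v' hv'
      exact (hΨ v' hv' w hw).2.2.2.1.symm
    have h2 := HasFDerivAt.comp (g := U) (f := fun v => Ψ (v, w)) v
      ((hUs v hv w hw).differentiableAt (by simp)).hasFDerivAt (hinl v hv w hw)
    change HasFDerivAt (fun v => U (Ψ (v, w))) _ v at h2
    rw [h1.fderiv_eq, h2.fderiv]
    have h3 : ((X, W) : A × B) = (X, 0) + (0, W) := by simp
    have h4 := ((hΨ v hv w hw).2.2.2.2 0 W).2 rfl
    rw [h3, map_add, map_add, h4, add_zero]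
    rfl
  have hYu : ∀ w ∈ Metric.ball w₀ ε, ∀ X, fderiv ℝ (fun v => y (Ψ (v, w))) u X =
      fderiv ℝ y (Ψ (u, w)) (fderiv ℝ Ψ (u, w) (X, 0)) := by
    intro w hw X
    have h2 := HasFDerivAt.comp (g := y) (f := fun v => Ψ (v, w)) u
      ((hys u hu w hw).differentiableAt (by simp)).hasFDerivAt (hinl u hu w hw)
    change HasFDerivAt (fun v => y (Ψ (v, w))) _ u at h2
    rw [h2.fderiv]
    rfl
  have hY : ∀ w ∈ Metric.ball w₀ ε, ∀ W, fderiv ℝ (fun w => y (Ψ (u, w))) w W =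
      fderiv ℝ y (Ψ (u, w)) (fderiv ℝ Ψ (u, w) (0, W)) := by
    intro w hw W
    have h2 := HasFDerivAt.comp (g := y) (f := fun w => Ψ (u, w)) w
      ((hys u hu w hw).differentiableAt (by simp)).hasFDerivAt (hinr w hw)
    change HasFDerivAt (fun w => y (Ψ (u, w))) _ w at h2
    rw [h2.fderiv]
    rfl
  have hspan : ∀ v ∈ Metric.ball u₀ ε, ∀ w ∈ Metric.ball w₀ ε,
      Submodule.span ℝ {U (Ψ (v, w₀)), y (Ψ (v, w))} =
        Submodule.span ℝ {y (Ψ (v, w)), z (Ψ (v, w))} := by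
    intro v hv w hw
    rw [← (hΨ v hv w hw).2.2.2.1]
    exact span_sphere_eq (inv_ne_zero (hΨ v hv w hw).2.1.2) _
  have hpair : ∀ v ∈ Metric.ball u₀ ε, ∀ w ∈ Metric.ball w₀ ε,
      IsNullPair (U (Ψ (v, w₀))) (y (Ψ (v, w))) := by
    intro v hv w hw
    rw [← (hΨ v hv w hw).2.2.2.1]
    exact (h.pair _ (hΨ v hv w hw).2.1.1).sphere (inv_ne_zero (hΨ v hv w hw).2.1.2) _
  have hformk : ∀ v ∈ Metric.ball u₀ ε, ∀ w ∈ Metric.ball w₀ ε, ∀ X,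
      lieForm (fderiv ℝ (fun v => U (Ψ (v, w₀))) v X) (y (Ψ (v, w))) = 0 ∧
      lieForm (fderiv ℝ (fun v => U (Ψ (v, w₀))) v X) (U (Ψ (v, w₀))) = 0 := by
    intro v hv w hw X
    obtain ⟨h1, h2⟩ := h.form_fderiv_unit (hΨ v hv w hw).2.1.1 (hΨ v hv w hw).2.1.2
      (fderiv ℝ Ψ (v, w) (X, 0))
    rw [hk v hv w hw X 0]
    refine ⟨h1, ?_⟩
    have h3 : U (Ψ (v, w₀)) ∈ Submodule.span ℝ {y (Ψ (v, w)), z (Ψ (v, w))} := by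
      rw [← hspan v hv w hw]; exact Submodule.subset_span (by simp)
    obtain ⟨a, b, hab⟩ := Submodule.mem_span_pair.1 h3
    rw [← hab, map_add, map_smul, map_smul, h1, h2]
    simp
  have hks : ContDiffAt ℝ 2 (fun v => U (Ψ (v, w₀))) u := by
    have h1 : ContDiffAt ℝ ∞ (fun v => Ψ (v, w₀)) u :=
      (hΨ u hu w₀ hw₀).1.comp u (contDiffAt_id.prodMk contDiffAt_const)
    exact ((hUs u hu w₀ hw₀).comp u h1).of_le two_le_infty
  have hYud : ∀ w ∈ Metric.ball w₀ ε, DifferentiableAt ℝ (fun v => y (Ψ (v, w))) u := fun w hw =>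
    (HasFDerivAt.comp (g := y) (f := fun v => Ψ (v, w)) u
      ((hys u hu w hw).differentiableAt (by simp)).hasFDerivAt (hinl u hu w hw)).differentiableAt
  have hballu := Metric.isOpen_ball.mem_nhds hu
  refine ⟨Metric.isOpen_ball, ?_, hpair u hu, fun X => (hformk u hu w₀ hw₀ X).2,
    fun w hw X => (hformk u hu w hw X).1, ?_, ?_, ?_, ?_, ?_, ?_, ?_, ?_, ?_⟩
  · intro w hw
    have h1 : ContDiffAt ℝ ∞ (fun w => Ψ (u, w)) w :=
      (hΨ u hu w hw).1.comp w (contDiffAt_const.prodMk contDiffAt_id)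
    exact ((hys u hu w hw).comp w h1).contDiffWithinAt
  · intro w hw X
    have h1 := h.form_dy_y (hΨ u hu w hw).2.1.1 (fderiv ℝ Ψ (u, w) (X, 0))
    have h2 := h.contact _ (hΨ u hu w hw).2.1.1 (fderiv ℝ Ψ (u, w) (X, 0))
    have h3 : U (Ψ (u, w₀)) ∈ Submodule.span ℝ {y (Ψ (u, w)), z (Ψ (u, w))} := by
      rw [← hspan u hu w hw]; exact Submodule.subset_span (by simp)
    obtain ⟨a, b, hab⟩ := Submodule.mem_span_pair.1 h3
    rw [hYu w hw, ← hab, map_add, map_smul, map_smul, h1, h2]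
    simp
  · intro w hw X
    rw [hYu w hw]
    exact h.form_dy_y (hΨ u hu w hw).2.1.1 _
  · intro X Z
    refine lieForm_second_fderiv (hks.differentiableAt (by norm_num)) hks ?_ X
    filter_upwards [hballu] with v hv
    rw [lieForm_comm]
    exact (hformk v hv w₀ hw₀ Z).2
  · intro w hw X Z
    refine lieForm_second_fderiv (a := fun v => y (Ψ (v, w))) (hYud w hw) hks ?_ X
    filter_upwards [hballu] with v hv
    rw [lieForm_comm]
    exact (hformk v hv w hw Z).1
  · intro w hw X hX
    rw [hspan u hu w hw, hk u hu w hw X 0] at hX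
    have h1 := h.mem_of_fderiv_unit_mem hF (hΨ u hu w hw).2.1.1 (hΨ u hu w hw).2.1.2 hX
    rw [← h.fderiv_unit_eq_zero_iff hF hD (hΨ u hu w hw).2.1.1 (hΨ u hu w hw).2.1.2] at h1
    exact ((hΨ u hu w hw).2.2.2.2 X 0).1 h1
  · intro w hw W hW
    rw [hspan u hu w hw, hY w hw] at hW
    have h1 := h.regular _ (hΨ u hu w hw).2.1.1 _ hW
    have h2 := (hΨ u hu w hw).2.2.1.1 (h1.trans (map_zero _).symm)
    exact congrArg Prod.snd h2
  · intro j w hw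
    have h0 : ContinuousAt (fun w => Ψ (u, w)) w := (hinr w hw).continuousAt
    have hΩ := (hΨ u hu w hw).2.1.1
    have h1 : ContinuousAt (fun w => β (sphereVec y z (κ i) (Ψ (u, w)))) w :=
      β.continuous.continuousAt.comp
        (ContinuousAt.comp (f := fun w => Ψ (u, w)) (h.contDiffAt_sphereVec hΩ i).continuousAt h0)
    have h2 : ∀ l, ContinuousAt (fun w => κ l (Ψ (u, w))) w := fun l =>
      ContinuousAt.comp (f := fun w => Ψ (u, w)) (h.contDiffAt_curv hΩ l).continuousAt h0
    refine (h1.mul (((h2 i).sub (h2 j)).inv₀ ?_)).continuousWithinAt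
    exact sub_ne_zero.2 fun h0 => j.2 (h.injective _ hΩ h0).symm
  · intro w hw j j' hjj
    have h1 := mul_left_cancel₀ (hΨ u hu w hw).2.1.2 hjj
    have h2 := sub_right_injective (inv_injective h1)
    exact Subtype.ext (h.injective _ (hΨ u hu w hw).2.1.1 h2)
  · intro w hw c
    obtain ⟨hΩ, hβ⟩ := (hΨ u hu w hw).2.1
    set b := β (sphereVec y z (κ i) (Ψ (u, w))) with hb
    have h1 := h.exists_principal_iff hF hΩ i (b⁻¹ * c)
    have h2 : (∃ j : {j // j ≠ i}, b * (κ i (Ψ (u, w)) - κ j (Ψ (u, w)))⁻¹ = c) ↔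
        ∃ j : {j // j ≠ i}, (κ i (Ψ (u, w)) - κ j (Ψ (u, w)))⁻¹ = b⁻¹ * c :=
      exists_congr fun j => by rw [eq_inv_mul_iff_mul_eq₀ hβ]
    rw [h2, ← h1, hspan u hu w hw]
    have key : ∀ X W, c • fderiv ℝ (fun v => U (Ψ (v, w₀))) u X +
        fderiv ℝ (fun v => y (Ψ (v, w))) u X + fderiv ℝ (fun w => y (Ψ (u, w))) w W ∈
          Submodule.span ℝ {y (Ψ (u, w)), z (Ψ (u, w))} ↔
        (b⁻¹ * c) • (fderiv ℝ z (Ψ (u, w)) (fderiv ℝ Ψ (u, w) (X, W)) - κ i (Ψ (u, w)) •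
          fderiv ℝ y (Ψ (u, w)) (fderiv ℝ Ψ (u, w) (X, W))) +
          fderiv ℝ y (Ψ (u, w)) (fderiv ℝ Ψ (u, w) (X, W)) ∈
          Submodule.span ℝ {y (Ψ (u, w)), z (Ψ (u, w))} := by
      intro X W
      obtain ⟨c', hc'⟩ := h.fderiv_unit hΩ hβ (fderiv ℝ Ψ (u, w) (X, W))
      rw [hk u hu w hw X W, hYu w hw, hY w hw, add_assoc, ← map_add, ← map_add, hU, hc',
        h.fderiv_sphereVec hΩ]
      have h3 : ((X, (0 : B)) : A × B) + (0, W) = (X, W) := by simp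
      rw [h3]
      set ξ := fderiv ℝ Ψ (u, w) (X, W)
      set S := Submodule.span ℝ {y (Ψ (u, w)), z (Ψ (u, w))}
      have hy : y (Ψ (u, w)) ∈ S := Submodule.subset_span (by simp)
      have h4 : c • (b⁻¹ • (fderiv ℝ z (Ψ (u, w)) ξ - κ i (Ψ (u, w)) • fderiv ℝ y (Ψ (u, w)) ξ -
          fderiv ℝ (κ i) (Ψ (u, w)) ξ • y (Ψ (u, w))) + c' • sphereVec y z (κ i) (Ψ (u, w))) +
          fderiv ℝ y (Ψ (u, w)) ξ = ((b⁻¹ * c) • (fderiv ℝ z (Ψ (u, w)) ξ - κ i (Ψ (u, w)) •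
          fderiv ℝ y (Ψ (u, w)) ξ) + fderiv ℝ y (Ψ (u, w)) ξ) +
          ((-(c * b⁻¹ * fderiv ℝ (κ i) (Ψ (u, w)) ξ)) • y (Ψ (u, w)) +
            (c * c') • sphereVec y z (κ i) (Ψ (u, w))) := by
        module
      rw [h4]
      exact Submodule.add_mem_iff_left _ (Submodule.add_mem _ (Submodule.smul_mem _ _ hy)
        (Submodule.smul_mem _ _ (sphereVec_mem i _)))
    constructor
    · rintro ⟨X, W, hXW, hmem⟩
      refine ⟨fderiv ℝ Ψ (u, w) (X, W), fun h0 => ?_, (key X W).1 hmem⟩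
      have h5 := (hΨ u hu w hw).2.2.1.1 (h0.trans (map_zero _).symm)
      rcases hXW with hX | hW
      · exact hX (congrArg Prod.fst h5)
      · exact hW (congrArg Prod.snd h5)
    · rintro ⟨ξ, hξ, hmem⟩
      obtain ⟨⟨X, W⟩, rfl⟩ := (hΨ u hu w hw).2.2.1.2 ξ
      refine ⟨X, W, ?_, (key X W).2 hmem⟩
      by_contra hno
      push Not at hno
      apply hξ
      rw [hno.1, hno.2]
      exact map_zero _

end IsCurvatureFrame

end LieSphere

namespace LieSphere

open Filter Topology

/-- A nonempty open subset `Z` is all of a connected open set if, whenever it contains points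
arbitrarily near to `b` on certain curves through `b`, it contains `b`, where the velocities of these
curves span the space. For otherwise there is a ball in `Z` with a point `b ∉ Z` in its boundary,
and a curve of this kind that is transversal to the sphere enters the ball. -/
theorem subset_of_transversal_curves {F : Type*} [NormedAddCommGroup F] [InnerProductSpace ℝ F]
    [FiniteDimensional ℝ F] {Ω Z : Set F} (hΩ : IsOpen Ω) (hc : IsPreconnected Ω) (hZ : IsOpen Z)
    (hne : (Ω ∩ Z).Nonempty)
    (hcurve : ∀ b ∈ Ω, ∀ v ≠ 0, ∃ X : F, inner ℝ X v ≠ 0 ∧ ∃ c : ℝ → F, c 0 = b ∧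
      HasDerivAt c X 0 ∧ ∀ᶠ t in 𝓝 0, c t ∈ Z → b ∈ Z) : Ω ⊆ Z := by
  refine hc.subset_of_closure_inter_subset hZ hne ?_
  rintro b₀ ⟨hb₀, hb₀Ω⟩
  by_contra hnot
  obtain ⟨δ, hδ, hball⟩ := Metric.isOpen_iff.1 hΩ b₀ hb₀Ω
  obtain ⟨a, haZ, ha⟩ := Metric.mem_closure_iff.1 hb₀ (δ / 2) (half_pos hδ)
  obtain ⟨b, hb, hdist⟩ := hZ.isClosed_compl.exists_infDist_eq_dist ⟨b₀, hnot⟩ a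
  have hin : Metric.ball a (dist a b) ⊆ Z := by
    intro p hp
    by_contra hpZ
    have h1 := Metric.infDist_le_dist_of_mem (x := a) (s := Zᶜ) hpZ
    rw [hdist, dist_comm a p] at h1
    exact absurd (Metric.mem_ball.1 hp) (not_lt.2 h1)
  have hbΩ : b ∈ Ω := by
    apply hball
    have h1 := Metric.infDist_le_dist_of_mem (x := a) (s := Zᶜ) hnot
    rw [hdist] at h1
    rw [dist_comm] at ha
    rw [Metric.mem_ball]
    calc dist b b₀ ≤ dist b a + dist a b₀ := dist_triangle _ _ _
      _ < δ := by rw [dist_comm b a]; linarith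
  have hne : b - a ≠ 0 := by
    intro h0
    rw [sub_eq_zero] at h0
    exact hb (h0 ▸ haZ)
  obtain ⟨X, hX, c, hc0, hcX, hev⟩ := hcurve b hbΩ (b - a) hne
  have hder : HasDerivAt (fun t => ‖c t - a‖ ^ 2) (2 * inner ℝ (c 0 - a) X) 0 :=
    (hcX.sub_const a).norm_sq
  have hmin : ¬ IsLocalMin (fun t => ‖c t - a‖ ^ 2) 0 := by
    intro hmin
    have h1 := hmin.hasDerivAt_eq_zero hder
    rw [hc0, real_inner_comm] at h1
    exact hX (by linarith)
  rw [IsLocalMin, IsMinFilter, not_eventually] at hmin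
  obtain ⟨t, ht, htZ⟩ := (hmin.and_eventually hev).exists
  apply hb
  apply htZ
  apply hin
  rw [not_le, hc0] at ht
  rw [Metric.mem_ball, dist_eq_norm, dist_comm, dist_eq_norm]
  exact lt_of_pow_lt_pow_left₀ 2 (norm_nonneg _) ht

namespace IsCurvatureFrame

section Saturation

variable {m : ℕ} {F : Type*} [NormedAddCommGroup F] [NormedSpace ℝ F] {g : ℕ} {Ω : Set F}
  {y z : F → LieSpace m} {κ : Fin g → F → ℝ} {d : Fin g → ℕ} {b : F}

theorem sphereVec_ne_zero (h : IsCurvatureFrame Ω y z κ d) (hb : b ∈ Ω) (i : Fin g) :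
    sphereVec y z (κ i) b ≠ 0 := by
  intro h0
  have h1 : (-κ i b) • y b + (1 : ℝ) • z b = 0 := by
    rw [← h0, sphereVec]; module
  exact one_ne_zero ((h.pair b hb).coeff_eq_zero h1).2

/-- If a linear functional vanishes on the curvature sphere `j` near points of a leaf of the
curvature sphere `i` arbitrarily near to `b`, then it does so near `b`. -/
theorem exists_curve_eventually_eq_zero [FiniteDimensional ℝ F] (hF : Module.finrank ℝ F = m)
    (h : IsCurvatureFrame Ω y z κ d) (hD : IsInfinitesimallyDupin Ω y z κ) (hb : b ∈ Ω) (i j : Fin g)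
    (e : LieSpace m →ₗ[ℝ] ℝ) {X : F}
    (hX : X ∈ Module.End.eigenspace (shapeOp y z b).toLinearMap (κ i b)) :
    ∃ c : ℝ → F, c 0 = b ∧ HasDerivAt c X 0 ∧ ∀ᶠ t in 𝓝 0,
      (∀ᶠ p in 𝓝 (c t), e (sphereVec y z (κ j) p) = 0) →
        ∀ᶠ p in 𝓝 b, e (sphereVec y z (κ j) p) = 0 := by
  obtain ⟨β, hβ⟩ := SeparatingDual.exists_ne_zero (R := ℝ) (h.sphereVec_ne_zero hb i)
  set N := {q | q ∈ Ω ∧ β (sphereVec y z (κ i) q) ≠ 0} with hN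
  have hker : ∀ p ∈ N, LinearMap.ker (fderiv ℝ (unitSphereVec β y z (κ i)) p).toLinearMap =
      Module.End.eigenspace (shapeOp y z p).toLinearMap (κ i p) := fun p hp => by
    ext ξ
    exact h.fderiv_unit_eq_zero_iff hF hD hp.1 hp.2 ξ
  obtain ⟨Ψ, u₀, w₀, ε, hε, hΨb, hΨn, hΨ⟩ := exists_constant_rank_chart (h.isOpen_unit β i)
    (fun p hp => (h.contDiffAt_unit hp.1 hp.2).contDiffWithinAt) (⟨hb, hβ⟩ : b ∈ N)
    (fun p hp => by rw [hker p hp, hker b ⟨hb, hβ⟩, h.finrank_eq p hp.1, h.finrank_eq b hb])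
  have hdim : Module.finrank ℝ
      (LinearMap.range (fderiv ℝ (unitSphereVec β y z (κ i)) b).toLinearMap) +
      Module.finrank ℝ (LinearMap.ker (fderiv ℝ (unitSphereVec β y z (κ i)) b).toLinearMap) = m := by
    rw [LinearMap.finrank_range_add_finrank_ker, hF]
  have hnt : Nontrivial (LinearMap.ker (fderiv ℝ (unitSphereVec β y z (κ i)) b).toLinearMap) := by
    rw [Submodule.nontrivial_iff_ne_bot, hker b ⟨hb, hβ⟩]
    exact (h.hasEigenvalue_iff b hb (κ i b)).2 ⟨i, rfl⟩
  have hu₀ := Metric.mem_ball_self (x := u₀) hε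
  have hw₀ := Metric.mem_ball_self (x := w₀) hε
  -- vanishing spreads along each leaf
  have hleaf : ∀ u ∈ Metric.ball u₀ ε, ∀ w₁ ∈ Metric.ball w₀ ε,
      (∀ᶠ w in 𝓝 w₁, e (sphereVec y z (κ j) (Ψ (u, w))) = 0) →
      ∀ w ∈ Metric.ball w₀ ε, e (sphereVec y z (κ j) (Ψ (u, w))) = 0 := by
    intro u hu w₁ hw₁ he
    have hscale : ∀ w ∈ Metric.ball w₀ ε, sphereVec y z (κ i) (Ψ (u, w)) =
        β (sphereVec y z (κ i) (Ψ (u, w))) • unitSphereVec β y z (κ i) (Ψ (u, w₀)) := by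
      intro w hw
      rw [← (hΨ u hu w hw).2.2.2.1, unitSphereVec, smul_smul,
        mul_inv_cancel₀ (hΨ u hu w hw).2.1.2, one_smul]
    by_cases hij : j = i
    · subst hij
      have h1 := he.self_of_nhds
      rw [hscale w₁ hw₁, map_smul, smul_eq_mul] at h1
      intro w hw
      rw [hscale w hw, map_smul, smul_eq_mul,
        (mul_eq_zero.1 h1).resolve_left (hΨ u hu w₁ hw₁).2.1.2, mul_zero]
    · have h1 : ∀ w ∈ Metric.ball w₀ ε, y (Ψ (u, w)) + (β (sphereVec y z (κ i) (Ψ (u, w))) *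
          (κ i (Ψ (u, w)) - κ j (Ψ (u, w)))⁻¹) • unitSphereVec β y z (κ i) (Ψ (u, w₀)) =
          (κ i (Ψ (u, w)) - κ j (Ψ (u, w)))⁻¹ • sphereVec y z (κ j) (Ψ (u, w)) := by
        intro w hw
        have hne : κ i (Ψ (u, w)) - κ j (Ψ (u, w)) ≠ 0 := sub_ne_zero.2 fun h0 =>
          hij (h.injective _ (hΨ u hu w hw).2.1.1 h0).symm
        rw [mul_comm, mul_smul, ← hscale w hw]
        have h2 : y (Ψ (u, w)) = (κ i (Ψ (u, w)) - κ j (Ψ (u, w)))⁻¹ •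
            ((κ i (Ψ (u, w)) - κ j (Ψ (u, w))) • y (Ψ (u, w))) := by
          rw [smul_smul, inv_mul_cancel₀ hne, one_smul]
        nth_rw 1 [h2]
        rw [← smul_add, sphereVec, sphereVec]
        congr 1
        module
      have h2 := (h.isLeaf_of_chart hF hD hε hΨ hu).eqOn_zero hdim
        (convex_ball w₀ ε).isPreconnected e ⟨j, hij⟩ hw₁ (by
          filter_upwards [he, Metric.isOpen_ball.mem_nhds hw₁] with w hw hw'
          rw [h1 w hw', map_smul, hw, smul_zero])
      intro w hw
      have h3 := h2 w hw
      rw [h1 w hw, map_smul, smul_eq_mul] at h3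
      have hne : κ i (Ψ (u, w)) - κ j (Ψ (u, w)) ≠ 0 := sub_ne_zero.2 fun h0 =>
          hij (h.injective _ (hΨ u hu w hw).2.1.1 h0).symm
      exact (mul_eq_zero.1 h3).resolve_left (inv_ne_zero hne)
  -- the curve is the image of a straight line in the leaf
  obtain ⟨⟨A₀, W⟩, hW⟩ := (hΨ u₀ hu₀ w₀ hw₀).2.2.1.2 X
  have hA₀ : A₀ = 0 := by
    rw [← (hΨ u₀ hu₀ w₀ hw₀).2.2.2.2 A₀ W, hW, hΨb]
    exact (h.fderiv_unit_eq_zero_iff hF hD hb hβ X).2 hX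
  have hline : HasDerivAt (fun t : ℝ => (u₀, w₀ + t • W)) (A₀, W) 0 := by
    rw [hA₀]
    have h1 : HasDerivAt (fun t : ℝ => w₀ + t • W) W 0 := by
      simpa using ((hasDerivAt_id (0 : ℝ)).smul_const W).const_add w₀
    exact (hasDerivAt_const (0 : ℝ) u₀).prodMk h1
  refine ⟨fun t => Ψ (u₀, w₀ + t • W), by simpa using hΨb, ?_, ?_⟩
  · have h1 : HasFDerivAt Ψ (fderiv ℝ Ψ (u₀, w₀)) (u₀, w₀ + (0 : ℝ) • W) := by
      rw [zero_smul, add_zero]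
      exact ((hΨ u₀ hu₀ w₀ hw₀).1.differentiableAt (by simp)).hasFDerivAt
    have h2 := h1.comp_hasDerivAt (0 : ℝ) hline
    rw [hW] at h2
    exact h2
  · have hcont : Tendsto (fun t : ℝ => w₀ + t • W) (𝓝 0) (𝓝 w₀) := by
      have h1 : Continuous fun t : ℝ => w₀ + t • W := by fun_prop
      simpa using h1.tendsto 0
    filter_upwards [hcont (Metric.isOpen_ball.mem_nhds hw₀)] with t ht he
    have h1 : ∀ᶠ p in 𝓝 (u₀, w₀ + t • W), e (sphereVec y z (κ j) (Ψ p)) = 0 :=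
      (hΨ u₀ hu₀ _ ht).1.continuousAt.eventually he
    rw [nhds_prod_eq] at h1
    have h2 : ∀ᶠ p in 𝓝 (u₀, w₀), e (sphereVec y z (κ j) (Ψ p)) = 0 := by
      rw [nhds_prod_eq]
      filter_upwards [prod_mem_prod (h1.curry.and (Metric.isOpen_ball.mem_nhds hu₀))
        (Metric.isOpen_ball.mem_nhds hw₀)]
      rintro ⟨u, w⟩ ⟨⟨hu1, hu2⟩, hw⟩
      exact hleaf u hu2 _ ht hu1 w hw
    filter_upwards [hΨn _ h2]
    rintro _ ⟨p, hp, rfl⟩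
    exact hp

end Saturation

/-- A linear functional which vanishes on a curvature sphere of a Dupin submanifold on some nonempty
open set does so on each connected domain of a curvature frame. -/
theorem eqOn_zero_of_eventually {m : ℕ} {F : Type*} [NormedAddCommGroup F] [InnerProductSpace ℝ F]
    [FiniteDimensional ℝ F] {g : ℕ} {Ω : Set F} {y z : F → LieSpace m} {κ : Fin g → F → ℝ}
    {d : Fin g → ℕ} {a : F} (hF : Module.finrank ℝ F = m) (h : IsCurvatureFrame Ω y z κ d)
    (hD : IsInfinitesimallyDupin Ω y z κ) (hc : IsPreconnected Ω) (e : LieSpace m →ₗ[ℝ] ℝ)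
    (j : Fin g) (ha : a ∈ Ω) (he : ∀ᶠ p in 𝓝 a, e (sphereVec y z (κ j) p) = 0) :
    ∀ p ∈ Ω, e (sphereVec y z (κ j) p) = 0 := by
  have h1 : Ω ⊆ {q | ∀ᶠ p in 𝓝 q, e (sphereVec y z (κ j) p) = 0} := by
    refine subset_of_transversal_curves h.isOpen hc isOpen_setOfPred_eventually_nhds ⟨a, ha, he⟩ ?_
    intro b hb v hv
    by_contra hno
    apply hv
    have h2 : ∀ X : F, inner ℝ X v = 0 := by
      intro X
      have hXtop : X ∈ ⨆ μ, Module.End.eigenspace (shapeOp y z b).toLinearMap μ := by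
        rw [h.iSup_eigenspace hb]; trivial
      refine Submodule.iSup_induction _ (motive := fun X => inner ℝ X v = 0) hXtop ?_
        (inner_zero_left v) (fun X Y hX hY => by rw [inner_add_left, hX, hY, add_zero])
      intro μ X hX
      by_contra hXv
      have hX0 : X ≠ 0 := by
        rintro rfl
        exact hXv (inner_zero_left v)
      obtain ⟨i, rfl⟩ := (h.hasEigenvalue_iff b hb μ).1
        (Module.End.hasEigenvalue_of_hasEigenvector ⟨hX, hX0⟩)
      obtain ⟨c, hc0, hcX, hev⟩ := h.exists_curve_eventually_eq_zero hF hD hb i j e hX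
      exact hno ⟨X, hXv, c, hc0, hcX, hev⟩
    exact inner_self_eq_zero.1 (h2 v)
  exact fun p hp => (h1 hp).self_of_nhds

end IsCurvatureFrame

end LieSphere

/-! ### Legendre submanifolds in charts -/

namespace LieSphere

open Filter Topology

/-- The derivative of a section of the lines `span {y, z}` at a zero of it lies in the line. Hence
the principal spaces can be computed in any frame. -/
theorem fderiv_mem_span_of_section {m : ℕ} {F : Type*} [NormedAddCommGroup F] [NormedSpace ℝ F]
    {y z w : F → LieSpace m} {q : F} (hy : DifferentiableAt ℝ y q) (hz : DifferentiableAt ℝ z q)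
    (hw : DifferentiableAt ℝ w q) (hp : IsNullPair (y q) (z q))
    (hmem : ∀ᶠ p in 𝓝 q, w p ∈ Submodule.span ℝ {y p, z p}) (h0 : w q = 0) (X : F) :
    fderiv ℝ w q X ∈ Submodule.span ℝ {y q, z q} := by
  have hcoord : ∀ {f : F → LieSpace m}, DifferentiableAt ℝ f q → ∀ i,
      DifferentiableAt ℝ (fun p => f p i) q := fun hf i =>
    (EuclideanSpace.proj (𝕜 := ℝ) i).differentiableAt.comp q hf
  -- the components of `w`, up to the common denominator `D`, by Cramer's rule in two coordinates
  set D : F → ℝ := fun p => y p 0 * z p (Fin.last (m + 3)) - y p (Fin.last (m + 3)) * z p 0 with hD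
  set A : F → ℝ := fun p => w p 0 * z p (Fin.last (m + 3)) - w p (Fin.last (m + 3)) * z p 0 with hA
  set B : F → ℝ := fun p => y p 0 * w p (Fin.last (m + 3)) - y p (Fin.last (m + 3)) * w p 0 with hB
  have hDd : DifferentiableAt ℝ D q :=
    ((hcoord hy _).mul (hcoord hz _)).sub ((hcoord hy _).mul (hcoord hz _))
  have hAd : DifferentiableAt ℝ A q :=
    ((hcoord hw _).mul (hcoord hz _)).sub ((hcoord hw _).mul (hcoord hz _))
  have hBd : DifferentiableAt ℝ B q :=
    ((hcoord hy _).mul (hcoord hw _)).sub ((hcoord hy _).mul (hcoord hw _))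
  have heq : (fun p => D p • w p) =ᶠ[𝓝 q] fun p => A p • y p + B p • z p := by
    filter_upwards [hmem] with p hpm
    obtain ⟨a, b, hab⟩ := Submodule.mem_span_pair.1 hpm
    have h1 : A p = D p * a := by simp [hA, hD, ← hab]; ring
    have h2 : B p = D p * b := by simp [hB, hD, ← hab]; ring
    rw [h1, h2, ← hab, smul_add, smul_smul, smul_smul]
  have h1 := DFunLike.congr_fun (heq.fderiv_eq (𝕜 := ℝ)) X
  rw [fderiv_fun_smul (𝕜 := ℝ) hDd hw, fderiv_fun_add (hAd.fun_smul hy) (hBd.fun_smul hz), fderiv_fun_smul hAd hy,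
    fderiv_fun_smul hBd hz] at h1
  have hA0 : A q = 0 := by simp [hA, h0]
  have hB0 : B q = 0 := by simp [hB, h0]
  simp only [hA0, hB0, h0, add_apply, smul_apply, ContinuousLinearMap.smulRight_apply, smul_zero,
    add_zero, zero_smul, zero_add] at h1
  have hDq : D q ≠ 0 := hp.det_ne_zero
  rw [← Submodule.smul_mem_iff (Submodule.span ℝ {y q, z q}) hDq, h1]
  exact Submodule.mem_span_pair.2 ⟨_, _, rfl⟩

section Chart

variable {m : ℕ} {M : Type*} [TopologicalSpace M] [ChartedSpace (EuclideanSpace ℝ (Fin m)) M]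
  {L : M → LieLines m} {U : Set M} {Y₀ Y₁ : M → LieSpace m} {p q : M}

namespace IsFrameOn

theorem contMDiffAt₀ (h : IsFrameOn L U Y₀ Y₁) (hq : q ∈ U) :
    ContMDiffAt (𝓡 m) 𝓘(ℝ, LieSpace m) ∞ Y₀ q := h.smooth₀.contMDiffAt (h.isOpen.mem_nhds hq)

theorem contMDiffAt₁ (h : IsFrameOn L U Y₀ Y₁) (hq : q ∈ U) :
    ContMDiffAt (𝓡 m) 𝓘(ℝ, LieSpace m) ∞ Y₁ q := h.smooth₁.contMDiffAt (h.isOpen.mem_nhds hq)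

theorem mem₀ (h : IsFrameOn L U Y₀ Y₁) (hq : q ∈ U) : Y₀ q ∈ (L q).1 := by
  rw [h.span_eq q hq]; exact Submodule.subset_span (by simp)

theorem mem₁ (h : IsFrameOn L U Y₀ Y₁) (hq : q ∈ U) : Y₁ q ∈ (L q).1 := by
  rw [h.span_eq q hq]; exact Submodule.subset_span (by simp)

theorem isNullPair (h : IsFrameOn L U Y₀ Y₁) (hq : q ∈ U) : IsNullPair (Y₀ q) (Y₁ q) := by
  have hnull : ∀ x ∈ (L q).1, lieForm x x = 0 := fun x hx => (L q).2.2 x hx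
  have h0 := hnull _ (h.mem₀ hq)
  have h1 := hnull _ (h.mem₁ hq)
  refine ⟨?_, h0, ?_, h1⟩
  · rw [linearIndependent_iff_card_eq_finrank_span, Set.finrank]
    have h2 : Set.range ![Y₀ q, Y₁ q] = {Y₀ q, Y₁ q} := by simp [Set.pair_comm]
    rw [h2, ← h.span_eq q hq, (L q).2.1]
    simp
  · have h2 := hnull _ ((L q).1.add_mem (h.mem₀ hq) (h.mem₁ hq))
    simp only [map_add, add_apply, h0, h1, lieForm_comm (Y₁ q) (Y₀ q)] at h2
    linarith

end IsFrameOn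

variable [IsManifold (𝓡 m) ∞ M]

theorem dvec_comp_chart (hq : q ∈ (extChartAt (𝓡 m) p).source)
    {f : EuclideanSpace ℝ (Fin m) → LieSpace m} (hf : DifferentiableAt ℝ f (extChartAt (𝓡 m) p q))
    (X : TangentSpace (𝓡 m) q) : dvec (f ∘ extChartAt (𝓡 m) p) q X =
      fderiv ℝ f (extChartAt (𝓡 m) p q) (mfderiv (𝓡 m) 𝓘(ℝ, EuclideanSpace ℝ (Fin m))
        (extChartAt (𝓡 m) p) q X) := by
  have : IsManifold (𝓡 m) 1 M := IsManifold.of_le (n := ∞) (by simp)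
  rw [extChartAt_source] at hq
  rw [dvec, mfderiv_comp q hf.mdifferentiableAt (mdifferentiableAt_extChartAt hq),
    mfderiv_eq_fderiv]
  rfl

theorem bijective_mfderiv_chart (hq : q ∈ (extChartAt (𝓡 m) p).source) :
    Function.Bijective (mfderiv (𝓡 m) 𝓘(ℝ, EuclideanSpace ℝ (Fin m)) (extChartAt (𝓡 m) p) q) := by
  have : IsManifold (𝓡 m) 1 M := IsManifold.of_le (n := ∞) (by simp)
  exact (isInvertible_mfderiv_extChartAt hq).bijective

theorem contDiffAt_comp_chart_symm (hq : q ∈ (extChartAt (𝓡 m) p).source) {Y : M → LieSpace m}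
    (hY : ContMDiffAt (𝓡 m) 𝓘(ℝ, LieSpace m) ∞ Y q) :
    ContDiffAt ℝ ∞ (Y ∘ (extChartAt (𝓡 m) p).symm) (extChartAt (𝓡 m) p q) := by
  have h1 := (extChartAt (𝓡 m) p).map_source hq
  have h2 : ContMDiffAt 𝓘(ℝ, EuclideanSpace ℝ (Fin m)) (𝓡 m) ∞ (extChartAt (𝓡 m) p).symm
      (extChartAt (𝓡 m) p q) :=
    (contMDiffOn_extChartAt_symm p).contMDiffAt ((isOpen_extChartAt_target p).mem_nhds h1)
  rw [← contMDiffAt_iff_contDiffAt]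
  refine ContMDiffAt.comp _ ?_ h2
  rwa [(extChartAt (𝓡 m) p).left_inv hq]

theorem dvec_eq_fderiv (hq : q ∈ (extChartAt (𝓡 m) p).source) {Y : M → LieSpace m}
    (hY : ContMDiffAt (𝓡 m) 𝓘(ℝ, LieSpace m) ∞ Y q) (X : TangentSpace (𝓡 m) q) :
    dvec Y q X = fderiv ℝ (Y ∘ (extChartAt (𝓡 m) p).symm) (extChartAt (𝓡 m) p q)
      (mfderiv (𝓡 m) 𝓘(ℝ, EuclideanSpace ℝ (Fin m)) (extChartAt (𝓡 m) p) q X) := by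
  rw [← dvec_comp_chart hq ((contDiffAt_comp_chart_symm hq hY).differentiableAt (by simp))]
  have h1 : Y =ᶠ[𝓝 q] (Y ∘ (extChartAt (𝓡 m) p).symm) ∘ extChartAt (𝓡 m) p := by
    filter_upwards [(isOpen_extChartAt_source (I := 𝓡 m) p).mem_nhds hq] with v hv
    change Y v = Y ((extChartAt (𝓡 m) p).symm (extChartAt (𝓡 m) p v))
    rw [(extChartAt (𝓡 m) p).left_inv hv]
  rw [dvec, h1.mfderiv_eq]
  rfl

/-- The principal space can be computed in a single frame. -/
theorem IsFrameOn.mem_principalSpace_iff (h : IsFrameOn L U Y₀ Y₁) (hq : q ∈ U) {x : ℙ ℝ (LieSpace m)}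
    {r s : ℝ} (hx : r • Y₀ q + s • Y₁ q ∈ x.submodule) (hne : r • Y₀ q + s • Y₁ q ≠ 0)
    (X : TangentSpace (𝓡 m) q) :
    X ∈ principalSpace L q x ↔ r • dvec Y₀ q X + s • dvec Y₁ q X ∈ (L q).1 := by
  constructor
  · intro hX
    exact hX U Y₀ Y₁ hq h r s hx
  · intro hX U' Z₀ Z₁ hq' h' r' s' hx'
    obtain ⟨c, hc⟩ : ∃ c : ℝ, c • (r • Y₀ q + s • Y₁ q) = r' • Z₀ q + s' • Z₁ q := by
      obtain ⟨c, hc⟩ := (finrank_eq_one_iff_of_nonzero'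
        (⟨_, hx⟩ : x.submodule) (fun h0 => hne (congrArg Subtype.val h0))).1 x.finrank_submodule
        ⟨_, hx'⟩
      exact ⟨c, congrArg Subtype.val hc⟩
    set φ := extChartAt (𝓡 m) q
    have hqs : q ∈ φ.source := mem_extChartAt_source q
    have hd : ∀ {Y : M → LieSpace m}, ContMDiffAt (𝓡 m) 𝓘(ℝ, LieSpace m) ∞ Y q →
        DifferentiableAt ℝ (Y ∘ φ.symm) (φ q) := fun hY =>
      (contDiffAt_comp_chart_symm hqs hY).differentiableAt (by simp)
    have hY₀ := hd (h.contMDiffAt₀ hq)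
    have hY₁ := hd (h.contMDiffAt₁ hq)
    have hZ₀ := hd (h'.contMDiffAt₀ hq')
    have hZ₁ := hd (h'.contMDiffAt₁ hq')
    have hinv : φ.symm (φ q) = q := φ.left_inv hqs
    have hcont : Tendsto φ.symm (𝓝 (φ q)) (𝓝 q) := by
      have h1 := continuousAt_extChartAt_symm (I := 𝓡 m) q
      rwa [ContinuousAt, extChartAt_to_inv] at h1
    have key := fderiv_mem_span_of_section (w := fun v => (r' • Z₀ (φ.symm v) + s' • Z₁ (φ.symm v)) -
      c • (r • Y₀ (φ.symm v) + s • Y₁ (φ.symm v))) hY₀ hY₁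
      (((hZ₀.const_smul r').add (hZ₁.const_smul s')).sub
        (((hY₀.const_smul r).add (hY₁.const_smul s)).const_smul c))
      (by simpa only [Function.comp, hinv] using h.isNullPair hq)
      (by
        filter_upwards [hcont (h.isOpen.mem_nhds hq), hcont (h'.isOpen.mem_nhds hq')] with v hv hv'
        change φ.symm v ∈ U at hv
        change φ.symm v ∈ U' at hv'
        simp only [Function.comp]
        rw [← h.span_eq _ hv]
        exact Submodule.sub_mem _ (Submodule.add_mem _ (Submodule.smul_mem _ _ (h'.mem₀ hv'))
          (Submodule.smul_mem _ _ (h'.mem₁ hv'))) (Submodule.smul_mem _ _ (Submodule.add_mem _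
          (Submodule.smul_mem _ _ (h.mem₀ hv)) (Submodule.smul_mem _ _ (h.mem₁ hv)))))
      (by simp only [hinv]; rw [hc, sub_self])
    have hfd : ∀ ξ, fderiv ℝ (fun v => (r' • Z₀ (φ.symm v) + s' • Z₁ (φ.symm v)) -
        c • (r • Y₀ (φ.symm v) + s • Y₁ (φ.symm v))) (φ q) ξ =
        (r' • fderiv ℝ (Z₀ ∘ φ.symm) (φ q) ξ + s' • fderiv ℝ (Z₁ ∘ φ.symm) (φ q) ξ) -
        c • (r • fderiv ℝ (Y₀ ∘ φ.symm) (φ q) ξ + s • fderiv ℝ (Y₁ ∘ φ.symm) (φ q) ξ) := by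
      intro ξ
      exact DFunLike.congr_fun (((hZ₀.hasFDerivAt.const_smul r').add
        (hZ₁.hasFDerivAt.const_smul s')).sub (((hY₀.hasFDerivAt.const_smul r).add
          (hY₁.hasFDerivAt.const_smul s)).const_smul c)).fderiv ξ
    have hline : Submodule.span ℝ {(Y₀ ∘ φ.symm) (φ q), (Y₁ ∘ φ.symm) (φ q)} = (L q).1 := by
      rw [h.span_eq q hq, Function.comp, Function.comp, hinv]
    rw [hline] at key
    simp only [hfd] at key
    have h3 : (r' • dvec Z₀ q X + s' • dvec Z₁ q X) - c • (r • dvec Y₀ q X + s • dvec Y₁ q X) ∈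
        (L q).1 := by
      rw [dvec_eq_fderiv hqs (h.contMDiffAt₀ hq), dvec_eq_fderiv hqs (h.contMDiffAt₁ hq),
        dvec_eq_fderiv hqs (h'.contMDiffAt₀ hq'), dvec_eq_fderiv hqs (h'.contMDiffAt₁ hq')]
      exact key _
    have h4 := Submodule.add_mem _ h3 (Submodule.smul_mem _ c hX)
    rwa [sub_add_cancel] at h4

end Chart

end LieSphere

namespace LieSphere

open Filter Topology

/-- If `y` is an immersion modulo the line at one point, then it is one nearby. -/
theorem exists_isLegendreFrame {m : ℕ} {F : Type*} [NormedAddCommGroup F] [NormedSpace ℝ F]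
    [FiniteDimensional ℝ F] {Ω : Set F} {y z : F → LieSpace m} {b : F} (hΩ : IsOpen Ω)
    (hy : ContDiffOn ℝ ∞ y Ω) (hz : ContDiffOn ℝ ∞ z Ω) (hp : ∀ q ∈ Ω, IsNullPair (y q) (z q))
    (hc : ∀ q ∈ Ω, ∀ X, lieForm (fderiv ℝ y q X) (z q) = 0) (hb : b ∈ Ω)
    (hr : ∀ X, fderiv ℝ y b X ∈ Submodule.span ℝ {y b, z b} → X = 0) :
    ∃ N, b ∈ N ∧ N ⊆ Ω ∧ IsLegendreFrame N y z := by
  have hyd : ∀ q ∈ Ω, ContDiffAt ℝ ∞ y q := fun q hq => hy.contDiffAt (hΩ.mem_nhds hq)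
  have hyy : ∀ q ∈ Ω, ∀ X, lieForm (fderiv ℝ y q X) (y q) = 0 := by
    intro q hq X
    have hd := (hyd q hq).differentiableAt (by simp)
    have h1 := lieForm_fderiv_add hd hd (c := 0)
      (eventually_of_mem (hΩ.mem_nhds hq) fun p hp' => (hp p hp').left) X
    rw [lieForm_comm (y q)] at h1
    linarith
  have hinj : Function.Injective (gram (fderiv ℝ y b) (fderiv ℝ y b)) := by
    rw [injective_iff_map_eq_zero]
    intro X hX
    refine hr X ((hp b hb).mem_of_form_self (hyy b hb X) (hc b hb X) ?_)
    rw [← gram_apply, hX]; rfl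
  obtain ⟨T, hT⟩ := isInvertible_of_injective hinj
  have hcont : ContinuousAt (fun q => gram (fderiv ℝ y q) (fderiv ℝ y q)) b := by
    have h1 : ContDiffAt ℝ ∞ (fderiv ℝ y) b := (hyd b hb).fderiv_right (by simp)
    exact (ContDiffAt.gram h1 h1).continuousAt
  have hev := hcont.eventually (hT ▸ T.nhds)
  obtain ⟨N, hN, hNo, hbN⟩ := mem_nhds_iff.1 (inter_mem hev (hΩ.mem_nhds hb))
  refine ⟨N, hbN, fun q hq => (hN hq).2, hNo, hy.mono fun q hq => (hN hq).2,
    hz.mono fun q hq => (hN hq).2, fun q hq => hp q (hN hq).2, fun q hq => hc q (hN hq).2, ?_⟩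
  intro q hq X hX
  obtain ⟨T', hT'⟩ := (hN hq).1
  have h0 : gram (fderiv ℝ y q) (fderiv ℝ y q) X = 0 := by
    ext Z
    obtain ⟨r, s, hrs⟩ := Submodule.mem_span_pair.1 hX
    rw [gram_apply, ← hrs, lieForm_comm, map_add, map_smul, map_smul, hyy q (hN hq).2,
      hc q (hN hq).2]
    simp
  have h1 : T' X = T' 0 := by
    rw [map_zero]
    exact (DFunLike.congr_fun hT' X).trans h0
  exact T'.injective h1

theorem IsNullPair.sub_smul_ne_zero {m : ℕ} {y z : LieSpace m} (h : IsNullPair y z) (c : ℝ) :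
    z - c • y ≠ 0 := by
  intro h0
  have h1 : (-c) • y + (1 : ℝ) • z = 0 := by
    rw [← h0]; module
  exact one_ne_zero (h.coeff_eq_zero h1).2

theorem IsNullPair.injective_mk {m : ℕ} {y z : LieSpace m} (h : IsNullPair y z) :
    Function.Injective fun c => Projectivization.mk ℝ (z - c • y) (h.sub_smul_ne_zero c) := by
  intro c c' hcc
  obtain ⟨a, ha⟩ := (Projectivization.mk_eq_mk_iff' ℝ _ _ _ _).1 hcc
  have h2 : (c - a * c') • y + (a - 1) • z = 0 := by
    rw [← sub_eq_zero.2 ha]; module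
  obtain ⟨h3, h4⟩ := h.coeff_eq_zero h2
  rw [sub_eq_zero.1 h4] at h3
  linarith

section Chart

variable {m : ℕ} {M : Type*} [TopologicalSpace M] [ChartedSpace (EuclideanSpace ℝ (Fin m)) M]
  {L : M → LieLines m} {N : Set (EuclideanSpace ℝ (Fin m))}
  {y z : EuclideanSpace ℝ (Fin m) → LieSpace m} {p q : M} {x : ℙ ℝ (LieSpace m)}

/-- In the chart of `M` at `p`, the lines of `L` over `N` are spanned by `y` and `z`. -/
def IsChartFrame (L : M → LieLines m) (p : M) (N : Set (EuclideanSpace ℝ (Fin m)))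
    (y z : EuclideanSpace ℝ (Fin m) → LieSpace m) : Prop :=
  ∀ q ∈ N, q ∈ (extChartAt (𝓡 m) p).target ∧
    (L ((extChartAt (𝓡 m) p).symm q)).1 = Submodule.span ℝ {y q, z q}

theorem IsChartFrame.mono {N' : Set (EuclideanSpace ℝ (Fin m))} (h : IsChartFrame L p N y z)
    (hN : N' ⊆ N) : IsChartFrame L p N' y z := fun q hq => h q (hN hq)

theorem submodule_eq_span {v : LieSpace m} (hv : v ≠ 0) (hx : v ∈ x.submodule) :
    x.submodule = Submodule.span ℝ {v} := by
  symm
  apply Submodule.eq_of_le_of_finrank_eq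
  · rwa [Submodule.span_singleton_le_iff_mem]
  · rw [finrank_span_singleton hv, x.finrank_submodule]

variable [IsManifold (𝓡 m) ∞ M]

theorem IsChartFrame.isFrameOn (h : IsChartFrame L p N y z) (hf : IsLegendreFrame N y z) :
    IsFrameOn L ((extChartAt (𝓡 m) p).source ∩ extChartAt (𝓡 m) p ⁻¹' N)
      (y ∘ extChartAt (𝓡 m) p) (z ∘ extChartAt (𝓡 m) p) := by
  have hsm : ∀ {f : EuclideanSpace ℝ (Fin m) → LieSpace m}, ContDiffOn ℝ ∞ f N →
      ContMDiffOn (𝓡 m) 𝓘(ℝ, LieSpace m) ∞ (f ∘ extChartAt (𝓡 m) p)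
        ((extChartAt (𝓡 m) p).source ∩ extChartAt (𝓡 m) p ⁻¹' N) := by
    intro f hfN
    refine (contMDiffOn_iff_contDiffOn.2 hfN).comp
      ((contMDiffOn_extChartAt (n := ∞)).mono fun q hq => ?_) fun q hq => hq.2
    rw [← extChartAt_source (𝓡 m)]
    exact hq.1
  refine ⟨isOpen_extChartAt_preimage' p hf.isOpen, hsm hf.smooth_left, hsm hf.smooth_right, ?_⟩
  rintro q ⟨hq, hqN⟩
  have h1 := (h _ hqN).2
  rwa [(extChartAt (𝓡 m) p).left_inv hq] at h1

theorem IsChartFrame.mem_principalSpace_iff (h : IsChartFrame L p N y z)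
    (hf : IsLegendreFrame N y z) (hq : q ∈ (extChartAt (𝓡 m) p).source)
    (hqN : extChartAt (𝓡 m) p q ∈ N) {r s : ℝ}
    (hx : r • y (extChartAt (𝓡 m) p q) + s • z (extChartAt (𝓡 m) p q) ∈ x.submodule)
    (hne : r • y (extChartAt (𝓡 m) p q) + s • z (extChartAt (𝓡 m) p q) ≠ 0)
    (X : TangentSpace (𝓡 m) q) (ξ : EuclideanSpace ℝ (Fin m))
    (hξ : mfderiv (𝓡 m) 𝓘(ℝ, EuclideanSpace ℝ (Fin m)) (extChartAt (𝓡 m) p) q X = ξ) :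
    X ∈ principalSpace L q x ↔ r • ξ + s • shapeOp y z (extChartAt (𝓡 m) p q) ξ = 0 := by
  rw [(h.isFrameOn hf).mem_principalSpace_iff ⟨hq, hqN⟩ hx hne,
    ← hf.principal_iff finrank_euclideanSpace_fin hqN, ← (h _ hqN).2,
    (extChartAt (𝓡 m) p).left_inv hq, dvec_comp_chart hq (hf.diff_left hqN),
    dvec_comp_chart hq (hf.diff_right hqN), hξ]

theorem IsChartFrame.isCurvatureSphere_iff (h : IsChartFrame L p N y z)
    (hf : IsLegendreFrame N y z) (hq : q ∈ (extChartAt (𝓡 m) p).source)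
    (hqN : extChartAt (𝓡 m) p q ∈ N) : IsCurvatureSphere L q x ↔
      ∃ c, Module.End.HasEigenvalue (shapeOp y z (extChartAt (𝓡 m) p q)).toLinearMap c ∧
        z (extChartAt (𝓡 m) p q) - c • y (extChartAt (𝓡 m) p q) ∈ x.submodule := by
  have hbij := bijective_mfderiv_chart hq
  have hL : (L q).1 = Submodule.span ℝ {y (extChartAt (𝓡 m) p q), z (extChartAt (𝓡 m) p q)} := by
    have h1 := (h _ hqN).2
    rwa [(extChartAt (𝓡 m) p).left_inv hq] at h1
  have hpair := hf.pair _ hqN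
  constructor
  · rintro ⟨hxL, hne⟩
    obtain ⟨X, hX, hX0⟩ := Submodule.exists_mem_ne_zero_of_ne_bot hne
    have hxne : x.submodule ≠ ⊥ := by
      intro h0
      have h1 := x.finrank_submodule
      rw [h0, finrank_bot] at h1
      exact zero_ne_one h1
    obtain ⟨v, hv, hv0⟩ := Submodule.exists_mem_ne_zero_of_ne_bot hxne
    obtain ⟨r, s, rfl⟩ := Submodule.mem_span_pair.1 (hL ▸ hxL hv)
    have h1 := (h.mem_principalSpace_iff hf hq hqN hv hv0 X _ rfl).1 hX
    set ξ : EuclideanSpace ℝ (Fin m) :=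
      mfderiv (𝓡 m) 𝓘(ℝ, EuclideanSpace ℝ (Fin m)) (extChartAt (𝓡 m) p) q X with hξ
    have hξ0 : ξ ≠ 0 := fun h0 => hX0 (hbij.1 (h0.trans (map_zero _).symm))
    have hs : s ≠ 0 := by
      rintro rfl
      rw [zero_smul, add_zero] at h1
      rw [(smul_eq_zero.1 h1).resolve_right hξ0] at hv0
      simp at hv0
    refine ⟨-(s⁻¹ * r), Module.End.hasEigenvalue_of_hasEigenvector (x := ξ)
      ⟨Module.End.mem_eigenspace_iff.2 ?_, hξ0⟩, ?_⟩
    · have h2 : s • (shapeOp y z (extChartAt (𝓡 m) p q) ξ - (-(s⁻¹ * r)) • ξ) = 0 := by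
        rw [← h1, smul_sub, smul_smul, mul_neg, mul_inv_cancel_left₀ hs]; module
      exact sub_eq_zero.1 ((smul_eq_zero.1 h2).resolve_left hs)
    · have h2 := x.submodule.smul_mem s⁻¹ hv
      rw [smul_add, smul_smul, smul_smul, inv_mul_cancel₀ hs] at h2
      convert h2 using 1
      module
  · rintro ⟨c, hc, hx⟩
    have h1 : z (extChartAt (𝓡 m) p q) - c • y (extChartAt (𝓡 m) p q) =
        (-c) • y (extChartAt (𝓡 m) p q) + (1 : ℝ) • z (extChartAt (𝓡 m) p q) := by module
    rw [h1] at hx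
    have hne : (-c) • y (extChartAt (𝓡 m) p q) + (1 : ℝ) • z (extChartAt (𝓡 m) p q) ≠ 0 :=
      fun h0 => one_ne_zero (hpair.coeff_eq_zero h0).2
    refine ⟨?_, ?_⟩
    · rw [submodule_eq_span hne hx, Submodule.span_singleton_le_iff_mem, hL]
      exact Submodule.mem_span_pair.2 ⟨_, _, rfl⟩
    · obtain ⟨ξ, hξ, hξ0⟩ := hc.exists_hasEigenvector
      obtain ⟨X, hX⟩ := hbij.2 ξ
      rw [Submodule.ne_bot_iff]
      refine ⟨X, (h.mem_principalSpace_iff hf hq hqN hx hne X ξ hX).2 ?_, ?_⟩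
      · have h2 : shapeOp y z (extChartAt (𝓡 m) p q) ξ = c • ξ :=
          Module.End.mem_eigenspace_iff.1 hξ
        rw [h2]; module
      · rintro rfl
        exact hξ0 (hX.symm.trans (map_zero _))

theorem IsChartFrame.encard_eigenvalues (h : IsChartFrame L p N y z)
    (hf : IsLegendreFrame N y z) (hq : q ∈ (extChartAt (𝓡 m) p).source)
    (hqN : extChartAt (𝓡 m) p q ∈ N) :
    {c | Module.End.HasEigenvalue (shapeOp y z (extChartAt (𝓡 m) p q)).toLinearMap c}.encard =
      {x | IsCurvatureSphere L q x}.encard := by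
  have hne := (hf.pair _ hqN).sub_smul_ne_zero
  have hmem : ∀ c, z (extChartAt (𝓡 m) p q) - c • y (extChartAt (𝓡 m) p q) ∈
      (Projectivization.mk ℝ _ (hne c)).submodule := fun c => by
    rw [Projectivization.submodule_mk]; exact Submodule.mem_span_singleton_self _
  rw [← (hf.pair _ hqN).injective_mk.encard_image]
  congr 1
  ext x
  rw [Set.mem_ofPred_eq, h.isCurvatureSphere_iff hf hq hqN]
  constructor
  · rintro ⟨c, hc, rfl⟩
    exact ⟨c, hc, hmem c⟩
  · rintro ⟨c, hc, hx⟩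
    exact ⟨c, hc, Projectivization.submodule_injective (by
      rw [submodule_eq_span (hne c) hx, Projectivization.submodule_mk])⟩

/-- Near each point there is a frame whose first vector is an immersion modulo the lines: any point
of the line which is not a curvature sphere can be taken as its value. -/
theorem IsLegendre.exists_chartFrame (hL : IsLegendre L)
    (hfin : {x | IsCurvatureSphere L p x}.Finite) : ∃ N y z, extChartAt (𝓡 m) p p ∈ N ∧
      IsLegendreFrame N y z ∧ IsChartFrame L p N y z := by
  obtain ⟨U, Y₀, Y₁, hpU, hfr, hreg⟩ := hL p
  have hps := mem_extChartAt_source (I := 𝓡 m) p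
  have hne := (hfr.isNullPair hpU).sub_smul_ne_zero
  have hmem : ∀ c, Y₁ p - c • Y₀ p ∈ (Projectivization.mk ℝ _ (hne c)).submodule := fun c => by
    rw [Projectivization.submodule_mk]; exact Submodule.mem_span_singleton_self _
  obtain ⟨_, ⟨c, rfl⟩, hc⟩ := (Set.infinite_range_of_injective
    (hfr.isNullPair hpU).injective_mk).exists_notMem_finite hfin
  have hxL : (Projectivization.mk ℝ _ (hne c)).submodule ≤ (L p).1 := by
    rw [Projectivization.submodule_mk, Submodule.span_singleton_le_iff_mem]
    exact Submodule.sub_mem _ (hfr.mem₁ hpU) (Submodule.smul_mem _ _ (hfr.mem₀ hpU))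
  have hbot : principalSpace L p (Projectivization.mk ℝ _ (hne c)) = ⊥ := by
    by_contra h0
    exact hc ⟨hxL, h0⟩
  set φ := extChartAt (𝓡 m) p with hφ
  set Ω := φ.target ∩ φ.symm ⁻¹' U with hΩ
  have hΩo : IsOpen Ω :=
    (continuousOn_extChartAt_symm p).isOpen_inter_preimage (isOpen_extChartAt_target p) hfr.isOpen
  have hs : ∀ q ∈ Ω, φ.symm q ∈ φ.source := fun q hq => φ.map_target hq.1
  have hinv : ∀ q ∈ Ω, φ (φ.symm q) = q := fun q hq => φ.right_inv hq.1
  have hc₀ : ∀ q ∈ Ω, ContDiffAt ℝ ∞ (Y₀ ∘ φ.symm) q := fun q hq => by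
    have h1 := contDiffAt_comp_chart_symm (hs q hq) (hfr.contMDiffAt₀ hq.2)
    rwa [← hφ, hinv q hq] at h1
  have hc₁ : ∀ q ∈ Ω, ContDiffAt ℝ ∞ (Y₁ ∘ φ.symm) q := fun q hq => by
    have h1 := contDiffAt_comp_chart_symm (hs q hq) (hfr.contMDiffAt₁ hq.2)
    rwa [← hφ, hinv q hq] at h1
  have hd₀ := fun q hq => (hc₀ q hq).differentiableAt (by simp)
  have hd₁ := fun q hq => (hc₁ q hq).differentiableAt (by simp)
  have hpair : ∀ q ∈ Ω, IsNullPair ((Y₀ ∘ φ.symm) q) ((Y₁ ∘ φ.symm) q) :=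
    fun q hq => hfr.isNullPair hq.2
  have hcont : ∀ q ∈ Ω, ∀ X, lieForm (fderiv ℝ (Y₀ ∘ φ.symm) q X) ((Y₁ ∘ φ.symm) q) = 0 := by
    intro q hq ξ
    obtain ⟨X, hX⟩ := (bijective_mfderiv_chart (hs q hq)).2 ξ
    have h1 := (hreg _ hq.2).2 X
    rw [dvec_eq_fderiv (hs q hq) (hfr.contMDiffAt₀ hq.2), hX, ← hφ, hinv q hq] at h1
    exact h1
  have h00 : ∀ q ∈ Ω, ∀ X, lieForm (fderiv ℝ (Y₀ ∘ φ.symm) q X) ((Y₀ ∘ φ.symm) q) = 0 := by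
    intro q hq X
    have h1 := lieForm_fderiv_add (hd₀ q hq) (hd₀ q hq) (c := 0)
      (eventually_of_mem (hΩo.mem_nhds hq) fun v hv => (hpair v hv).left) X
    rw [lieForm_comm ((Y₀ ∘ φ.symm) q)] at h1
    linarith
  have h10 : ∀ q ∈ Ω, ∀ X, lieForm (fderiv ℝ (Y₁ ∘ φ.symm) q X) ((Y₀ ∘ φ.symm) q) = 0 := by
    intro q hq X
    have h1 := lieForm_fderiv_add (hd₁ q hq) (hd₀ q hq) (c := 0)
      (eventually_of_mem (hΩo.mem_nhds hq) fun v hv => (hpair v hv).symm.mixed) X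
    rw [lieForm_comm ((Y₁ ∘ φ.symm) q), hcont q hq, add_zero] at h1
    exact h1
  have hfd : ∀ q ∈ Ω, ∀ X, fderiv ℝ (fun v => (Y₁ ∘ φ.symm) v - c • (Y₀ ∘ φ.symm) v) q X =
      fderiv ℝ (Y₁ ∘ φ.symm) q X - c • fderiv ℝ (Y₀ ∘ φ.symm) q X := by
    intro q hq X
    exact DFunLike.congr_fun
      ((hd₁ q hq).hasFDerivAt.sub ((hd₀ q hq).hasFDerivAt.const_smul c)).fderiv X
  have hspan : ∀ q, Submodule.span ℝ {(Y₁ ∘ φ.symm) q - c • (Y₀ ∘ φ.symm) q, (Y₀ ∘ φ.symm) q} =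
      Submodule.span ℝ {(Y₀ ∘ φ.symm) q, (Y₁ ∘ φ.symm) q} := by
    intro q
    have h1 := span_sphere_eq (y := (Y₀ ∘ φ.symm) q) (z := (Y₁ ∘ φ.symm) q) one_ne_zero c
    rwa [one_smul] at h1
  have hpΩ : φ p ∈ Ω := ⟨φ.map_source hps, by
    rw [Set.mem_preimage, φ.left_inv hps]; exact hpU⟩
  obtain ⟨N, hpN, hNΩ, hN⟩ := exists_isLegendreFrame
    (y := fun v => (Y₁ ∘ φ.symm) v - c • (Y₀ ∘ φ.symm) v) (z := Y₀ ∘ φ.symm) hΩo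
    (fun q hq => ((hc₁ q hq).sub ((hc₀ q hq).const_smul c)).contDiffWithinAt)
    (fun q hq => (hc₀ q hq).contDiffWithinAt)
    (fun q hq => by simpa only [one_smul] using (hpair q hq).sphere one_ne_zero c)
    (fun q hq X => by
      rw [hfd q hq, map_sub, map_smul, sub_apply, smul_apply, h10 q hq, h00 q hq]; simp)
    hpΩ
    (fun ξ hξ => by
      obtain ⟨X, hX⟩ := (bijective_mfderiv_chart hps).2 ξ
      rw [hfd _ hpΩ, hspan] at hξ
      have h1 : X ∈ principalSpace L p (Projectivization.mk ℝ _ (hne c)) := by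
        have h2 : Y₁ p - c • Y₀ p = (-c) • Y₀ p + (1 : ℝ) • Y₁ p := by module
        refine (hfr.mem_principalSpace_iff hpU (r := -c) (s := 1) ?_ ?_ X).2 ?_
        · rw [← h2]; exact hmem c
        · rw [← h2]; exact hne c
        · rw [dvec_eq_fderiv hps (hfr.contMDiffAt₀ hpU), dvec_eq_fderiv hps (hfr.contMDiffAt₁ hpU),
            hX, hfr.span_eq p hpU]
          rw [Function.comp, Function.comp, φ.left_inv hps] at hξ
          convert hξ using 1
          module
      rw [hbot, Submodule.mem_bot] at h1
      rw [← hX, h1]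
      exact map_zero _)
  refine ⟨N, _, _, hpN, hN, fun q hq => ⟨(hNΩ hq).1, ?_⟩⟩
  rw [hspan, hfr.span_eq _ (hNΩ hq).2]
  rfl

end Chart

end LieSphere

/-! ### Curvature spheres and the Dupin condition in charts -/

namespace LieSphere

open Filter Topology

section Chart

variable {m : ℕ} {M : Type*} [TopologicalSpace M] [ChartedSpace (EuclideanSpace ℝ (Fin m)) M]
  [IsManifold (𝓡 m) ∞ M] {L : M → LieLines m} {N : Set (EuclideanSpace ℝ (Fin m))}
  {y z : EuclideanSpace ℝ (Fin m) → LieSpace m} {p : M} {x : ℙ ℝ (LieSpace m)}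

/-- If the number of curvature spheres is constant, then they are locally given by smooth functions. -/
theorem IsLegendre.exists_curvatureFrame (hL : IsLegendre L) {g : ℕ}
    (hg : ∀ q, {x | IsCurvatureSphere L q x}.encard = g) (p : M) :
    ∃ N y z, ∃ (κ : Fin g → EuclideanSpace ℝ (Fin m) → ℝ) (d : Fin g → ℕ),
      extChartAt (𝓡 m) p p ∈ N ∧ IsPreconnected N ∧ IsCurvatureFrame N y z κ d ∧
        IsChartFrame L p N y z := by
  obtain ⟨N₀, y, z, hp, hf, hc⟩ := hL.exists_chartFrame (p := p)
    (Set.finite_of_encard_eq_coe (hg p))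
  obtain ⟨N, κ, hN, hpN, hNN, hκ, hprop⟩ := exists_smooth_eigenvalues hf.isOpen
    hf.contDiffOn_shapeOp (I := fun q => gram (fderiv ℝ y q) (fderiv ℝ y q))
    (fun q hq => by
      have h1 : ContDiffAt ℝ ∞ (fderiv ℝ y) q := (hf.contDiffAt_left hq).fderiv_right (by simp)
      exact (ContDiffAt.gram h1 h1).continuousAt.continuousWithinAt)
    (fun q _ X Z => lieForm_comm _ _) (fun q hq X hX => hf.gram_pos hq hX)
    (fun q hq => hf.shapeOp_symm hq) (g := g)
    (fun q hq => by
      have h1 := hc.encard_eigenvalues hf (q := (extChartAt (𝓡 m) p).symm q)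
        ((extChartAt (𝓡 m) p).map_target (hc q hq).1)
        (by rwa [(extChartAt (𝓡 m) p).right_inv (hc q hq).1])
      rw [(extChartAt (𝓡 m) p).right_inv (hc q hq).1, hg] at h1
      exact h1) hp
  obtain ⟨r, hr, hball⟩ := Metric.isOpen_iff.1 hN _ hpN
  exact ⟨Metric.ball (extChartAt (𝓡 m) p p) r, y, z, κ, _, Metric.mem_ball_self hr,
    (convex_ball _ _).isPreconnected,
    ⟨⟨Metric.isOpen_ball, hf.smooth_left.mono (hball.trans hNN),
      hf.smooth_right.mono (hball.trans hNN), fun q hq => hf.pair q (hNN (hball hq)),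
      fun q hq => hf.contact q (hNN (hball hq)), fun q hq => hf.regular q (hNN (hball hq))⟩,
      fun l => (hκ l).mono hball, fun q hq => (hprop q (hball hq)).1,
      fun q hq => (hprop q (hball hq)).2.1, fun q hq => (hprop q (hball hq)).2.2⟩,
    hc.mono (hball.trans hNN)⟩

variable {g : ℕ} {κ : Fin g → EuclideanSpace ℝ (Fin m) → ℝ} {d : Fin g → ℕ}
  {b : EuclideanSpace ℝ (Fin m)}

theorem IsChartFrame.isCurvatureSphere_symm_iff (h : IsChartFrame L p N y z)
    (hf : IsCurvatureFrame N y z κ d) (hb : b ∈ N) :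
    IsCurvatureSphere L ((extChartAt (𝓡 m) p).symm b) x ↔
      ∃ l, sphereVec y z (κ l) b ∈ x.submodule := by
  have hinv := (extChartAt (𝓡 m) p).right_inv (h b hb).1
  rw [h.isCurvatureSphere_iff hf.toIsLegendreFrame ((extChartAt (𝓡 m) p).map_target (h b hb).1)
    (by rwa [hinv]), hinv]
  constructor
  · rintro ⟨c, hc, hx⟩
    obtain ⟨l, rfl⟩ := (hf.hasEigenvalue_iff b hb c).1 hc
    exact ⟨l, hx⟩
  · rintro ⟨l, hx⟩
    exact ⟨κ l b, (hf.hasEigenvalue_iff b hb _).2 ⟨l, rfl⟩, hx⟩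

theorem IsChartFrame.mem_principalSpace_symm_iff (h : IsChartFrame L p N y z)
    (hf : IsCurvatureFrame N y z κ d) (hb : b ∈ N) {l : Fin g}
    (hx : sphereVec y z (κ l) b ∈ x.submodule)
    (X : TangentSpace (𝓡 m) ((extChartAt (𝓡 m) p).symm b)) (ξ : EuclideanSpace ℝ (Fin m))
    (hξ : mfderiv (𝓡 m) 𝓘(ℝ, EuclideanSpace ℝ (Fin m)) (extChartAt (𝓡 m) p)
      ((extChartAt (𝓡 m) p).symm b) X = ξ) :
    X ∈ principalSpace L ((extChartAt (𝓡 m) p).symm b) x ↔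
      ξ ∈ Module.End.eigenspace (shapeOp y z b).toLinearMap (κ l b) := by
  have hinv := (extChartAt (𝓡 m) p).right_inv (h b hb).1
  have h1 : sphereVec y z (κ l) b = (-κ l b) • y b + (1 : ℝ) • z b := by
    rw [sphereVec]; module
  have h2 := h.mem_principalSpace_iff hf.toIsLegendreFrame (x := x) (r := -κ l b) (s := 1)
    ((extChartAt (𝓡 m) p).map_target (h b hb).1) (by rwa [hinv])
    (by rw [hinv, ← h1]; exact hx) (by rw [hinv, ← h1]; exact hf.sphereVec_ne_zero hb l) X ξ hξ
  rw [h2, hinv, Module.End.mem_eigenspace_iff, one_smul, neg_smul, neg_add_eq_zero, eq_comm]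
  rfl

/-- The Dupin condition implies that the derivative of a curvature sphere vanishes on its principal
space. For multiplicity at least two this holds for every Legendre submanifold; in the case of
multiplicity one the curvature surfaces are the curves tangent to the principal spaces. -/
theorem IsChartFrame.isInfinitesimallyDupin (hD : IsDupin L) (h : IsChartFrame L p N y z)
    (hf : IsCurvatureFrame N y z κ d) : IsInfinitesimallyDupin N y z κ := by
  intro q hq l X hX
  rcases eq_or_ne X 0 with rfl | hX0
  · rw [map_zero]; exact Submodule.zero_mem _
  by_cases hd : 2 ≤ d l
  · exact hf.fderiv_mem_of_two_le finrank_euclideanSpace_fin hq hd hX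
  have hd1 : d l = 1 := by
    have h1 : 0 < d l := by
      rw [← hf.finrank_eq q hq l, Module.finrank_pos_iff_exists_ne_zero]
      exact ⟨⟨X, hX⟩, fun h0 => hX0 (congrArg Subtype.val h0)⟩
    omega
  obtain ⟨γ, ε, hε, hγ0, hγX, hγs, hγi, hγ⟩ := hf.exists_principal_curve hq hX hX0
  set φ := extChartAt (𝓡 m) p with hφ
  -- the integral curve, parametrized by the whole line
  set σ : ℝ → ℝ := fun t => ε / 2 * Real.arctan t with hσ
  have hσmem : ∀ t, σ t ∈ Set.Ioo (-ε) ε := by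
    intro t
    have h1 := Real.neg_pi_div_two_lt_arctan t
    have h2 := Real.arctan_lt_pi_div_two t
    have h3 := Real.pi_lt_four
    constructor <;> simp only [hσ] <;> nlinarith
  have hσd : ∀ t, HasDerivAt σ (ε / 2 * (1 / (1 + t ^ 2))) t := fun t =>
    (Real.hasDerivAt_arctan t).const_mul _
  have hσ' : ∀ t : ℝ, ε / 2 * (1 / (1 + t ^ 2)) ≠ 0 := fun t => by positivity
  have hσ0 : σ 0 = 0 := by simp [hσ]
  have hσs : ContDiff ℝ ∞ σ := contDiff_const.mul Real.contDiff_arctan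
  have hγat : ∀ t, ContDiffAt ℝ ∞ γ (σ t) := fun t => hγs.contDiffAt (isOpen_Ioo.mem_nhds (hσmem t))
  set c : EuclideanSpace ℝ (Fin 1) → EuclideanSpace ℝ (Fin m) := fun τ => γ (σ (τ 0)) with hc
  have hproj : ContDiff ℝ ∞ fun τ : EuclideanSpace ℝ (Fin 1) => τ 0 :=
    (EuclideanSpace.proj (𝕜 := ℝ) (0 : Fin 1)).contDiff
  have hcs : ContDiff ℝ ∞ c := by
    rw [contDiff_iff_contDiffAt]
    intro τ
    exact (hγat (τ 0)).comp τ ((hσs.comp hproj).contDiffAt)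
  have hγσ : ∀ t, HasDerivAt (fun t => γ (σ t)) ((ε / 2 * (1 / (1 + t ^ 2))) • deriv γ (σ t)) t :=
    fun t => ((hγat t).differentiableAt (by simp)).hasDerivAt.scomp t (hσd t)
  have hcd : ∀ τ v, fderiv ℝ c τ v =
      (v 0 * (ε / 2 * (1 / (1 + τ 0 ^ 2)))) • deriv γ (σ (τ 0)) := by
    intro τ v
    have h1 : HasFDerivAt (fun τ : EuclideanSpace ℝ (Fin 1) => τ 0)
        (EuclideanSpace.proj (𝕜 := ℝ) (0 : Fin 1) : EuclideanSpace ℝ (Fin 1) →L[ℝ] ℝ) τ :=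
      (EuclideanSpace.proj (𝕜 := ℝ) (0 : Fin 1)).hasFDerivAt
    have h2 := (hγσ (τ 0)).hasFDerivAt.comp τ h1
    rw [show c = (fun t => γ (σ t)) ∘ fun τ : EuclideanSpace ℝ (Fin 1) => τ 0 from rfl, h2.fderiv,
      mul_smul (v 0)]
    rfl
  have hcN : ∀ τ, c τ ∈ N := fun τ => (hγ _ (hσmem _)).1
  have hct : ∀ τ, c τ ∈ φ.target := fun τ => (h _ (hcN τ)).1
  have hci : Function.Injective c := by
    intro τ τ' hτ
    have h1 := hγi (hσmem _) (hσmem _) hτ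
    have h2 : τ 0 = τ' 0 := Real.arctan_injective (mul_left_cancel₀ (by positivity) h1)
    ext i
    rwa [Subsingleton.elim i 0]
  have hfs : ContMDiff (𝓡 1) (𝓡 m) ∞ (φ.symm ∘ c) :=
    (contMDiffOn_extChartAt_symm p).comp_contMDiff hcs.contMDiff hct
  have hfder : ∀ τ v, mfderiv (𝓡 m) 𝓘(ℝ, EuclideanSpace ℝ (Fin m)) φ (φ.symm (c τ))
      (mfderiv (𝓡 1) (𝓡 m) (φ.symm ∘ c) τ v) = fderiv ℝ c τ v := by
    intro τ v
    have : IsManifold (𝓡 m) 1 M := IsManifold.of_le (n := ∞) (by simp)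
    have h1 : φ ∘ (φ.symm ∘ c) = c := funext fun τ => φ.right_inv (hct τ)
    have h2 := mfderiv_comp (I := 𝓡 1) (I' := 𝓡 m) (I'' := 𝓘(ℝ, EuclideanSpace ℝ (Fin m))) τ
      (g := φ) (f := φ.symm ∘ c)
      (mdifferentiableAt_extChartAt (by
        rw [← extChartAt_source (𝓡 m)]; exact φ.map_target (hct τ)))
      ((hfs τ).mdifferentiableAt (by simp))
    rw [h1, mfderiv_eq_fderiv] at h2
    exact (DFunLike.congr_fun h2 v).symm
  have hne : ∀ τ, sphereVec y z (κ l) (c τ) ≠ 0 := fun τ => hf.sphereVec_ne_zero (hcN τ) l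
  have hmem : ∀ τ, sphereVec y z (κ l) (c τ) ∈ (Projectivization.mk ℝ _ (hne τ)).submodule :=
    fun τ => by rw [Projectivization.submodule_mk]; exact Submodule.mem_span_singleton_self _
  have hbij : ∀ τ, Function.Bijective (mfderiv (𝓡 m) 𝓘(ℝ, EuclideanSpace ℝ (Fin m)) φ
      (φ.symm (c τ))) := fun τ => bijective_mfderiv_chart (φ.map_target (hct τ))
  have hconst := hD 1 (EuclideanSpace ℝ (Fin 1)) (φ.symm ∘ c)
    (fun τ => Projectivization.mk ℝ _ (hne τ)) hfs
    (fun τ τ' hτ => hci (φ.symm.injOn (hct τ) (hct τ') hτ))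
    (fun τ v v' hv => by
      have h1 := hcd τ v
      have h2 := hcd τ v'
      rw [← hfder, hv, hfder, h2] at h1
      have h3 := mul_right_cancel₀ (hσ' (τ 0)) (smul_left_injective ℝ (hγ _ (hσmem _)).2.1 h1)
      refine PiLp.ext fun i => ?_
      rw [Subsingleton.elim i 0]
      exact h3.symm)
    (fun τ => (h.isCurvatureSphere_symm_iff hf (hcN τ)).2 ⟨l, hmem τ⟩)
    (fun τ => by
      ext Z
      rw [LinearMap.mem_range]
      have hprin := h.mem_principalSpace_symm_iff hf (hcN τ) (hmem τ) Z _ rfl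
      refine Iff.trans ?_ hprin.symm
      constructor
      · rintro ⟨v, rfl⟩
        have h1 := (hfder τ v).trans (hcd τ v)
        refine h1 ▸ Submodule.smul_mem _ _ (hγ _ (hσmem _)).2.2
      · intro hZ
        have hone := hf.finrank_eq (c τ) (hcN τ) l
        rw [hd1] at hone
        obtain ⟨a, ha⟩ := (finrank_eq_one_iff_of_nonzero' (⟨_, (hγ _ (hσmem (τ 0))).2.2⟩ :
            Module.End.eigenspace (shapeOp y z (c τ)).toLinearMap (κ l (c τ)))
          (fun h0 => (hγ _ (hσmem (τ 0))).2.1 (congrArg Subtype.val h0))).1 hone ⟨_, hZ⟩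
        refine ⟨EuclideanSpace.single 0 (a / (ε / 2 * (1 / (1 + τ 0 ^ 2)))), (hbij τ).1 ?_⟩
        refine (hfder τ _).trans ((hcd τ _).trans ?_)
        rw [PiLp.single_apply, if_pos rfl, div_mul_cancel₀ _ (hσ' _)]
        exact congrArg Subtype.val ha)
  have hline : ∀ t : ℝ, sphereVec y z (κ l) (γ (σ t)) ∈
      Submodule.span ℝ {sphereVec y z (κ l) q} := by
    intro t
    have h1 := hmem (EuclideanSpace.single 0 t)
    rw [hconst _ 0, Projectivization.submodule_mk] at h1
    simpa [hc, hσ0, hγ0] using h1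
  have hder : HasDerivAt (fun t => sphereVec y z (κ l) (γ (σ t)))
      (fderiv ℝ (sphereVec y z (κ l)) q ((ε / 2) • X)) 0 := by
    have h1 := hγσ 0
    rw [hσ0, hγX.deriv] at h1
    simp only [ne_eq, OfNat.ofNat_ne_zero, not_false_eq_true, zero_pow, add_zero, div_one,
      mul_one] at h1
    have h2 : HasFDerivAt (sphereVec y z (κ l)) (fderiv ℝ (sphereVec y z (κ l)) q) (γ (σ 0)) := by
      rw [hσ0, hγ0]
      exact ((hf.contDiffAt_sphereVec hq l).differentiableAt (by simp)).hasFDerivAt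
    exact h2.comp_hasDerivAt 0 h1
  have h1 := mem_of_hasDerivAt hder (Eventually.of_forall hline)
  rw [map_smul] at h1
  exact (Submodule.smul_mem_iff _ (by positivity)).1 h1

end Chart

/-- If a hyperplane contains the lines of a Legendre submanifold near a point, then there is at most
one curvature sphere: the polar point of the hyperplane lies on all these lines. -/
theorem IsCurvatureFrame.le_one_of_eventually {m : ℕ} {F : Type*} [NormedAddCommGroup F]
    [NormedSpace ℝ F] [FiniteDimensional ℝ F] {g : ℕ} {Ω : Set F} {y z : F → LieSpace m}
    {κ : Fin g → F → ℝ} {d : Fin g → ℕ} {b : F} (hF : Module.finrank ℝ F = m)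
    (h : IsCurvatureFrame Ω y z κ d) (hb : b ∈ Ω) {e : LieSpace m →ₗ[ℝ] ℝ} (he : e ≠ 0)
    (hev : ∀ᶠ q in 𝓝 b, e (y q) = 0 ∧ e (z q) = 0) : g ≤ 1 := by
  obtain ⟨v, hv⟩ := exists_lieForm_eq e
  have hmem : ∀ᶠ q in 𝓝 b, v ∈ Submodule.span ℝ {y q, z q} := by
    filter_upwards [hev.eventually_nhds, h.isOpen.mem_nhds hb] with q hq hqΩ
    have h0 := hq.self_of_nhds
    rw [hv, hv] at h0
    refine h.mem_span_of_orthogonal hF hqΩ h0.1 h0.2 fun X => ?_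
    have h1 := lieForm_fderiv_add (differentiableAt_const v) (h.diff_left hqΩ) (c := 0)
      (hq.mono fun p hp => by rw [← hv]; exact hp.1) X
    simpa using h1
  obtain ⟨r, s, hrs⟩ := Submodule.mem_span_pair.1 hmem.self_of_nhds
  have hdy := h.diff_left hb
  have hdz := h.diff_right hb
  -- the derivative of the section `v - r y - s z`, which vanishes at `b`
  have hprin : ∀ X, r • X + s • shapeOp y z b X = 0 := by
    intro X
    rw [← h.principal_iff hF hb]
    have h1 := fderiv_mem_span_of_section (w := fun q => v - (r • y q + s • z q)) hdy hdz
      ((differentiableAt_const v).sub ((hdy.const_smul r).add (hdz.const_smul s))) (h.pair b hb)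
      (hmem.mono fun q hq => Submodule.sub_mem _ hq (Submodule.mem_span_pair.2 ⟨r, s, rfl⟩))
      (by rw [hrs, sub_self]) X
    have h2 : fderiv ℝ (fun q => v - (r • y q + s • z q)) b X =
        -(r • fderiv ℝ y b X + s • fderiv ℝ z b X) :=
      DFunLike.congr_fun (((hdy.hasFDerivAt.const_smul r).add
        (hdz.hasFDerivAt.const_smul s)).const_sub v).fderiv X
    rw [h2] at h1
    exact (Submodule.neg_mem_iff _).1 h1
  have hs : ∀ l, r + s * κ l b = 0 := by
    intro l
    obtain ⟨ξ, hξ⟩ := ((h.hasEigenvalue_iff b hb (κ l b)).2 ⟨l, rfl⟩).exists_hasEigenvector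
    have h1 : shapeOp y z b ξ = κ l b • ξ := hξ.apply_eq_smul
    have h2 := hprin ξ
    rw [h1, smul_smul, ← add_smul] at h2
    exact (smul_eq_zero.1 h2).resolve_right hξ.2
  by_contra hg
  push Not at hg
  have h01 := (hs ⟨0, by omega⟩).trans (hs ⟨1, hg⟩).symm
  rcases eq_or_ne s 0 with rfl | hs0
  · have hr := hs ⟨0, by omega⟩
    rw [zero_mul, add_zero] at hr
    apply he
    ext x
    rw [hv, ← hrs, hr]
    simp
  · have h2 := h.injective b hb (mul_left_cancel₀ hs0 (add_left_cancel h01))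
    simp at h2

end LieSphere

/-! ### Curvature spheres in a linear subspace -/

namespace LieSphere

open Filter Topology

/-- If finitely many relatively closed sets cover a nonempty open set, then one of them has
interior points. -/
theorem exists_eventually_mem_of_cover {X ι : Type*} [TopologicalSpace X] {A : ι → Set X}
    {U : Set X} (hA : ∀ l, ∀ W ⊆ U, IsOpen W → IsOpen (W \ A l)) (s : Finset ι) :
    ∀ W ⊆ U, IsOpen W → W.Nonempty → (∀ q ∈ W, ∃ l ∈ s, q ∈ A l) →
      ∃ l, ∃ q ∈ W, ∀ᶠ q' in 𝓝 q, q' ∈ A l := by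
  classical
  induction s using Finset.induction_on with
  | empty =>
    rintro W - - ⟨q, hq⟩ hc
    obtain ⟨l, hl, -⟩ := hc q hq
    simp at hl
  | insert a s _ ih =>
    intro W hWU hW hne hc
    by_cases hWa : (W \ A a).Nonempty
    · obtain ⟨l, q, hq, hl⟩ := ih (W \ A a) (Set.sdiff_subset.trans hWU) (hA a W hWU hW) hWa
        fun q hq => by
          obtain ⟨l, hl, hql⟩ := hc q hq.1
          rcases Finset.mem_insert.1 hl with rfl | hl
          · exact absurd hql hq.2
          · exact ⟨l, hl, hql⟩
      exact ⟨l, q, hq.1, hl⟩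
    · obtain ⟨q, hq⟩ := hne
      refine ⟨a, q, hq, eventually_of_mem (hW.mem_nhds hq) fun q' hq' => ?_⟩
      by_contra hno
      exact hWa ⟨q', hq', hno⟩

section Manifold

variable {m : ℕ} {M : Type*} [TopologicalSpace M] [ChartedSpace (EuclideanSpace ℝ (Fin m)) M]
  {L : M → LieLines m} {p : M} {E : Submodule ℝ (LieSpace m)} {g : ℕ}

/-- The vector field `k` represents a curvature sphere with values in `E` near `p`. -/
def IsSphereGerm (L : M → LieLines m) (E : Submodule ℝ (LieSpace m)) (p : M) (k : M → LieSpace m) :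
    Prop :=
  ∀ᶠ q in 𝓝 p, ContMDiffAt (𝓡 m) 𝓘(ℝ, LieSpace m) ∞ k q ∧ k q ≠ 0 ∧ k q ∈ E ∧
    ∀ x : ℙ ℝ (LieSpace m), k q ∈ x.submodule → IsCurvatureSphere L q x

theorem mem_line_of_forall_isCurvatureSphere {v : LieSpace m} (hv : v ≠ 0)
    (h : ∀ x : ℙ ℝ (LieSpace m), v ∈ x.submodule → IsCurvatureSphere L p x) : v ∈ (L p).1 := by
  have h1 : v ∈ (Projectivization.mk ℝ v hv).submodule := by
    rw [Projectivization.submodule_mk]; exact Submodule.mem_span_singleton_self _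
  exact (h _ h1).1 h1

variable [IsManifold (𝓡 m) ∞ M]

/-- Local representatives of all the curvature spheres; by unique continuation each of them that lies
in a linear subspace near one point does so throughout. -/
theorem exists_local_curvatureSpheres (hL : IsLegendre L) (hD : IsDupin L)
    (hg : ∀ q, {x | IsCurvatureSphere L q x}.encard = g) (p : M) :
    ∃ (U : Set M) (k : Fin g → M → LieSpace m), IsOpen U ∧ p ∈ U ∧
      (∀ l, ContMDiffOn (𝓡 m) 𝓘(ℝ, LieSpace m) ∞ (k l) U) ∧ (∀ q ∈ U, ∀ l, k l q ≠ 0) ∧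
      (∀ q ∈ U, ∀ x, IsCurvatureSphere L q x ↔ ∃ l, k l q ∈ x.submodule) ∧
      ∀ E : Submodule ℝ (LieSpace m), ∀ l, ∀ q ∈ U, (∀ᶠ q' in 𝓝 q, k l q' ∈ E) →
        ∀ q' ∈ U, k l q' ∈ E := by
  obtain ⟨N, y, z, κ, d, hpN, hNc, hf, hc⟩ := hL.exists_curvatureFrame hg p
  have hinf := hc.isInfinitesimallyDupin hD hf
  set φ := extChartAt (𝓡 m) p with hφ
  refine ⟨φ.source ∩ φ ⁻¹' N, fun l => sphereVec y z (κ l) ∘ φ,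
    isOpen_extChartAt_preimage' p hf.isOpen, ⟨mem_extChartAt_source p, hpN⟩, ?_, ?_, ?_, ?_⟩
  · intro l
    refine (contMDiffOn_iff_contDiffOn.2 fun q hq =>
      (hf.contDiffAt_sphereVec hq l).contDiffWithinAt : ContMDiffOn _ _ _ _ N).comp
      ((contMDiffOn_extChartAt (n := ∞)).mono fun q hq => ?_) fun q hq => hq.2
    rw [← extChartAt_source (𝓡 m)]
    exact hq.1
  · exact fun q hq l => hf.sphereVec_ne_zero hq.2 l
  · intro q hq x
    have h1 := hc.isCurvatureSphere_symm_iff hf hq.2 (x := x)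
    rwa [← hφ, φ.left_inv hq.1] at h1
  · intro E l q hq hev q' hq'
    by_contra hno
    obtain ⟨e, he, hE⟩ := Submodule.exists_le_ker_of_notMem hno
    apply he
    have hcont : Tendsto φ.symm (𝓝 (φ q)) (𝓝 q) := by
      have h1 := (continuousOn_extChartAt_symm (I := 𝓡 m) p).continuousAt
        ((isOpen_extChartAt_target p).mem_nhds (hc _ hq.2).1)
      rwa [ContinuousAt, ← hφ, φ.left_inv hq.1] at h1
    refine hf.eqOn_zero_of_eventually finrank_euclideanSpace_fin hinf hNc e l hq.2 ?_ (φ q') hq'.2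
    filter_upwards [hcont.eventually hev, hf.isOpen.mem_nhds hq.2] with b hb hbN
    have h1 := hE hb
    rw [Function.comp, φ.right_inv (hc b hbN).1] at h1
    exact h1

/-- Lines in a fixed hyperplane leave room for at most one curvature sphere. -/
theorem le_one_of_eventually_le (hL : IsLegendre L)
    (hg : ∀ q, {x | IsCurvatureSphere L q x}.encard = g) (hE : E < ⊤)
    (hev : ∀ᶠ q in 𝓝 p, (L q).1 ≤ E) : g ≤ 1 := by
  obtain ⟨N, y, z, κ, d, hpN, hNc, hf, hc⟩ := hL.exists_curvatureFrame hg p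
  obtain ⟨e, he, hEe⟩ := Submodule.exists_le_ker_of_lt_top E hE
  refine hf.le_one_of_eventually finrank_euclideanSpace_fin hpN he ?_
  have hcont : Tendsto (extChartAt (𝓡 m) p).symm (𝓝 (extChartAt (𝓡 m) p p)) (𝓝 p) := by
    have h1 := continuousAt_extChartAt_symm (I := 𝓡 m) p
    rwa [ContinuousAt, extChartAt_to_inv] at h1
  filter_upwards [hcont.eventually hev, hf.isOpen.mem_nhds hpN] with b hb hbN
  rw [(hc b hbN).2] at hb
  exact ⟨hEe (hb (Submodule.subset_span (by simp))), hEe (hb (Submodule.subset_span (by simp)))⟩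

/-- Curvature spheres in a proper subspace near a point are unique there. -/
theorem IsSphereGerm.mem_span (hL : IsLegendre L)
    (hg : ∀ q, {x | IsCurvatureSphere L q x}.encard = g) (hE : E < ⊤) {k k' : M → LieSpace m}
    (hk : IsSphereGerm L E p k) (hk' : IsSphereGerm L E p k') :
    k' p ∈ Submodule.span ℝ {k p} := by
  by_contra hno
  obtain ⟨hc, h0, -, hx⟩ := hk.self_of_nhds
  obtain ⟨hc', h0', -, hx'⟩ := hk'.self_of_nhds
  have hind : LinearIndependent ℝ ![k p, k' p] := by
    rw [LinearIndependent.pair_iff' h0]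
    exact fun a ha => hno (ha ▸ Submodule.smul_mem _ a (Submodule.mem_span_singleton_self _))
  have hcont : ContinuousAt (fun q => ![k q, k' q]) p := by
    refine continuousAt_pi.2 fun i => ?_
    fin_cases i
    · exact hc.continuousAt
    · exact hc'.continuousAt
  -- two curvature spheres in `E` span the line
  have hle : ∀ᶠ q in 𝓝 p, (L q).1 ≤ E := by
    filter_upwards [hcont.eventually (isOpen_setOfPred_linearIndependent.mem_nhds hind), hk, hk']
      with q hq h h'
    have hsub : Submodule.span ℝ (Set.range ![k q, k' q]) ≤ (L q).1 := by
      rw [Submodule.span_le]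
      rintro _ ⟨i, rfl⟩
      fin_cases i
      · exact mem_line_of_forall_isCurvatureSphere h.2.1 h.2.2.2
      · exact mem_line_of_forall_isCurvatureSphere h'.2.1 h'.2.2.2
    have heq := Submodule.eq_of_le_of_finrank_eq hsub (by
      rw [finrank_span_eq_card hq, (L q).2.1]; simp)
    rw [← heq, Submodule.span_le]
    rintro _ ⟨i, rfl⟩
    fin_cases i
    · exact h.2.2.1
    · exact h'.2.2.1
  have hg1 := le_one_of_eventually_le hL hg hE hle
  have hsub : {x | IsCurvatureSphere L p x}.encard ≤ 1 := by
    rw [hg]; exact_mod_cast hg1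
  have hm : ∀ {v : LieSpace m} (hv : v ≠ 0), v ∈ (Projectivization.mk ℝ v hv).submodule :=
    fun hv => by rw [Projectivization.submodule_mk]; exact Submodule.mem_span_singleton_self _
  have heq := Set.encard_le_one_iff.1 hsub _ _ (hx _ (hm h0)) (hx' _ (hm h0'))
  apply hno
  have h1 := hm h0'
  rwa [← heq, Projectivization.submodule_mk] at h1

/-- The points near which some curvature sphere lies in `E` form an open and closed set. -/
theorem exists_isSphereGerm (hL : IsLegendre L) (hD : IsDupin L)
    (hg : ∀ q, {x | IsCurvatureSphere L q x}.encard = g) [ConnectedSpace M] {U : Set M}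
    (hU : IsOpen U) (hUne : U.Nonempty)
    (hUE : ∀ q ∈ U, ∃ x, IsCurvatureSphere L q x ∧ x.submodule ≤ E) (p : M) :
    ∃ k, IsSphereGerm L E p k := by
  have hlocal : ∀ p : M, ∃ W : Set M, IsOpen W ∧ p ∈ W ∧ ∀ q ∈ W,
      (∀ᶠ q' in 𝓝 q, ∃ x, IsCurvatureSphere L q' x ∧ x.submodule ≤ E) →
        ∃ k, ∀ q' ∈ W, IsSphereGerm L E q' k := by
    intro p
    obtain ⟨W, k, hW, hpW, hks, hk0, hkx, hku⟩ := exists_local_curvatureSpheres hL hD hg p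
    refine ⟨W, hW, hpW, fun q hq hev => ?_⟩
    obtain ⟨V, hV, hVo, hqV⟩ := mem_nhds_iff.1 (inter_mem hev (hW.mem_nhds hq))
    obtain ⟨l, q₁, hq₁, hl⟩ := exists_eventually_mem_of_cover (A := fun l => {q | k l q ∈ E})
      (U := W) (fun l V hVW hVo => by
        have h1 := ((hks l).continuousOn.mono hVW).isOpen_inter_preimage hVo
          (Submodule.closed_of_finiteDimensional E).isOpen_compl
        exact h1) Finset.univ V (fun q hq => (hV hq).2) hVo ⟨q, hqV⟩ (fun q' hq' => by
        obtain ⟨x, hx, hxE⟩ := (hV hq').1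
        obtain ⟨l, hl⟩ := (hkx q' (hV hq').2 x).1 hx
        exact ⟨l, Finset.mem_univ l, hxE hl⟩)
    have hall := hku E l q₁ (hV hq₁).2 hl
    refine ⟨k l, fun q' hq' => ?_⟩
    filter_upwards [hW.mem_nhds hq'] with v hv
    exact ⟨(hks l).contMDiffAt (hW.mem_nhds hv), hk0 v hv l, hall v hv,
      fun x hx => (hkx v hv x).2 ⟨l, hx⟩⟩
  have hcl : IsClopen {q : M | ∀ᶠ q' in 𝓝 q, ∃ x, IsCurvatureSphere L q' x ∧ x.submodule ≤ E} := by
    refine ⟨isClosed_of_closure_subset fun p hp => ?_, isOpen_setOfPred_eventually_nhds⟩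
    obtain ⟨W, hW, hpW, hprop⟩ := hlocal p
    obtain ⟨q, hqW, hq⟩ := mem_closure_iff.1 hp W hW hpW
    obtain ⟨k, hk⟩ := hprop q hqW hq
    refine (hk p hpW).mono fun v hv => ⟨Projectivization.mk ℝ (k v) hv.2.1, hv.2.2.2 _ ?_, ?_⟩
    · rw [Projectivization.submodule_mk]; exact Submodule.mem_span_singleton_self _
    · rw [Projectivization.submodule_mk, Submodule.span_singleton_le_iff_mem]
      exact hv.2.2.1
  have huniv := hcl.eq_univ (by
    obtain ⟨q, hq⟩ := hUne
    exact ⟨q, eventually_of_mem (hU.mem_nhds hq) hUE⟩)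
  obtain ⟨W, -, hpW, hprop⟩ := hlocal p
  have hp : p ∈ {q : M | ∀ᶠ q' in 𝓝 q, ∃ x, IsCurvatureSphere L q' x ∧ x.submodule ≤ E} := by
    rw [huniv]; trivial
  obtain ⟨k, hk⟩ := hprop p hpW hp
  exact ⟨k, hk p hpW⟩

/-- A proper Dupin submanifold which is reducible on a nonempty open set is reducible. -/
theorem IsProperDupin.reducible_of_reducibleOn [ConnectedSpace M] (hL : IsProperDupin L) {U : Set M}
    (hU : IsOpen U) (hUne : U.Nonempty) (hred : ReducibleOn L U) : Reducible L := by
  obtain ⟨x₀, E, hx₀, hcodim, hE⟩ := hred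
  obtain ⟨g, hg⟩ := hL.proper
  have hEtop : E < ⊤ := by
    rw [lt_top_iff_ne_top]
    rintro rfl
    have := Submodule.Quotient.subsingleton_iff.2 (rfl : (⊤ : Submodule ℝ (LieSpace m)) = ⊤)
    rw [Module.finrank_zero_of_subsingleton] at hcodim
    omega
  choose k hk using exists_isSphereGerm hL.legendre hL.dupin hg hU hUne
    (fun q hq => ⟨x₀ q, hx₀.1 q hq, hE q hq⟩)
  have hk0 : ∀ p, k p p ≠ 0 := fun p => (hk p).self_of_nhds.2.1
  have hmem : ∀ p, k p p ∈ (Projectivization.mk ℝ _ (hk0 p)).submodule := fun p => by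
    rw [Projectivization.submodule_mk]; exact Submodule.mem_span_singleton_self _
  refine ⟨fun p => Projectivization.mk ℝ _ (hk0 p), E,
    ⟨fun p _ => (hk p).self_of_nhds.2.2.2 _ (hmem p), fun p _ => ?_⟩, hcodim, fun p _ => ?_⟩
  · obtain ⟨W, hW, hWo, hpW⟩ := eventually_nhds_iff.1 (hk p)
    refine ⟨W, k p, hWo, hpW, Set.subset_univ _, fun q hq => (hW q hq).1.contMDiffWithinAt,
      fun q hq => ⟨(hW q hq).2.1, ?_⟩⟩
    rw [Projectivization.submodule_mk]
    exact (hk q).mem_span hL.legendre hg hEtop (eventually_of_mem (hWo.mem_nhds hq) hW)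
  · rw [Projectivization.submodule_mk, Submodule.span_singleton_le_iff_mem]
    exact (hk p).self_of_nhds.2.2.1

end Manifold

end LieSphere

theorem proposition4 {m : ℕ} {M : Type*} [TopologicalSpace M]
    [ChartedSpace (EuclideanSpace ℝ (Fin m)) M] [IsManifold (𝓡 m) ∞ M]
    [T2Space M] [SecondCountableTopology M] [ConnectedSpace M]
    (L : M → LieLines m) (hL : LieSphere.IsProperDupin L) :
    (∀ U : Set M, IsOpen U → U.Nonempty → LieSphere.ReducibleOn L U → LieSphere.Reducible L) ∧
      (LieSphere.LocallyIrreducible L ↔ LieSphere.Irreducible L) := by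
  have h : ∀ U : Set M, IsOpen U → U.Nonempty → LieSphere.ReducibleOn L U → LieSphere.Reducible L :=
    fun U hU hne hred => hL.reducible_of_reducibleOn hU hne hred
  exact ⟨h, fun hloc => hloc Set.univ isOpen_univ Set.univ_nonempty,
    fun hirr O hO hne hred => hirr (h O hO hne hred)⟩
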